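/- **Setting.** Let $n\ge 3$, $t\ge 1$, and let $\mathbf s=(s_1,\dots,s_t)$, $\mathbf k=(k_1,\dots,k_t)$ be vectors of positive integers with $k_1\ge k_2\ge\dots\ge k_t\ge 1$. In the $(\mathbf s,\mathbf k,t)$ asymmetric document exchange problem Alice holds $x\in\{0,1\}^n$ and Bob holds $y\in\{0,1\}^n$; both know $n,t,\mathbf s,\mathbf k$; in addition Bob (but not Alice) knows pairwise disjoint sets $S_1,\dots,S_t\subseteq[n]$ with $|S_i|=s_i$ such that $x$ and $y$ agree outside $S_1\cup\dots\cup S_t$ and differ in at most $k_i$ positions of $S_i$, for every $i$. In a one-round randomized protocol with shared randomness, Alice and Bob share an infinite string of independent fair coin tosses (which each of them can access at any position), Alice sends one bit string to Bob, and Bob then outputs a string; the protocol succeeds if Bob outputs $x$. The communication is the length of Alice's message. The two parties are fixed programs (the same for all inputs and all parameters) of a random access machine on natural numbers with logarithmic cost, i.e. every elementary operation costs the bit length of the numbers and addresses involved (equivalently, up to factors polylogarithmic in $n$, a word RAM with words of $O(\log n)$ bits); the running time is the sum of the two costs. Put $s=\sum_i s_i$ and $$\mathsf H(\mathbf s,\mathbf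 k)=\sum_{i=1}^{t}\log_2\Big(\sum_{j=0}^{k_i}\binom{s_i}{j}\Big).$$ **Statement.** Suppose that $s_i\ge 2k_i$ for all $i$. There is an efficient one-round randomized protocol for Bob to learn Alice's string, with communication $O((\log\log n)^2\,\mathsf H(\mathbf s,\mathbf k))$ and error probability $2^{-\Omega(k_t)}+1/\mathrm{poly}(s)$, running in time $\widetilde O(n)$. Precisely: for every $a\in\mathbb N$ there are a one-round protocol and constants $C,c>0$ and $d\in\mathbb N$, depending only on $a$, such that for all $n,t,\mathbf s,\mathbf k$ as above with $s_i\ge 2k_i$ for all $i$, and for all $x,y,S_1,\dots,S_t$ as above, * for every outcome of the shared randomness, both programs halt, Alice's message has at most $C(\log_2\log_2 n)^2\,\mathsf H(\mathbf s,\mathbf k)$ bits, and the total running time is at most $C\,n(\log_2 n)^d$; * with probability at least $1-\big(2^{-c k_t}+s^{-a}\big)$ over the shared randomness, Bob outputs $x$. -/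

import Mathlib

open MeasureTheory

namespace AsymDE

/-! ### A random access machine with logarithmic cost

The machine has natural number registers, finitely many of which are used by a given program,
unbounded arrays of natural numbers, random access to an infinite tape of random bits,
and a write-only output tape of bits. -/

/-- The state of the machine: registers, arrays (`arr A j` is entry `j` of array `A`), and the bits
written so far. -/
structure RamState where
  reg : ℕ → ℕ
  arr : ℕ → ℕ → ℕ
  out : List Bool

/-- The arithmetic operations on natural numbers (`sub` is truncated, `div` is rounded down). -/
inductive BinOp
  | add | sub | mul | div | mod | lt | eq

/-- The value of an arithmetic operation; comparisons return `0` or `1`. -/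
def BinOp.eval : BinOp → ℕ → ℕ → ℕ
  | .add, a, b => a + b
  | .sub, a, b => a - b
  | .mul, a, b => a * b
  | .div, a, b => a / b
  | .mod, a, b => a % b
  | .lt, a, b => if a < b then 1 else 0
  | .eq, a, b => if a = b then 1 else 0

/-- Expressions: constants, registers, array entries `A[e]`, random bits, arithmetic. -/
inductive RamExpr
  | const (v : ℕ)
  | reg (r : ℕ)
  | load (A : ℕ) (e : RamExpr)
  | coin (e : RamExpr)
  | bin (o : BinOp) (e₁ e₂ : RamExpr)

/-- The value of an expression, when the random tape is `ω`. -/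
def RamExpr.eval (ω : ℕ → Bool) (σ : RamState) : RamExpr → ℕ
  | .const v => v
  | .reg r => σ.reg r
  | .load A e => σ.arr A (e.eval ω σ)
  | .coin e => (ω (e.eval ω σ)).toNat
  | .bin o e₁ e₂ => o.eval (e₁.eval ω σ) (e₂.eval ω σ)

/-- The logarithmic cost of an expression: every elementary operation (including an access to
memory or to the random tape) costs one plus the bit lengths of its operands, of its address
and of its result. -/
def RamExpr.cost (ω : ℕ → Bool) (σ : RamState) : RamExpr → ℕ
  | .const v => 1 + v.size
  | .reg r => 1 + (σ.reg r).size
  | .load A e => e.cost ω σ + (1 + (e.eval ω σ).size + (σ.arr A (e.eval ω σ)).size)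
  | .coin e => e.cost ω σ + (1 + (e.eval ω σ).size)
  | .bin o e₁ e₂ => e₁.cost ω σ + e₂.cost ω σ +
      (1 + (e₁.eval ω σ).size + (e₂.eval ω σ).size +
        (o.eval (e₁.eval ω σ) (e₂.eval ω σ)).size)

/-- Programs. -/
inductive Prog
  | skip
  | assign (r : ℕ) (e : RamExpr)
  | store (A : ℕ) (i e : RamExpr)
  | emit (e : RamExpr)
  | seq (p q : Prog)
  | cond (e : RamExpr) (p q : Prog)
  | loop (e : RamExpr) (p : Prog)

/-- `Exec ω p σ T τ`: with random tape `ω`, the program `p` started in the state `σ` halts in the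
state `τ` after a computation of logarithmic cost exactly `T`.
`cond e p q` runs `p` if `e ≠ 0` and `q` otherwise; `loop e p` runs `p` while `e ≠ 0`;
`emit e` writes the bit `e ≠ 0` at the end of the output. -/
inductive Exec (ω : ℕ → Bool) : Prog → RamState → ℕ → RamState → Prop
  | skip (σ) : Exec ω .skip σ 1 σ
  | assign (σ r e) : Exec ω (.assign r e) σ (1 + e.cost ω σ)
      ⟨Function.update σ.reg r (e.eval ω σ), σ.arr, σ.out⟩
  | store (σ A i e) : Exec ω (.store A i e) σ (1 + i.cost ω σ + e.cost ω σ)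
      ⟨σ.reg, Function.update σ.arr A
        (Function.update (σ.arr A) (i.eval ω σ) (e.eval ω σ)), σ.out⟩
  | emit (σ e) : Exec ω (.emit e) σ (1 + e.cost ω σ)
      ⟨σ.reg, σ.arr, σ.out ++ [decide (e.eval ω σ ≠ 0)]⟩
  | seq {p q σ σ' τ T T'} : Exec ω p σ T σ' → Exec ω q σ' T' τ →
      Exec ω (.seq p q) σ (T + T') τ
  | cond_true {e p q σ τ T} : e.eval ω σ ≠ 0 → Exec ω p σ T τ →
      Exec ω (.cond e p q) σ (1 + e.cost ω σ + T) τ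
  | cond_false {e p q σ τ T} : e.eval ω σ = 0 → Exec ω q σ T τ →
      Exec ω (.cond e p q) σ (1 + e.cost ω σ + T) τ
  | loop_stop {e p σ} : e.eval ω σ = 0 →
      Exec ω (.loop e p) σ (1 + e.cost ω σ) σ
  | loop_step {e p σ σ' τ T T'} : e.eval ω σ ≠ 0 → Exec ω p σ T σ' →
      Exec ω (.loop e p) σ' T' τ →
      Exec ω (.loop e p) σ (1 + e.cost ω σ + T + T') τ

/-- With random tape `ω`, the program `p` started in the state `σ` halts after a computation of
cost `T` with the bit string `w` on its output tape. -/
def Outputs (p : Prog) (ω : ℕ → Bool) (σ : RamState) (T : ℕ) (w : List Bool) : Prop :=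
  ∃ τ, Exec ω p σ T τ ∧ τ.out = w

/-! ### Asymmetric document exchange -/

/-- A finite vector as the contents of an array, followed by zeros. -/
def toArr {m : ℕ} (v : Fin m → ℕ) (j : ℕ) : ℕ := if h : j < m then v ⟨j, h⟩ else 0

/-- The vector of disjoint subsets `S`, given to the machine as the vector of length `n` whose
entry at the position `j` is `i + 1` if `j ∈ S i`, and `0` if `j` is in none of the subsets. -/
def labels {n t : ℕ} (S : Fin t → Finset (Fin n)) (j : Fin n) : ℕ :=
  ∑ i, if j ∈ S i then (i : ℕ) + 1 else 0

/-- What Alice knows at the beginning: `n`, `t` in the registers 0 and 1, and `s`, `k`, `x` in the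
arrays 0, 1, 2. -/
def aliceInput {n t : ℕ} (s k : Fin t → ℕ) (x : Fin n → Bool) : RamState where
  reg
    | 0 => n
    | 1 => t
    | _ => 0
  arr
    | 0 => toArr s
    | 1 => toArr k
    | 2 => toArr fun j => (x j).toNat
    | _ => fun _ => 0
  out := []

/-- What Bob knows when he has received the message `w`: `n`, `t` and the length of `w` in the
registers 0, 1, 2, and `s`, `k`, `y`, `S`, `w` in the arrays 0, 1, 2, 3, 4. -/
def bobInput {n t : ℕ} (s k : Fin t → ℕ) (y : Fin n → Bool) (S : Fin t → Finset (Fin n))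
    (w : List Bool) : RamState where
  reg
    | 0 => n
    | 1 => t
    | 2 => w.length
    | _ => 0
  arr
    | 0 => toArr s
    | 1 => toArr k
    | 2 => toArr fun j => (y j).toNat
    | 3 => toArr (labels S)
    | 4 => fun j => (w.getD j false).toNat
    | _ => fun _ => 0
  out := []

/-- The inputs `x`, `y`, `S` are consistent with the parameters `s`, `k`: the subsets are disjoint
and have the prescribed sizes, `x` and `y` differ only inside them, and in at most `k i` positions
of `S i`. -/
structure Consistent {n t : ℕ} (s k : Fin t → ℕ) (x y : Fin n → Bool)
    (S : Fin t → Finset (Fin n)) : Prop where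
  disjoint : ∀ i j, i ≠ j → Disjoint (S i) (S j)
  card_eq : ∀ i, (S i).card = s i
  eq_outside : ∀ j, (∀ i, j ∉ S i) → x j = y j
  dist_le : ∀ i, ((S i).filter fun j => x j ≠ y j).card ≤ k i

/-- A one round protocol (with shared randomness) for Bob to learn Alice's string: one program for
each party. The programs are fixed and work for all lengths and all parameters. -/
structure OneRoundProtocol where
  alice : Prog
  bob : Prog

/-- With shared random tape `ω`, Alice sends the message `w`, then Bob outputs the bit string `z`,
and the two computations have total cost `T`. -/
def OneRoundProtocol.Runs (P : OneRoundProtocol) {n t : ℕ} (s k : Fin t → ℕ)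
    (x y : Fin n → Bool) (S : Fin t → Finset (Fin n)) (ω : ℕ → Bool)
    (w z : List Bool) (T : ℕ) : Prop :=
  ∃ T₁ T₂, Outputs P.alice ω (aliceInput s k x) T₁ w ∧
    Outputs P.bob ω (bobInput s k y S w) T₂ z ∧ T = T₁ + T₂

/-- With shared random tape `ω`, Bob learns Alice's string. -/
def OneRoundProtocol.Succeeds (P : OneRoundProtocol) {n t : ℕ} (s k : Fin t → ℕ)
    (x y : Fin n → Bool) (S : Fin t → Finset (Fin n)) (ω : ℕ → Bool) : Prop :=
  ∃ w T, P.Runs s k x y S ω w (List.ofFn x) T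

/-- The law of an infinite sequence of independent fair coin tosses. -/
noncomputable def coinTape : Measure (ℕ → Bool) :=
  Measure.infinitePi fun _ => (PMF.uniformOfFintype Bool).toMeasure

/-- `H(s, k) = ∑ᵢ log₂ (∑_{j ≤ kᵢ} (sᵢ choose j))`. -/
noncomputable def entropyH {t : ℕ} (s k : Fin t → ℕ) : ℝ :=
  ∑ i, Real.logb 2 (∑ j ∈ Finset.range (k i + 1), ((s i).choose j : ℝ))

end AsymDE

/-! ### A step-counting Hoare logic for the machine. -/

namespace AsymDE

/-! ### Bounded states and the cost of expressions -/

/-! Let `D i` be the bit length of `s i / k i` and `H = ∑ k i * D i`. Since `s i / k i ≥ 2`, `H` is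
at most twice the entropy (`roundedH_le_entropyH`). Choose `β` with `2^14 * H < 2^β ≤ 2^15 * H`, and
let `λ` be about `log log n`. The protocol has stages `m = 0, …, min λ β`. In each of the `C * 2^m *
λ` repetitions of stage `m`, all positions are hashed with fresh coins into `2^(β-m)` buckets, and
Alice sends the parity of `x` in every bucket. Adding the parities of his current estimate, Bob gets
the parity of the number of errors in each bucket. At the end of the stage he flips every position
whose block has `D ≤ 2^m` and whose bucket was odd in a majority of the repetitions. The product of
repetitions and buckets does not depend on `m` (`reps_mul_pow`), so the message has `O(λ^2 * H)`
bits.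

The invariant `Sched.Inv` controls the errors before stage `m`. Blocks with `2^m < 2 * D` are
untouched, so they contain at most `2 * H / 2^m` errors because each error there accounts for `D`
units of `H`. The other blocks contain at most `2^(β-m-13)` errors. Together the errors fill at most
a fraction `2^(-12)` of the buckets, so a given position rarely shares its bucket with an error at
another position. A repetition without such a collision votes correctly, hence a misjudged position
has collisions in at least half of its repetitions.

Collisions of different positions are not independent, as an error may itself be among the positions
considered. `exists_half_hit` keeps half of the colliding pairs, each with a partner outside the
kept set; the coins of the kept pairs are then free, and `coinTape_collisions_le` and
`coinTape_misjudged_le` give probability `2^(-2*f*R)` that `f` given positions are all misjudged in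
`R` repetitions. There are at most `H * 2^(2^m)` candidates, and `choose_mul_half_pow_le` shows that
the union bound over sets of `f` candidates is affordable once `f * 2^m ≥ H`. The current errors may
be treated as fixed because each stage uses new coins (`coinTape_conditional`).

If Bob fails, some stage had too many misjudged positions, or the stage `λ` had at least one
(`Sched.exists_bad_stage`). The first kind of event costs `2^(-H)`, which is at most `2^(-k i)` for
every `i`; the second costs at most `s * 2^(-2*R)`, where `R` exceeds `(a+1) * log n`
(`Sched.coinTape_errSet_le`). The programs are verified by `post_progAlice` and `post_progBob`; both
parties share the loop of `post_progStages`, so they read the same coins. -/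

/-- All registers and array entries are at most `V`. -/
def Bdd (V : ℕ) (σ : RamState) : Prop :=
  (∀ r, σ.reg r ≤ V) ∧ ∀ A j, σ.arr A j ≤ V

/-- The bit length of the value of `e` is at most `e.wt` times that of a bound on the state. -/
def RamExpr.wt : RamExpr → ℕ
  | .const v => v.size
  | .reg _ => 1
  | .load _ _ => 1
  | .coin _ => 1
  | .bin _ e₁ e₂ => e₁.wt + e₂.wt + 1

/-- The cost of `e` is at most `e.kap` times the bit length of a bound on the state. -/
def RamExpr.kap : RamExpr → ℕ
  | .const v => 1 + v.size
  | .reg _ => 1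
  | .load _ e => e.kap + e.wt + 1
  | .coin e => e.kap + e.wt + 1
  | .bin _ e₁ e₂ => e₁.kap + e₂.kap + 2 * (e₁.wt + e₂.wt) + 2

theorem size_add_le (a b : ℕ) : (a + b).size ≤ a.size + b.size + 1 := by
  rw [Nat.size_le, pow_succ, pow_add]
  have ha := Nat.lt_size_self a
  have hb := Nat.lt_size_self b
  nlinarith [Nat.zero_le a, Nat.zero_le b]

theorem size_mul_le (a b : ℕ) : (a * b).size ≤ a.size + b.size := by
  rw [Nat.size_le, pow_add]
  exact Nat.mul_lt_mul'' (Nat.lt_size_self a) (Nat.lt_size_self b)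

theorem BinOp.size_eval_le (o : BinOp) (a b : ℕ) : (o.eval a b).size ≤ a.size + b.size + 1 := by
  cases o with
  | add => exact size_add_le a b
  | sub => exact (Nat.size_le_size (Nat.sub_le a b)).trans (by omega)
  | mul => exact (size_mul_le a b).trans (by omega)
  | div => exact (Nat.size_le_size (Nat.div_le_self a b)).trans (by omega)
  | mod => exact (Nat.size_le_size (Nat.mod_le a b)).trans (by omega)
  | lt => simp only [BinOp.eval]; split_ifs <;> simp
  | eq => simp only [BinOp.eval]; split_ifs <;> simp

/-- Intermediate values may exceed `V`, but every operation at most adds bit lengths, up to one. A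
syntactic weight therefore bounds them linearly in the bit length of `V`. -/
theorem RamExpr.size_eval_le {ω : ℕ → Bool} {V : ℕ} {σ : RamState} (h : Bdd V σ) (e : RamExpr) :
    (e.eval ω σ).size ≤ e.wt * (V.size + 1) := by
  induction e with
  | const v => simp only [eval, wt]; nlinarith [Nat.zero_le (v.size * V.size)]
  | reg r => simp only [eval, wt]; have := Nat.size_le_size (h.1 r); omega
  | load A e ih => simp only [eval, wt]; have := Nat.size_le_size (h.2 A (e.eval ω σ)); omega
  | coin e ih =>
    simp only [eval, wt]
    cases ω (e.eval ω σ) <;> simp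
  | bin o e₁ e₂ ih₁ ih₂ =>
    simp only [eval, wt]
    have := o.size_eval_le (e₁.eval ω σ) (e₂.eval ω σ)
    nlinarith

theorem RamExpr.cost_le {ω : ℕ → Bool} {V : ℕ} {σ : RamState} (h : Bdd V σ) (e : RamExpr) :
    e.cost ω σ ≤ e.kap * (V.size + 1) := by
  induction e with
  | const v => simp only [cost, kap]; nlinarith [Nat.zero_le (v.size * V.size)]
  | reg r => simp only [cost, kap]; have := Nat.size_le_size (h.1 r); omega
  | load A e ih =>
    simp only [cost, kap]
    have := Nat.size_le_size (h.2 A (e.eval ω σ))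
    have := size_eval_le (ω := ω) h e
    nlinarith
  | coin e ih =>
    simp only [cost, kap]
    have := size_eval_le (ω := ω) h e
    nlinarith
  | bin o e₁ e₂ ih₁ ih₂ =>
    simp only [cost, kap]
    have := o.size_eval_le (e₁.eval ω σ) (e₂.eval ω σ)
    have := size_eval_le (ω := ω) h e₁
    have := size_eval_le (ω := ω) h e₂
    nlinarith

/-! ### Total correctness with a bound on the number of steps -/

/-- The cost of a step of a program whose expressions have weight less than `256`, as long as all
numbers are at most `V`. -/
def stepCost (V : ℕ) : ℕ := 256 * (V.size + 1)

/-- Started in `σ`, the program halts within `N` steps, in a bounded state that satisfies `Q`. -/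
def Post (ω : ℕ → Bool) (V : ℕ) (p : Prog) (σ : RamState) (N : ℕ) (Q : RamState → Prop) : Prop :=
  ∃ τ T, Exec ω p σ T τ ∧ T ≤ N * stepCost V ∧ Bdd V τ ∧ Q τ

variable {ω : ℕ → Bool} {V : ℕ} {σ : RamState} {Q : RamState → Prop}

theorem Bdd.update_reg (h : Bdd V σ) {r v : ℕ} (hv : v ≤ V) :
    Bdd V ⟨Function.update σ.reg r v, σ.arr, σ.out⟩ := by
  refine ⟨fun r' => ?_, h.2⟩
  by_cases hr : r' = r
  · subst hr; simpa
  · simpa [hr] using h.1 r'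

theorem Bdd.update_arr (h : Bdd V σ) {A i v : ℕ} (hv : v ≤ V) :
    Bdd V ⟨σ.reg, Function.update σ.arr A (Function.update (σ.arr A) i v), σ.out⟩ := by
  refine ⟨h.1, fun A' j => ?_⟩
  by_cases hA : A' = A
  · subst hA
    by_cases hj : j = i
    · subst hj; simpa
    · simpa [hj] using h.2 A' j
  · simpa [hA] using h.2 A' j

theorem Post.mono {p : Prog} {N N' : ℕ} {Q' : RamState → Prop} (h : Post ω V p σ N Q)
    (hN : N ≤ N') (hQ : ∀ τ, Bdd V τ → Q τ → Q' τ) : Post ω V p σ N' Q' := by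
  obtain ⟨τ, T, h1, h2, h3, h4⟩ := h
  exact ⟨τ, T, h1, h2.trans (Nat.mul_le_mul_right _ hN), h3, hQ _ h3 h4⟩

theorem Post.skip (hB : Bdd V σ) (hQ : Q σ) : Post ω V .skip σ 1 Q :=
  ⟨σ, 1, .skip σ, by unfold stepCost; omega, hB, hQ⟩

theorem Post.assign (hB : Bdd V σ) {r : ℕ} {e : RamExpr} (hk : e.kap < 256)
    (hv : e.eval ω σ ≤ V) (hQ : Q ⟨Function.update σ.reg r (e.eval ω σ), σ.arr, σ.out⟩) :
    Post ω V (.assign r e) σ 1 Q := by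
  refine ⟨_, _, .assign σ r e, ?_, hB.update_reg hv, hQ⟩
  have := e.cost_le (ω := ω) hB
  unfold stepCost; nlinarith

/-- The constant of the protocol is a parameter, so `kap` of it cannot be compared with `256` by
`decide`; its size is bounded through `v ≤ V` instead. -/
theorem Post.assign_const (hB : Bdd V σ) {r v : ℕ} (hv : v ≤ V)
    (hQ : Q ⟨Function.update σ.reg r v, σ.arr, σ.out⟩) :
    Post ω V (.assign r (.const v)) σ 1 Q := by
  refine ⟨_, _, .assign σ r _, ?_, hB.update_reg hv, hQ⟩
  have := Nat.size_le_size hv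
  simp only [RamExpr.cost]
  unfold stepCost; omega

theorem Post.store (hB : Bdd V σ) {A : ℕ} {i e : RamExpr} (hk : i.kap + e.kap < 256)
    (hv : e.eval ω σ ≤ V) (hQ : Q ⟨σ.reg, Function.update σ.arr A
      (Function.update (σ.arr A) (i.eval ω σ) (e.eval ω σ)), σ.out⟩) :
    Post ω V (.store A i e) σ 1 Q := by
  refine ⟨_, _, .store σ A i e, ?_, hB.update_arr hv, hQ⟩
  have := e.cost_le (ω := ω) hB
  have := i.cost_le (ω := ω) hB
  unfold stepCost; nlinarith

theorem Post.emit (hB : Bdd V σ) {e : RamExpr} (hk : e.kap < 256)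
    (hQ : Q ⟨σ.reg, σ.arr, σ.out ++ [decide (e.eval ω σ ≠ 0)]⟩) :
    Post ω V (.emit e) σ 1 Q := by
  refine ⟨_, _, .emit σ e, ?_, hB, hQ⟩
  have := e.cost_le (ω := ω) hB
  unfold stepCost; nlinarith

theorem Post.seq {p q : Prog} {N₁ N₂ : ℕ} {P : RamState → Prop} (hp : Post ω V p σ N₁ P)
    (hq : ∀ τ, Bdd V τ → P τ → Post ω V q τ N₂ Q) : Post ω V (.seq p q) σ (N₁ + N₂) Q := by
  obtain ⟨τ, T, h1, h2, h3, h4⟩ := hp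
  obtain ⟨τ', T', h1', h2', h3', h4'⟩ := hq τ h3 h4
  exact ⟨τ', T + T', .seq h1 h1', by rw [add_mul]; omega, h3', h4'⟩

theorem Post.seq_assign {N : ℕ} {q : Prog} (hB : Bdd V σ) {r : ℕ} {e : RamExpr}
    (hk : e.kap < 256) (hv : e.eval ω σ ≤ V)
    (hq : Bdd V ⟨Function.update σ.reg r (e.eval ω σ), σ.arr, σ.out⟩ →
      Post ω V q ⟨Function.update σ.reg r (e.eval ω σ), σ.arr, σ.out⟩ N Q) :
    Post ω V (.seq (.assign r e) q) σ (1 + N) Q :=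
  Post.seq (P := fun τ => τ = ⟨Function.update σ.reg r (e.eval ω σ), σ.arr, σ.out⟩)
    (Post.assign hB hk hv rfl) (by rintro τ hτ rfl; exact hq hτ)

theorem Post.seq_store {N : ℕ} {q : Prog} (hB : Bdd V σ) {A : ℕ} {i e : RamExpr}
    (hk : i.kap + e.kap < 256) (hv : e.eval ω σ ≤ V)
    (hq : Bdd V ⟨σ.reg, Function.update σ.arr A
      (Function.update (σ.arr A) (i.eval ω σ) (e.eval ω σ)), σ.out⟩ →
      Post ω V q ⟨σ.reg, Function.update σ.arr A
      (Function.update (σ.arr A) (i.eval ω σ) (e.eval ω σ)), σ.out⟩ N Q) :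
    Post ω V (.seq (.store A i e) q) σ (1 + N) Q :=
  Post.seq (P := fun τ => τ = ⟨σ.reg, Function.update σ.arr A
      (Function.update (σ.arr A) (i.eval ω σ) (e.eval ω σ)), σ.out⟩)
    (Post.store hB hk hv rfl) (by rintro τ hτ rfl; exact hq hτ)

theorem Post.cond {e : RamExpr} {p q : Prog} {N : ℕ} (hB : Bdd V σ) (hk : e.kap < 256)
    (hp : e.eval ω σ ≠ 0 → Post ω V p σ N Q) (hq : e.eval ω σ = 0 → Post ω V q σ N Q) :
    Post ω V (.cond e p q) σ (1 + N) Q := by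
  have hc := e.cost_le (ω := ω) hB
  have hc' : 1 + e.cost ω σ ≤ stepCost V := by unfold stepCost; nlinarith
  by_cases h : e.eval ω σ = 0
  · obtain ⟨τ, T, h1, h2, h3, h4⟩ := hq h
    exact ⟨τ, _, .cond_false h h1, by rw [add_mul]; omega, h3, h4⟩
  · obtain ⟨τ, T, h1, h2, h3, h4⟩ := hp h
    exact ⟨τ, _, .cond_true h h1, by rw [add_mul]; omega, h3, h4⟩

/-- A loop that is executed `cnt` times and keeps the invariant `I`. -/
theorem Post.loop {e : RamExpr} {p : Prog} {N : ℕ} (I : ℕ → RamState → Prop) (cnt : ℕ)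
    (hk : e.kap < 256) (hB : Bdd V σ) (h0 : I 0 σ)
    (hstep : ∀ i < cnt, ∀ τ, Bdd V τ → I i τ → e.eval ω τ ≠ 0 ∧ Post ω V p τ N (I (i + 1)))
    (hend : ∀ τ, Bdd V τ → I cnt τ → e.eval ω τ = 0) :
    Post ω V (.loop e p) σ (cnt * (N + 1) + 1) (I cnt) := by
  have hc : ∀ τ, Bdd V τ → 1 + e.cost ω τ ≤ stepCost V := fun τ hτ => by
    have := e.cost_le (ω := ω) hτ
    unfold stepCost; nlinarith
  -- The induction is on the number `d` of remaining rounds, since an execution of a loop unfolds at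
  -- its first round. Each round pays `N` for the body and one for the test.
  suffices H : ∀ d i, i + d = cnt → ∀ τ, Bdd V τ → I i τ →
      Post ω V (.loop e p) τ (d * (N + 1) + 1) (I cnt) from H cnt 0 (by simp) σ hB h0
  intro d
  induction d with
  | zero =>
    rintro i hi τ hτ hI
    obtain rfl : i = cnt := by simpa using hi
    exact ⟨τ, _, Exec.loop_stop (hend τ hτ hI), by simpa using hc τ hτ, hτ, hI⟩
  | succ d ih =>
    intro i hi τ hτ hI
    obtain ⟨he, τ', T, h1, h2, h3, h4⟩ := hstep i (by omega) τ hτ hI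
    obtain ⟨τ'', T', h1', h2', h3', h4'⟩ := ih (i + 1) (by omega) τ' h3 h4
    refine ⟨τ'', _, .loop_step he h1 h1', ?_, h3', h4'⟩
    have := hc τ hτ
    calc _ ≤ stepCost V + N * stepCost V + (d * (N + 1) + 1) * stepCost V := by omega
      _ = _ := by ring

end AsymDE

/-! ### Bit lengths, and hashing with random bits. -/

namespace AsymDE

/-! ### Basic subprograms -/

/-- The bits `p, …, p + w - 1` of the random tape, read as a binary number. -/
def bkt (ω : ℕ → Bool) (p : ℕ) : ℕ → ℕ
  | 0 => 0
  | w + 1 => 2 * bkt ω p w + (ω (p + w)).toNat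

theorem bkt_lt (ω : ℕ → Bool) (p w : ℕ) : bkt ω p w < 2 ^ w := by
  induction w with
  | zero => simp [bkt]
  | succ w ih =>
    have := Bool.toNat_le (ω (p + w))
    rw [bkt, pow_succ]; omega

/-- This turns a collision of two buckets into `w` equalities between coins, the form in which its
probability is computed. -/
theorem bkt_eq_iff (ω : ℕ → Bool) (p q w : ℕ) :
    bkt ω p w = bkt ω q w ↔ ∀ l < w, ω (p + l) = ω (q + l) := by
  induction w with
  | zero => simp [bkt]
  | succ w ih =>
    have hp := Bool.toNat_le (ω (p + w))
    have hq := Bool.toNat_le (ω (q + w))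
    constructor
    · intro h l hl
      rw [bkt, bkt] at h
      have h1 : bkt ω p w = bkt ω q w := by omega
      have h2 : (ω (p + w)).toNat = (ω (q + w)).toNat := by omega
      rcases Nat.lt_succ_iff_lt_or_eq.1 hl with h' | rfl
      · exact ih.1 h1 l h'
      · revert h2; cases ω (p + l) <;> cases ω (q + l) <;> simp
    · intro h
      rw [bkt, bkt, ih.2 fun l hl => h l (by omega), h w (by omega)]

variable {ω : ℕ → Bool} {V : ℕ} {σ : RamState}

/-- Puts the bit length of register `5` into register `6` and the corresponding power of two into
register `17`. -/
def progSize : Prog :=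
  .seq (.assign 6 (.const 0)) (.seq (.assign 17 (.const 1)) (.loop (.reg 5)
    (.seq (.assign 5 (.bin .div (.reg 5) (.const 2))) (.seq
      (.assign 6 (.bin .add (.reg 6) (.const 1)))
      (.assign 17 (.bin .mul (.const 2) (.reg 17)))))))

theorem post_progSize (hB : Bdd V σ) (hV : 2 ^ (σ.reg 5).size ≤ V) :
    Post ω V progSize σ (4 * (σ.reg 5).size + 3) fun τ =>
      τ.reg 6 = (σ.reg 5).size ∧ τ.reg 17 = 2 ^ (σ.reg 5).size ∧
      (∀ r, r ∉ [5, 6, 17] → τ.reg r = σ.reg r) ∧ τ.arr = σ.arr ∧ τ.out = σ.out := by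
  have h1V : 1 ≤ V := Nat.one_le_two_pow.trans hV
  refine Post.mono (Post.seq_assign hB (by decide) (by simp [RamExpr.eval]) fun hB1 =>
    Post.seq_assign hB1 (by decide) (by simpa [RamExpr.eval]) fun hB2 =>
    Post.loop (N := 1 + (1 + 1)) (fun i τ => τ.reg 5 = σ.reg 5 / 2 ^ i ∧ τ.reg 6 = i ∧
      τ.reg 17 = 2 ^ i ∧ (∀ r, r ∉ [5, 6, 17] → τ.reg r = σ.reg r) ∧ τ.arr = σ.arr ∧
      τ.out = σ.out) (σ.reg 5).size (by decide) hB2 ?_ ?_ ?_) (by omega)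
      (fun τ _ h => ⟨h.2.1, h.2.2.1, h.2.2.2⟩)
  · simp +contextual [RamExpr.eval]
  · rintro i hi τ hτ ⟨h5, h6, h17, hr, ha, ho⟩
    have hpow : 2 ^ (i + 1) ≤ V := (Nat.pow_le_pow_right (by norm_num) hi).trans hV
    have hi' : i < 2 ^ i := Nat.lt_two_pow_self
    rw [pow_succ] at hpow
    refine ⟨?_, Post.seq_assign hτ (by decide) ?_ fun hB1 => Post.seq_assign hB1 (by decide) ?_
      fun hB2 => Post.assign hB2 (by decide) ?_ ?_⟩
    · simp only [RamExpr.eval, h5]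
      have := Nat.lt_size.1 hi
      exact (Nat.div_pos this (by positivity)).ne'
    · simp only [RamExpr.eval, BinOp.eval]
      exact (Nat.div_le_self _ _).trans (hτ.1 5)
    · simp [RamExpr.eval, BinOp.eval, h6]; omega
    · simp [RamExpr.eval, BinOp.eval, h17]; omega
    · simp +contextual [RamExpr.eval, BinOp.eval, h5, h6, h17, ha, ho, hr,
        Nat.div_div_eq_div_mul, pow_succ, mul_comm]
  · rintro τ hτ ⟨h5, -⟩
    simp only [RamExpr.eval, h5]
    exact Nat.div_eq_of_lt (Nat.lt_size_self _)

/-- Reads the number of random bits given in register `12`, from the position in register `15` on,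
and puts their value into register `20`. -/
def progBucket : Prog :=
  .seq (.assign 20 (.const 0)) (.seq (.assign 22 (.const 0))
    (.loop (.bin .lt (.reg 22) (.reg 12))
      (.seq (.assign 20 (.bin .add (.bin .mul (.const 2) (.reg 20)) (.coin (.reg 15))))
        (.seq (.assign 15 (.bin .add (.reg 15) (.const 1)))
          (.assign 22 (.bin .add (.reg 22) (.const 1)))))))

theorem post_progBucket (hB : Bdd V σ) {p w : ℕ} (hw : σ.reg 12 = w) (hp : σ.reg 15 = p)
    (hV : p + w ≤ V) (hV' : 2 ^ w ≤ V) :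
    Post ω V progBucket σ (4 * w + 3) fun τ =>
      τ.reg 20 = bkt ω p w ∧ τ.reg 15 = p + w ∧
      (∀ r, r ∉ [15, 20, 22] → τ.reg r = σ.reg r) ∧ τ.arr = σ.arr ∧ τ.out = σ.out := by
  refine Post.mono (Post.seq_assign hB (by decide) (by simp [RamExpr.eval]) fun hB1 =>
    Post.seq_assign hB1 (by decide) (by simp [RamExpr.eval]) fun hB2 =>
    Post.loop (N := 1 + (1 + 1)) (fun i τ => τ.reg 22 = i ∧ τ.reg 20 = bkt ω p i ∧
      τ.reg 15 = p + i ∧ (∀ r, r ∉ [15, 20, 22] → τ.reg r = σ.reg r) ∧ τ.arr = σ.arr ∧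
      τ.out = σ.out) w (by decide) hB2 ?_ ?_ ?_) (by omega) (fun τ _ h => h.2)
  · simp +contextual [RamExpr.eval, bkt, hp]
  · rintro i hi τ hτ ⟨h22, h20, h15, hr, ha, ho⟩
    have hbk := bkt_lt ω p (i + 1)
    rw [bkt] at hbk
    have hpow : 2 ^ (i + 1) ≤ V := (Nat.pow_le_pow_right (by norm_num) hi).trans hV'
    refine ⟨?_, Post.seq_assign hτ (by decide) ?_ fun hB1 => Post.seq_assign hB1 (by decide) ?_
      fun hB2 => Post.assign hB2 (by decide) ?_ ?_⟩
    · simp [RamExpr.eval, BinOp.eval, h22, hr, hw, hi]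
    · simp only [RamExpr.eval, BinOp.eval, h20, h15]; omega
    · simp [RamExpr.eval, BinOp.eval, h15]; omega
    · simp [RamExpr.eval, BinOp.eval, h22]; omega
    · simp +contextual [RamExpr.eval, BinOp.eval, h22, h20, h15, ha, ho, hr,
        bkt, add_assoc]
  · rintro τ hτ ⟨h22, h20, h15, hr, ha, ho⟩
    simp [RamExpr.eval, BinOp.eval, h22, hr, hw]

/-- The parity of the entries of `u` whose position is hashed to `v`, where the position `j` is
hashed by the `w` random bits from `p + j * w` on. -/
def parity (ω : ℕ → Bool) (n p w : ℕ) (u : ℕ → ℕ) (v : ℕ) : ℕ :=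
  (∑ j ∈ Finset.range n, if bkt ω (p + j * w) w = v then u j else 0) % 2

theorem parity_le (ω : ℕ → Bool) (n p w : ℕ) (u : ℕ → ℕ) (v : ℕ) : parity ω n p w u v ≤ 1 := by
  unfold parity; omega

/-- Hashes all positions `j`, stores the values in array `7` and the parities of the bits of
array `2` in array `6`. -/
def progHash : Prog :=
  .seq (.assign 19 (.const 0)) (.loop (.bin .lt (.reg 19) (.reg 0))
    (.seq progBucket (.seq (.store 7 (.reg 19) (.reg 20))
      (.seq (.store 6 (.reg 20)
        (.bin .mod (.bin .add (.load 6 (.reg 20)) (.load 2 (.reg 19))) (.const 2)))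
        (.assign 19 (.bin .add (.reg 19) (.const 1)))))))

/-- Array `6` must be clear at the start, as parities are accumulated in it; the callers clear it
after use. The coin pointer in register `15` ends just after the `n * w` coins consumed. -/
theorem post_progHash (hB : Bdd V σ) {n p w : ℕ} (hn : σ.reg 0 = n) (hw : σ.reg 12 = w)
    (hp : σ.reg 15 = p) (h6 : ∀ v, σ.arr 6 v = 0) (hV : p + n * w ≤ V) (hV' : 2 ^ w ≤ V) :
    Post ω V progHash σ (n * (4 * w + 7) + 2) fun τ =>
      (∀ v, τ.arr 6 v = parity ω n p w (σ.arr 2) v) ∧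
      (∀ j < n, τ.arr 7 j = bkt ω (p + j * w) w) ∧ τ.reg 15 = p + n * w ∧
      (∀ r, r ∉ [15, 19, 20, 22] → τ.reg r = σ.reg r) ∧
      (∀ A, A ∉ [6, 7] → τ.arr A = σ.arr A) ∧ τ.out = σ.out := by
  have h1V : 1 ≤ V := Nat.one_le_two_pow.trans hV'
  have hnV : n ≤ V := hn ▸ hB.1 0
  refine Post.mono (Post.seq_assign hB (by decide) (by simp [RamExpr.eval]) fun hB1 =>
    Post.loop (N := (4 * w + 3) + (1 + (1 + 1))) (fun i τ => τ.reg 19 = i ∧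
      (∀ v, τ.arr 6 v = parity ω i p w (σ.arr 2) v) ∧
      (∀ j < i, τ.arr 7 j = bkt ω (p + j * w) w) ∧ τ.reg 15 = p + i * w ∧
      (∀ r, r ∉ [15, 19, 20, 22] → τ.reg r = σ.reg r) ∧
      (∀ A, A ∉ [6, 7] → τ.arr A = σ.arr A) ∧ τ.out = σ.out) n (by decide) hB1 ?_ ?_ ?_)
      (by rw [add_comm]) (fun τ _ h => h.2)
  · simp +contextual [RamExpr.eval, parity, hp, h6]
  · rintro i hi τ hτ ⟨h19, h6, h7, h15, hr, ha, ho⟩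
    have hiw : (i + 1) * w ≤ n * w := Nat.mul_le_mul_right _ hi
    rw [add_mul, one_mul] at hiw
    refine ⟨?_, Post.seq (post_progBucket hτ (w := w) (by simp [hr, hw]) h15 (by omega) hV') ?_⟩
    · simp [RamExpr.eval, BinOp.eval, h19, hr, hn, hi]
    rintro τ' hτ' ⟨h20', h15', hr', ha', ho'⟩
    have hbk := bkt_lt ω (p + i * w) w
    refine Post.seq_store hτ' (by decide) ?_ fun hB1 => Post.seq_store hB1 (by decide) ?_ fun hB2 =>
      Post.assign hB2 (by decide) ?_ ?_
    · simp only [RamExpr.eval, h20']; omega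
    · simp only [RamExpr.eval, BinOp.eval]
      exact (Nat.le_of_lt_succ (Nat.mod_lt _ two_pos)).trans h1V
    · simp [RamExpr.eval, BinOp.eval, hr', h19]; omega
    · refine ⟨by simp [RamExpr.eval, BinOp.eval, hr', h19], fun v => ?_, fun j hj => ?_, ?_,
        fun r h => ?_, fun A h => ?_, ?_⟩
      · have h2 : τ.arr 2 = σ.arr 2 := ha 2 (by decide)
        by_cases hv : v = bkt ω (p + i * w) w
        · subst hv
          simp [RamExpr.eval, BinOp.eval, hr', h19, h20', ha', h6, h2, parity,
            Finset.sum_range_succ]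
        · simp [RamExpr.eval, BinOp.eval, h20', ha', h6, parity,
            Finset.sum_range_succ, hv, Ne.symm hv]
      · rcases Nat.lt_succ_iff_lt_or_eq.1 hj with h' | rfl
        · simp [RamExpr.eval, hr', h19, ha', h7, h', h'.ne]
        · simp [RamExpr.eval, hr', h19, h20']
      · simp [h15', add_mul, add_assoc]
      · simp only [List.mem_cons, not_or] at h
        simp [h, hr', hr]
      · simp only [List.mem_cons, not_or] at h
        simp [h, ha', ha]
      · simp [ho', ho]
  · rintro τ hτ ⟨h19, -, -, -, hr, -⟩
    simp [RamExpr.eval, BinOp.eval, h19, hr, hn]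

end AsymDE

/-! ### One repetition for each party, Bob's flips and his output. -/

namespace AsymDE

variable {ω : ℕ → Bool} {V : ℕ} {σ : RamState}

/-- Entries of index at least `2 ^ w` are never touched, so clearing the first `2 ^ w` entries
restores the zero array needed by the next repetition. -/
theorem parity_eq_zero {ω : ℕ → Bool} {n p w : ℕ} {u : ℕ → ℕ} {v : ℕ} (h : 2 ^ w ≤ v) :
    parity ω n p w u v = 0 := by
  unfold parity
  rw [Finset.sum_eq_zero fun j _ => if_neg (by have := bkt_lt ω (p + j * w) w; omega), Nat.zero_mod]

/-! ### A repetition of a stage -/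

/-- Writes the bits in array `6` (as many as register `13` says), and clears the array. -/
def progEmit : Prog :=
  .seq (.assign 21 (.const 0)) (.loop (.bin .lt (.reg 21) (.reg 13))
    (.seq (.emit (.load 6 (.reg 21))) (.seq (.store 6 (.reg 21) (.const 0))
      (.assign 21 (.bin .add (.reg 21) (.const 1))))))

theorem post_progEmit (hB : Bdd V σ) {b : ℕ} (hb : σ.reg 13 = b) :
    Post ω V progEmit σ (4 * b + 2) fun τ =>
      (∀ v, τ.arr 6 v = if v < b then 0 else σ.arr 6 v) ∧
      τ.out = σ.out ++ (List.range b).map (fun v => decide (σ.arr 6 v ≠ 0)) ∧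
      (∀ r, r ∉ [21] → τ.reg r = σ.reg r) ∧ (∀ A, A ∉ [6] → τ.arr A = σ.arr A) := by
  have hbV : b ≤ V := hb ▸ hB.1 13
  refine Post.mono (Post.seq_assign hB (by decide) (by simp [RamExpr.eval]) fun hB1 =>
    Post.loop (N := 1 + (1 + 1)) (fun i τ => τ.reg 21 = i ∧
      (∀ v, τ.arr 6 v = if v < i then 0 else σ.arr 6 v) ∧
      τ.out = σ.out ++ (List.range i).map (fun v => decide (σ.arr 6 v ≠ 0)) ∧
      (∀ r, r ∉ [21] → τ.reg r = σ.reg r) ∧ (∀ A, A ∉ [6] → τ.arr A = σ.arr A))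
      b (by decide) hB1 ?_ ?_ ?_) (by omega) (fun τ _ h => h.2)
  · simp +contextual [RamExpr.eval]
  · rintro i hi τ hτ ⟨h21, h6, ho, hr, ha⟩
    refine ⟨by simp [RamExpr.eval, BinOp.eval, h21, hr, hb, hi], Post.seq (P := fun τ' => τ' =
      ⟨τ.reg, τ.arr, τ.out ++ [decide (σ.arr 6 i ≠ 0)]⟩) (Post.emit hτ (by decide) ?_) ?_⟩
    · simp [RamExpr.eval, h21, h6]
    rintro _ hτ' rfl
    refine Post.seq_store hτ' (by decide) (by simp [RamExpr.eval]) fun hB2 =>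
      Post.assign hB2 (by decide) ?_ ?_
    · simp [RamExpr.eval, BinOp.eval, h21]; omega
    · refine ⟨by simp [RamExpr.eval, BinOp.eval, h21], fun v => ?_, ?_, ?_, ?_⟩
      · by_cases hv : v = i
        · subst hv; simp [RamExpr.eval, h21]
        · have : v < i + 1 ↔ v < i := by omega
          simp [RamExpr.eval, h21, hv, h6, this]
      · simp [ho, List.range_succ]
      · simp +contextual [hr]
      · simp +contextual [ha]
  · rintro τ hτ ⟨h21, -, -, hr, -⟩
    simp [RamExpr.eval, BinOp.eval, h21, hr, hb]

/-- The bits that Alice sends in a repetition. -/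
def segment (ω : ℕ → Bool) (n p w : ℕ) (u : ℕ → ℕ) : List Bool :=
  (List.range (2 ^ w)).map fun v => decide (parity ω n p w u v ≠ 0)

theorem length_segment (ω : ℕ → Bool) (n p w : ℕ) (u : ℕ → ℕ) :
    (segment ω n p w u).length = 2 ^ w := by simp [segment]

/-- What Alice does in a repetition. -/
def aliceBody : Prog := .seq progHash progEmit

theorem post_aliceBody (hB : Bdd V σ) {n p w : ℕ} (hn : σ.reg 0 = n) (hw : σ.reg 12 = w)
    (hb : σ.reg 13 = 2 ^ w)
    (hp : σ.reg 15 = p) (h6 : ∀ v, σ.arr 6 v = 0) (hV : p + n * w ≤ V) (hV' : 2 ^ w ≤ V) :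
    Post ω V aliceBody σ (n * (4 * w + 7) + 2 + (4 * 2 ^ w + 2)) fun τ =>
      (∀ v, τ.arr 6 v = 0) ∧ τ.out = σ.out ++ segment ω n p w (σ.arr 2) ∧
      τ.reg 15 = p + n * w ∧
      (∀ r, r ∉ [15, 19, 20, 21, 22] → τ.reg r = σ.reg r) ∧
      (∀ A, A ∉ [6, 7] → τ.arr A = σ.arr A) := by
  refine Post.seq (post_progHash hB hn hw hp h6 hV hV') ?_
  rintro τ hτ ⟨h6, h7, h15, hr, ha, ho⟩
  refine Post.mono (post_progEmit hτ (b := 2 ^ w) (by simp [hr, hb])) le_rfl ?_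
  rintro τ' hτ' ⟨h6', ho', hr', ha'⟩
  refine ⟨fun v => ?_, ?_, ?_, fun r h => ?_, fun A h => ?_⟩
  · rw [h6']
    split_ifs with h
    · rfl
    · rw [h6, parity_eq_zero (by omega)]
  · simp [ho', ho, segment, h6]
  · simp [hr', h15]
  · simp only [List.mem_cons, not_or] at h
    simp [h, hr', hr]
  · simp only [List.mem_cons, not_or] at h
    simp [h, ha', ha]

/-- Adds the next bits of the message to array `6`. -/
def progAddMsg : Prog :=
  .seq (.assign 21 (.const 0)) (.loop (.bin .lt (.reg 21) (.reg 13))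
    (.seq (.store 6 (.reg 21)
      (.bin .mod (.bin .add (.load 6 (.reg 21)) (.load 4 (.reg 16))) (.const 2)))
      (.seq (.assign 16 (.bin .add (.reg 16) (.const 1)))
      (.assign 21 (.bin .add (.reg 21) (.const 1))))))

theorem post_progAddMsg (hB : Bdd V σ) {b q : ℕ} (hb : σ.reg 13 = b) (hq : σ.reg 16 = q)
    (h1V : 1 ≤ V) (hV : q + b ≤ V) :
    Post ω V progAddMsg σ (4 * b + 2) fun τ =>
      (∀ v, τ.arr 6 v = if v < b then (σ.arr 6 v + σ.arr 4 (q + v)) % 2 else σ.arr 6 v) ∧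
      τ.reg 16 = q + b ∧
      (∀ r, r ∉ [16, 21] → τ.reg r = σ.reg r) ∧ (∀ A, A ∉ [6] → τ.arr A = σ.arr A) ∧
      τ.out = σ.out := by
  refine Post.mono (Post.seq_assign hB (by decide) (by simp [RamExpr.eval]) fun hB1 =>
    Post.loop (N := 1 + (1 + 1)) (fun i τ => τ.reg 21 = i ∧
      (∀ v, τ.arr 6 v = if v < i then (σ.arr 6 v + σ.arr 4 (q + v)) % 2 else σ.arr 6 v) ∧
      τ.reg 16 = q + i ∧
      (∀ r, r ∉ [16, 21] → τ.reg r = σ.reg r) ∧ (∀ A, A ∉ [6] → τ.arr A = σ.arr A) ∧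
      τ.out = σ.out)
      b (by decide) hB1 ?_ ?_ ?_) (by omega) (fun τ _ h => h.2)
  · simp +contextual [RamExpr.eval, hq]
  · rintro i hi τ hτ ⟨h21, h6, h16, hr, ha, ho⟩
    refine ⟨by simp [RamExpr.eval, BinOp.eval, h21, hr, hb, hi], Post.seq_store hτ (by decide) ?_
      fun hB2 => Post.seq_assign hB2 (by decide) ?_ fun hB3 => Post.assign hB3 (by decide) ?_ ?_⟩
    · simp only [RamExpr.eval, BinOp.eval]
      exact (Nat.le_of_lt_succ (Nat.mod_lt _ two_pos)).trans h1V
    · simp [RamExpr.eval, BinOp.eval, h16]; omega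
    · simp [RamExpr.eval, BinOp.eval, h21]; omega
    · refine ⟨by simp [RamExpr.eval, BinOp.eval, h21], fun v => ?_, ?_, ?_, ?_, ?_⟩
      · by_cases hv : v = i
        · subst hv; simp [RamExpr.eval, BinOp.eval, h21, h6, ha, h16]
        · have : v < i + 1 ↔ v < i := by omega
          simp [RamExpr.eval, h21, hv, h6, this]
      · simp [RamExpr.eval, BinOp.eval, h16, add_assoc]
      · simp +contextual [hr]
      · simp +contextual [ha]
      · simp [ho]
  · rintro τ hτ ⟨h21, -, -, hr, -⟩
    simp [RamExpr.eval, BinOp.eval, h21, hr, hb]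

/-- Adds to each entry of array `8` the bit of its bucket. -/
def progVote : Prog :=
  .seq (.assign 19 (.const 0)) (.loop (.bin .lt (.reg 19) (.reg 0))
    (.seq (.store 8 (.reg 19) (.bin .add (.load 8 (.reg 19)) (.load 6 (.load 7 (.reg 19)))))
      (.assign 19 (.bin .add (.reg 19) (.const 1)))))

theorem post_progVote (hB : Bdd V σ) {n : ℕ} (hn : σ.reg 0 = n)
    (hV : ∀ j < n, σ.arr 8 j + σ.arr 6 (σ.arr 7 j) ≤ V) :
    Post ω V progVote σ (3 * n + 2) fun τ =>
      (∀ j < n, τ.arr 8 j = σ.arr 8 j + σ.arr 6 (σ.arr 7 j)) ∧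
      (∀ r, r ∉ [19] → τ.reg r = σ.reg r) ∧ (∀ A, A ∉ [8] → τ.arr A = σ.arr A) ∧
      τ.out = σ.out := by
  have hnV : n ≤ V := hn ▸ hB.1 0
  refine Post.mono (Post.seq_assign hB (by decide) (by simp [RamExpr.eval]) fun hB1 =>
    Post.loop (N := 1 + 1) (fun i τ => τ.reg 19 = i ∧
      (∀ j < n, τ.arr 8 j = if j < i then σ.arr 8 j + σ.arr 6 (σ.arr 7 j) else σ.arr 8 j) ∧
      (∀ r, r ∉ [19] → τ.reg r = σ.reg r) ∧ (∀ A, A ∉ [8] → τ.arr A = σ.arr A) ∧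
      τ.out = σ.out)
      n (by decide) hB1 ?_ ?_ ?_) (by omega)
      (fun τ _ h => ⟨fun j hj => by rw [h.2.1 j hj, if_pos hj], h.2.2⟩)
  · simp +contextual [RamExpr.eval]
  · rintro i hi τ hτ ⟨h19, h8, hr, ha, ho⟩
    refine ⟨by simp [RamExpr.eval, BinOp.eval, h19, hr, hn, hi], Post.seq_store hτ (by decide) ?_
      fun hB2 => Post.assign hB2 (by decide) ?_ ?_⟩
    · simp [RamExpr.eval, BinOp.eval, h19, h8 i hi, ha, hV i hi]
    · simp [RamExpr.eval, BinOp.eval, h19]; omega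
    · refine ⟨by simp [RamExpr.eval, BinOp.eval, h19], fun j hj => ?_, ?_, ?_, ?_⟩
      · by_cases hji : j = i
        · subst hji; simp [RamExpr.eval, BinOp.eval, h19, h8, hi, ha]
        · have : j < i + 1 ↔ j < i := by omega
          simp [RamExpr.eval, h19, hji, h8 j hj, this]
      · simp +contextual [hr]
      · simp +contextual [ha]
      · simp [ho]
  · rintro τ hτ ⟨h19, -, hr, -⟩
    simp [RamExpr.eval, BinOp.eval, h19, hr, hn]

/-- Clears the first entries of array `6` (as many as register `13` says). -/
def progClear : Prog :=
  .seq (.assign 21 (.const 0)) (.loop (.bin .lt (.reg 21) (.reg 13))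
    (.seq (.store 6 (.reg 21) (.const 0)) (.assign 21 (.bin .add (.reg 21) (.const 1)))))

theorem post_progClear (hB : Bdd V σ) {b : ℕ} (hb : σ.reg 13 = b) :
    Post ω V progClear σ (3 * b + 2) fun τ =>
      (∀ v, τ.arr 6 v = if v < b then 0 else σ.arr 6 v) ∧
      (∀ r, r ∉ [21] → τ.reg r = σ.reg r) ∧ (∀ A, A ∉ [6] → τ.arr A = σ.arr A) ∧
      τ.out = σ.out := by
  have hbV : b ≤ V := hb ▸ hB.1 13
  refine Post.mono (Post.seq_assign hB (by decide) (by simp [RamExpr.eval]) fun hB1 =>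
    Post.loop (N := 1 + 1) (fun i τ => τ.reg 21 = i ∧
      (∀ v, τ.arr 6 v = if v < i then 0 else σ.arr 6 v) ∧
      (∀ r, r ∉ [21] → τ.reg r = σ.reg r) ∧ (∀ A, A ∉ [6] → τ.arr A = σ.arr A) ∧
      τ.out = σ.out)
      b (by decide) hB1 ?_ ?_ ?_) (by omega) (fun τ _ h => h.2)
  · simp +contextual [RamExpr.eval]
  · rintro i hi τ hτ ⟨h21, h6, hr, ha, ho⟩
    refine ⟨by simp [RamExpr.eval, BinOp.eval, h21, hr, hb, hi],
      Post.seq_store hτ (by decide) (by simp [RamExpr.eval]) fun hB2 =>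
      Post.assign hB2 (by decide) ?_ ?_⟩
    · simp [RamExpr.eval, BinOp.eval, h21]; omega
    · refine ⟨by simp [RamExpr.eval, BinOp.eval, h21], fun v => ?_, ?_, ?_, ?_⟩
      · by_cases hv : v = i
        · subst hv; simp [RamExpr.eval, h21]
        · have : v < i + 1 ↔ v < i := by omega
          simp [RamExpr.eval, h21, hv, h6, this]
      · simp +contextual [hr]
      · simp +contextual [ha]
      · simp [ho]
  · rintro τ hτ ⟨h21, -, hr, -⟩
    simp [RamExpr.eval, BinOp.eval, h21, hr, hb]

/-- What Bob does in a repetition. -/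
def bobBody : Prog := .seq progHash (.seq progAddMsg (.seq progVote progClear))

/-- Whether the bits of `x` and `y` in the bucket of `j` differ in an odd number of places. -/
def vote (ω : ℕ → Bool) (n p w : ℕ) (x y : ℕ → ℕ) (j : ℕ) : ℕ :=
  (parity ω n p w y (bkt ω (p + j * w) w) + parity ω n p w x (bkt ω (p + j * w) w)) % 2

theorem vote_le (ω : ℕ → Bool) (n p w : ℕ) (x y : ℕ → ℕ) (j : ℕ) : vote ω n p w x y j ≤ 1 := by
  unfold vote; omega

/-- The hypothesis `h4` says that the message carries Alice's parities at the reading position.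
Modulo 2 their sum with Bob's parities sees only the positions where the two strings differ. `h8`
leaves room for one more vote. -/
theorem post_bobBody (hB : Bdd V σ) {n p w q : ℕ} {x : ℕ → ℕ} (hn : σ.reg 0 = n)
    (hw : σ.reg 12 = w) (hb : σ.reg 13 = 2 ^ w) (hp : σ.reg 15 = p) (hq : σ.reg 16 = q)
    (h6 : ∀ v, σ.arr 6 v = 0) (h8 : ∀ j < n, σ.arr 8 j + 1 ≤ V)
    (h4 : ∀ v < 2 ^ w, σ.arr 4 (q + v) = parity ω n p w x v)
    (hV : p + n * w ≤ V) (hV' : q + 2 ^ w ≤ V) :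
    Post ω V bobBody σ (n * (4 * w + 10) + 7 * 2 ^ w + 8) fun τ =>
      (∀ v, τ.arr 6 v = 0) ∧
      (∀ j < n, τ.arr 8 j = σ.arr 8 j + vote ω n p w x (σ.arr 2) j) ∧
      τ.reg 15 = p + n * w ∧ τ.reg 16 = q + 2 ^ w ∧
      (∀ r, r ∉ [15, 16, 19, 20, 21, 22] → τ.reg r = σ.reg r) ∧
      (∀ A, A ∉ [6, 7, 8] → τ.arr A = σ.arr A) ∧ τ.out = σ.out := by
  have h2V : 2 ^ w ≤ V := by omega
  refine Post.mono (N := (n * (4 * w + 7) + 2) + ((4 * 2 ^ w + 2) + ((3 * n + 2) + (3 * 2 ^ w + 2))))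
    (Q := fun τ => (∀ v, τ.arr 6 v = 0) ∧
      (∀ j < n, τ.arr 8 j = σ.arr 8 j + vote ω n p w x (σ.arr 2) j) ∧
      τ.reg 15 = p + n * w ∧ τ.reg 16 = q + 2 ^ w ∧
      (∀ r, r ∉ [15, 16, 19, 20, 21, 22] → τ.reg r = σ.reg r) ∧
      (∀ A, A ∉ [6, 7, 8] → τ.arr A = σ.arr A) ∧ τ.out = σ.out)
    ?_ (by ring_nf; omega) (fun _ _ h => h)
  refine Post.seq (post_progHash hB hn hw hp h6 hV h2V) ?_
  rintro τ₁ hτ₁ ⟨h6₁, h7₁, h15₁, hr₁, ha₁, ho₁⟩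
  refine Post.seq (post_progAddMsg hτ₁ (b := 2 ^ w) (q := q) (by simp [hr₁, hb]) (by simp [hr₁, hq])
    (Nat.one_le_two_pow.trans h2V) hV') ?_
  rintro τ₂ hτ₂ ⟨h6₂, h16₂, hr₂, ha₂, ho₂⟩
  have hvote : ∀ j < n, τ₂.arr 6 (τ₂.arr 7 j) = vote ω n p w x (σ.arr 2) j := by
    intro j hj
    have h4' : τ₁.arr 4 = σ.arr 4 := ha₁ 4 (by decide)
    have h7' : τ₂.arr 7 = τ₁.arr 7 := ha₂ 7 (by decide)
    have hlt := bkt_lt ω (p + j * w) w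
    rw [h7', h7₁ j hj, h6₂, if_pos hlt, h6₁, h4', h4 _ hlt, vote]
  have h8₂ : τ₂.arr 8 = σ.arr 8 := by rw [ha₂ 8 (by decide), ha₁ 8 (by decide)]
  refine Post.seq (post_progVote hτ₂ (n := n) (by simp [hr₂, hr₁, hn]) ?_) ?_
  · intro j hj
    rw [hvote j hj, h8₂]
    have := vote_le ω n p w x (σ.arr 2) j
    have := h8 j hj
    omega
  rintro τ₃ hτ₃ ⟨h8₃, hr₃, ha₃, ho₃⟩
  refine Post.mono (post_progClear hτ₃ (b := 2 ^ w) (by simp [hr₃, hr₂, hr₁, hb])) le_rfl ?_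
  rintro τ₄ hτ₄ ⟨h6₄, hr₄, ha₄, ho₄⟩
  refine ⟨fun v => ?_, fun j hj => ?_, ?_, ?_, fun r h => ?_, fun A h => ?_, ?_⟩
  · rw [h6₄]
    split_ifs with h
    · rfl
    · rw [ha₃ 6 (by decide), h6₂, if_neg h, h6₁, parity_eq_zero (by omega)]
  · rw [ha₄ 8 (by decide), h8₃ j hj, hvote j hj, h8₂]
  · simp [hr₄, hr₃, hr₂, h15₁]
  · simp [hr₄, hr₃, h16₂]
  · simp only [List.mem_cons, not_or] at h
    simp [h, hr₄, hr₃, hr₂, hr₁]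
  · simp only [List.mem_cons, not_or] at h
    simp [h, ha₄, ha₃, ha₂, ha₁]
  · simp [ho₄, ho₃, ho₂, ho₁]

/-- The condition for Bob to flip a bit with label `l` and `c` votes, when the thresholds are
`g` and `R`. -/
def FlipCond (D : ℕ → ℕ) (g R l c : ℕ) : Prop := 0 < l ∧ D l ≤ g ∧ R < 2 * c

instance (D : ℕ → ℕ) (g R l c : ℕ) : Decidable (FlipCond D g R l c) :=
  inferInstanceAs (Decidable (_ ∧ _ ∧ _))

/-- Flips the bits of array `2` that have got enough votes, and clears the votes. -/
def progFlip : Prog :=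
  .seq (.assign 19 (.const 0)) (.loop (.bin .lt (.reg 19) (.reg 0))
    (.seq (.cond (.bin .mul (.bin .mul (.bin .lt (.const 0) (.load 3 (.reg 19)))
        (.bin .lt (.load 5 (.load 3 (.reg 19))) (.bin .add (.reg 11) (.const 1))))
        (.bin .lt (.reg 14) (.bin .mul (.const 2) (.load 8 (.reg 19)))))
      (.store 2 (.reg 19) (.bin .sub (.const 1) (.load 2 (.reg 19)))) .skip)
      (.seq (.store 8 (.reg 19) (.const 0)) (.assign 19 (.bin .add (.reg 19) (.const 1))))))

/-- The machine has no conjunction: the three conditions become a product of values in `{0, 1}`,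
with `D l ≤ g` tested as `D l < g + 1`. Flipping a bit is subtraction from one. -/
theorem post_progFlip (hB : Bdd V σ) {n g R : ℕ} (hn : σ.reg 0 = n) (hg : σ.reg 11 = g)
    (hR : σ.reg 14 = R) (h1V : 1 ≤ V) :
    Post ω V progFlip σ (5 * n + 2) fun τ =>
      (∀ j < n, τ.arr 2 j = if FlipCond (σ.arr 5) g R (σ.arr 3 j) (σ.arr 8 j)
        then 1 - σ.arr 2 j else σ.arr 2 j) ∧
      (∀ j < n, τ.arr 8 j = 0) ∧
      (∀ r, r ∉ [19] → τ.reg r = σ.reg r) ∧ (∀ A, A ∉ [2, 8] → τ.arr A = σ.arr A) ∧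
      τ.out = σ.out := by
  have hnV : n ≤ V := hn ▸ hB.1 0
  refine Post.mono (Post.seq_assign hB (by decide) (by simp [RamExpr.eval]) fun hB1 =>
    Post.loop (N := (1 + 1) + (1 + 1)) (fun i τ => τ.reg 19 = i ∧
      (∀ j < n, τ.arr 2 j = if j < i ∧ FlipCond (σ.arr 5) g R (σ.arr 3 j) (σ.arr 8 j)
        then 1 - σ.arr 2 j else σ.arr 2 j) ∧
      (∀ j < n, τ.arr 8 j = if j < i then 0 else σ.arr 8 j) ∧
      (∀ r, r ∉ [19] → τ.reg r = σ.reg r) ∧ (∀ A, A ∉ [2, 8] → τ.arr A = σ.arr A) ∧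
      τ.out = σ.out)
      n (by decide) hB1 ?_ ?_ ?_) (by omega)
      (fun τ _ h => ⟨fun j hj => by simp [h.2.1 j hj, hj], fun j hj => by simp [h.2.2.1 j hj, hj],
        h.2.2.2⟩)
  · simp +contextual [RamExpr.eval]
  · rintro i hi τ hτ ⟨h19, h2, h8, hr, ha, ho⟩
    refine ⟨by simp [RamExpr.eval, BinOp.eval, h19, hr, hn, hi], ?_⟩
    refine Post.seq (P := fun τ' => τ'.reg = τ.reg ∧ (∀ j < n, τ'.arr 2 j =
      if j < i + 1 ∧ FlipCond (σ.arr 5) g R (σ.arr 3 j) (σ.arr 8 j)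
        then 1 - σ.arr 2 j else σ.arr 2 j) ∧ (∀ A, A ∉ [2] → τ'.arr A = τ.arr A) ∧
        τ'.out = τ.out) (Post.cond hτ (by decide) (fun hc => ?_) fun hc => ?_) ?_
    · have hc' : FlipCond (σ.arr 5) g R (σ.arr 3 i) (σ.arr 8 i) := by
        simp [RamExpr.eval, BinOp.eval, h19, h8 i hi, ha, hr, hg, hR] at hc
        exact ⟨by omega, hc.2.1, hc.1⟩
      refine Post.store hτ (by decide) ?_ ⟨rfl, fun j hj => ?_, ?_, rfl⟩
      · simp only [RamExpr.eval, BinOp.eval]; omega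
      · by_cases hji : j = i
        · subst hji; simp [RamExpr.eval, BinOp.eval, h19, h2 j hj, hc']
        · have : j < i + 1 ↔ j < i := by omega
          simp [RamExpr.eval, h19, hji, h2 j hj, this]
      · simp +contextual
    · have hc' : ¬ FlipCond (σ.arr 5) g R (σ.arr 3 i) (σ.arr 8 i) := by
        intro hf
        obtain ⟨h1, h2, h3⟩ := hf
        simp [RamExpr.eval, BinOp.eval, h19, h8 i hi, ha, hr, hg, hR, h2, h3] at hc
        omega
      refine Post.skip hτ ⟨rfl, fun j hj => ?_, fun _ _ => rfl, rfl⟩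
      by_cases hji : j = i
      · subst hji; simp [h2 j hj, hc']
      · have : j < i + 1 ↔ j < i := by omega
        simp [h2 j hj, this]
    rintro τ' hτ' ⟨hr', h2', ha', ho'⟩
    refine Post.seq_store hτ' (by decide) (by simp [RamExpr.eval]) fun hB2 =>
      Post.assign hB2 (by decide) ?_ ?_
    · simp [RamExpr.eval, BinOp.eval, h19, hr']; omega
    · refine ⟨by simp [RamExpr.eval, BinOp.eval, h19, hr'], fun j hj => ?_, fun j hj => ?_,
        ?_, fun A h => ?_, ?_⟩
      · simp [h2' j hj]
      · by_cases hji : j = i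
        · subst hji; simp [RamExpr.eval, h19, hr']
        · have : j < i + 1 ↔ j < i := by omega
          simp [RamExpr.eval, h19, hji, h8 j hj, this, hr', ha']
      · simp +contextual [hr, hr']
      · simp only [List.mem_cons, not_or] at h
        simp [ha, ha', h]
      · simp [ho, ho']
  · rintro τ hτ ⟨h19, -, -, hr, -⟩
    simp [RamExpr.eval, BinOp.eval, h19, hr, hn]

/-- Writes the bits in array `2`. -/
def progOutput : Prog :=
  .seq (.assign 19 (.const 0)) (.loop (.bin .lt (.reg 19) (.reg 0))
    (.seq (.emit (.load 2 (.reg 19))) (.assign 19 (.bin .add (.reg 19) (.const 1)))))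

theorem post_progOutput (hB : Bdd V σ) {n : ℕ} (hn : σ.reg 0 = n) :
    Post ω V progOutput σ (3 * n + 2) fun τ =>
      τ.out = σ.out ++ (List.range n).map (fun v => decide (σ.arr 2 v ≠ 0)) := by
  have hnV : n ≤ V := hn ▸ hB.1 0
  refine Post.mono (Post.seq_assign hB (by decide) (by simp [RamExpr.eval]) fun hB1 =>
    Post.loop (N := 1 + 1) (fun i τ => τ.reg 19 = i ∧
      τ.out = σ.out ++ (List.range i).map (fun v => decide (σ.arr 2 v ≠ 0)) ∧
      τ.reg 0 = n ∧ τ.arr = σ.arr)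
      n (by decide) hB1 ?_ ?_ ?_) (by omega) (fun τ _ h => h.2.1)
  · simp +contextual [RamExpr.eval, hn]
  · rintro i hi τ hτ ⟨h19, ho, hr, ha⟩
    refine ⟨by simp [RamExpr.eval, BinOp.eval, h19, hr, hi], Post.seq (P := fun τ' => τ' =
      ⟨τ.reg, τ.arr, τ.out ++ [decide (σ.arr 2 i ≠ 0)]⟩) (Post.emit hτ (by decide) ?_) ?_⟩
    · simp [RamExpr.eval, h19, ha]
    rintro _ hτ' rfl
    refine Post.assign hτ' (by decide) ?_ ?_
    · simp [RamExpr.eval, BinOp.eval, h19]; omega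
    · refine ⟨by simp [RamExpr.eval, BinOp.eval, h19], ?_, by simp [hr], ha⟩
      simp [ho, List.range_succ]
  · rintro τ hτ ⟨h19, -, hr, -⟩
    simp [RamExpr.eval, BinOp.eval, h19, hr]

end AsymDE

/-! ### Computation of the parameters, and the loop over stages and repetitions. -/

namespace AsymDE

variable {ω : ℕ → Bool} {V : ℕ} {σ : RamState}

/-! ### The parameters of the protocol -/

/-- The bit length of `s i / k i`. -/
def blockBits (s k : ℕ → ℕ) (i : ℕ) : ℕ := (s i / k i).size

/-- `∑ᵢ kᵢ log (sᵢ / kᵢ)`, rounded. -/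
def roundedH (s k : ℕ → ℕ) (t : ℕ) : ℕ := ∑ i ∈ Finset.range t, k i * blockBits s k i

/-- The logarithm of the number of buckets in the first stage. -/
def logBuckets (s k : ℕ → ℕ) (t : ℕ) : ℕ := (16384 * roundedH s k t).size

/-- `log log n`, rounded. -/
def loglog (n : ℕ) : ℕ := n.size.size

/-- The sums of `roundedH`, stored in register `3`, and its summands, stored in array `5`. -/
def progSum : Prog :=
  .loop (.bin .lt (.reg 4) (.reg 1))
    (.seq (.assign 5 (.bin .div (.load 0 (.reg 4)) (.load 1 (.reg 4)))) (.seq progSize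
      (.seq (.store 5 (.bin .add (.reg 4) (.const 1)) (.reg 6))
      (.seq (.assign 3 (.bin .add (.reg 3) (.bin .mul (.load 1 (.reg 4)) (.reg 6))))
        (.assign 4 (.bin .add (.reg 4) (.const 1)))))))

/-- The bit length for block `i` goes to index `i + 1` of array `5`, so that it can be looked up by
label; label `0` means that a position is in no block. -/
theorem post_progSum (hB : Bdd V σ) {t l : ℕ} (ht : σ.reg 1 = t) (h3 : σ.reg 3 = 0)
    (h4 : σ.reg 4 = 0) (hl : ∀ i < t, blockBits (σ.arr 0) (σ.arr 1) i ≤ l) (hV : 2 ^ l ≤ V)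
    (hH : roundedH (σ.arr 0) (σ.arr 1) t ≤ V) :
    Post ω V progSum σ (t * (4 * l + 8) + 1) fun τ =>
      τ.reg 3 = roundedH (σ.arr 0) (σ.arr 1) t ∧
      (∀ i < t, τ.arr 5 (i + 1) = blockBits (σ.arr 0) (σ.arr 1) i) ∧
      (∀ r, r ∉ [3, 4, 5, 6, 17] → τ.reg r = σ.reg r) ∧
      (∀ A, A ∉ [5] → τ.arr A = σ.arr A) ∧ τ.out = σ.out := by
  have htV : t ≤ V := ht ▸ hB.1 1
  refine Post.mono (Post.loop (N := 1 + ((4 * l + 3) + (1 + (1 + 1)))) (fun i τ =>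
      τ.reg 4 = i ∧ τ.reg 3 = roundedH (σ.arr 0) (σ.arr 1) i ∧
      (∀ i' < i, τ.arr 5 (i' + 1) = blockBits (σ.arr 0) (σ.arr 1) i') ∧
      (∀ r, r ∉ [3, 4, 5, 6, 17] → τ.reg r = σ.reg r) ∧
      (∀ A, A ∉ [5] → τ.arr A = σ.arr A) ∧ τ.out = σ.out) t (by decide) hB ?_ ?_ ?_)
      (by ring_nf; omega) (fun τ _ h => h.2)
  · simp [h3, h4, roundedH]
  · rintro i hi τ hτ ⟨h4, h3, h5, hr, ha, ho⟩
    refine ⟨by simp [RamExpr.eval, BinOp.eval, h4, hr, ht, hi], ?_⟩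
    refine Post.seq_assign hτ (by decide) ?_ fun hB1 => ?_
    · simp only [RamExpr.eval, BinOp.eval]
      exact (Nat.div_le_self _ _).trans (hτ.2 _ _)
    refine Post.seq (Post.mono (post_progSize hB1 ?_) ?_ fun _ _ h => h) ?_
    · simp only [RamExpr.eval, BinOp.eval, Function.update_self, h4, ha 0 (by decide),
        ha 1 (by decide)]
      exact (Nat.pow_le_pow_right (by norm_num) (hl i hi)).trans hV
    · simp only [RamExpr.eval, BinOp.eval, Function.update_self, h4, ha 0 (by decide),
        ha 1 (by decide)]
      have := hl i hi
      unfold blockBits at this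
      omega
    rintro τ' hτ' ⟨h6', -, hr', ha', ho'⟩
    simp only [RamExpr.eval, BinOp.eval, Function.update_self, h4, ha 0 (by decide),
        ha 1 (by decide)] at h6' hr' ha' ho'
    have hs : roundedH (σ.arr 0) (σ.arr 1) (i + 1) ≤ V :=
      le_trans (Finset.sum_le_sum_of_subset (Finset.range_subset_range.2 hi)) hH
    have hs' : roundedH (σ.arr 0) (σ.arr 1) (i + 1) = roundedH (σ.arr 0) (σ.arr 1) i +
        σ.arr 1 i * (σ.arr 0 i / σ.arr 1 i).size := Finset.sum_range_succ _ _
    refine Post.seq_store hτ' (by decide) ?_ fun hB2 => Post.seq_assign hB2 (by decide) ?_ fun hB3 =>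
      Post.assign hB3 (by decide) ?_ ?_
    · simp only [RamExpr.eval]; exact hτ'.1 6
    · simp [RamExpr.eval, BinOp.eval, hr', ha', ha, h3, h4, h6']; omega
    · simp [RamExpr.eval, BinOp.eval, hr', h4]; omega
    · refine ⟨by simp [RamExpr.eval, BinOp.eval, hr', h4], ?_, fun i' hi' => ?_, fun r h => ?_,
        fun A h => ?_, ?_⟩
      · simp [RamExpr.eval, BinOp.eval, hr', ha', ha, h3, h4, h6', hs']
      · by_cases hii : i' = i
        · subst hii; simp [RamExpr.eval, BinOp.eval, hr', h4, h6', blockBits]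
        · simp [RamExpr.eval, BinOp.eval, hr', h4, hii, ha', h5 i' (by omega)]
      · simp only [List.mem_cons, not_or] at h
        simp [h, hr', hr]
      · simp only [List.mem_cons, not_or] at h
        simp [h, ha', ha]
      · simp [ho', ho]
  · rintro τ hτ ⟨h4, -, -, hr, -⟩
    simp [RamExpr.eval, BinOp.eval, h4, hr, ht]

/-- Computes all parameters; `C` is the constant in the number of repetitions. -/
def progInit (C : ℕ) : Prog :=
  .seq (.assign 23 (.const C)) (.seq (.assign 3 (.const 0)) (.seq (.assign 4 (.const 0))
  (.seq progSum (.seq (.assign 5 (.reg 0)) (.seq progSize (.seq (.assign 5 (.reg 6))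
  (.seq progSize (.seq (.assign 7 (.reg 6)) (.seq (.assign 5 (.bin .mul (.const 16384) (.reg 3)))
  (.seq progSize (.seq (.assign 8 (.reg 6)) (.seq (.assign 13 (.reg 17))
  (.seq (.cond (.bin .lt (.reg 7) (.reg 8)) (.assign 9 (.bin .add (.reg 7) (.const 1)))
    (.assign 9 (.bin .add (.reg 8) (.const 1))))
  (.seq (.assign 10 (.const 0)) (.seq (.assign 11 (.const 1)) (.seq (.assign 15 (.const 0))
  (.assign 16 (.const 0))))))))))))))))))

theorem post_progInit (hB : Bdd V σ) {C n t : ℕ} (hn : σ.reg 0 = n) (ht : σ.reg 1 = t)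
    (hC : C ≤ V) (hl : ∀ i < t, blockBits (σ.arr 0) (σ.arr 1) i ≤ n.size) (hV : 2 ^ n.size ≤ V)
    (hH : 2 ^ logBuckets (σ.arr 0) (σ.arr 1) t ≤ V) :
    Post ω V (progInit C) σ (t * (4 * n.size + 8) + (4 * n.size + 4 * loglog n +
      4 * logBuckets (σ.arr 0) (σ.arr 1) t + 25)) fun τ =>
      τ.reg 0 = n ∧ τ.reg 7 = loglog n ∧ τ.reg 8 = logBuckets (σ.arr 0) (σ.arr 1) t ∧
      τ.reg 9 = min (loglog n) (logBuckets (σ.arr 0) (σ.arr 1) t) + 1 ∧ τ.reg 10 = 0 ∧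
      τ.reg 11 = 1 ∧ τ.reg 13 = 2 ^ logBuckets (σ.arr 0) (σ.arr 1) t ∧ τ.reg 15 = 0 ∧
      τ.reg 16 = 0 ∧ τ.reg 23 = C ∧
      (∀ i < t, τ.arr 5 (i + 1) = blockBits (σ.arr 0) (σ.arr 1) i) ∧
      (∀ A, A ∉ [5] → τ.arr A = σ.arr A) ∧ τ.out = σ.out := by
  have h1V : 1 ≤ V := Nat.one_le_two_pow.trans hV
  have hHV : 16384 * roundedH (σ.arr 0) (σ.arr 1) t ≤ V := (Nat.lt_size_self _).le.trans hH
  -- The second call of `progSize` is applied to the bit length of `n`, so its power of two is also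
  -- covered by the hypothesis on `2 ^ n.size`.
  have hss : n.size.size ≤ n.size := Nat.size_le.2 Nat.lt_two_pow_self
  have hV2 : 2 ^ n.size.size ≤ V := (Nat.pow_le_pow_right (by norm_num) hss).trans hV
  have hlog : loglog n < V := Nat.lt_two_pow_self.trans_le hV2
  have hbV : logBuckets (σ.arr 0) (σ.arr 1) t < V := Nat.lt_two_pow_self.trans_le hH
  set β := logBuckets (σ.arr 0) (σ.arr 1) t with hβ
  refine Post.mono (Post.seq (P := fun τ => τ = ⟨Function.update σ.reg 23 C, σ.arr, σ.out⟩)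
    (Post.assign_const hB hC rfl) ?_) (?_ : 1 + (1 + (1 + ((t * (4 * n.size + 8) + 1) + (1 +
      ((4 * n.size + 3) + (1 + ((4 * loglog n + 3) + (1 + (1 + ((4 * β + 3) + (1 + (1 +
      ((1 + 1) + (1 + (1 + (1 + 1)))))))))))))))) ≤ _) fun _ _ h => h
  swap
  · ring_nf; omega
  rintro _ hB1 rfl
  refine Post.seq_assign hB1 (by decide) (by simp [RamExpr.eval]) fun hB2 =>
    Post.seq_assign hB2 (by decide) (by simp [RamExpr.eval]) fun hB3 =>
    Post.seq (post_progSum hB3 (t := t) (l := n.size) (by simp [ht]) (by simp [RamExpr.eval])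
      (by simp [RamExpr.eval]) hl hV (by simp only; omega)) ?_
  rintro τ₁ hτ₁ ⟨h3₁, h5₁, hr₁, ha₁, ho₁⟩
  simp only [RamExpr.eval] at h3₁ h5₁ hr₁ ha₁ ho₁
  have h0₁ : τ₁.reg 0 = n := by simp [hr₁, hn]
  have h23₁ : τ₁.reg 23 = C := by simp [hr₁]
  refine Post.seq_assign hτ₁ (by decide) (hτ₁.1 0) fun hB4 =>
    Post.seq (Post.mono (post_progSize hB4 ?_) ?_ fun _ _ h => h) ?_
  · simpa [RamExpr.eval, h0₁]
  · simp [RamExpr.eval, h0₁]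
  rintro τ₂ hτ₂ ⟨h6₂, -, hr₂, ha₂, ho₂⟩
  simp only [RamExpr.eval, h0₁, Function.update_self] at h6₂ hr₂ ha₂ ho₂
  refine Post.seq_assign hτ₂ (by decide) (hτ₂.1 6) fun hB5 =>
    Post.seq (Post.mono (post_progSize hB5 ?_) ?_ fun _ _ h => h) ?_
  · simpa [RamExpr.eval, h6₂]
  · simp [RamExpr.eval, h6₂, loglog]
  rintro τ₃ hτ₃ ⟨h6₃, -, hr₃, ha₃, ho₃⟩
  simp only [RamExpr.eval, h6₂, Function.update_self] at h6₃ hr₃ ha₃ ho₃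
  refine Post.seq_assign hτ₃ (by decide) (hτ₃.1 6) fun hB6 =>
    Post.seq_assign hB6 (by decide) ?_ fun hB7 =>
    Post.seq (Post.mono (post_progSize hB7 ?_) ?_ fun _ _ h => h) ?_
  · simpa [RamExpr.eval, BinOp.eval, hr₃, hr₂, h3₁]
  · simp [RamExpr.eval, BinOp.eval, hr₃, hr₂, h3₁]
    exact hH
  · simp [RamExpr.eval, BinOp.eval, hr₃, hr₂, h3₁, hβ, logBuckets]
  rintro τ₄ hτ₄ ⟨h6₄, h17₄, hr₄, ha₄, ho₄⟩
  have h3₃ : τ₃.reg 3 = roundedH (σ.arr 0) (σ.arr 1) t := by simp [hr₃, hr₂, h3₁]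
  have hβ' : (16384 * roundedH (σ.arr 0) (σ.arr 1) t).size = β := rfl
  simp [RamExpr.eval, BinOp.eval, h3₃, hβ'] at h6₄ h17₄ hr₄ ha₄ ho₄
  have h7₄ : τ₄.reg 7 = loglog n := by simp [hr₄, h6₃, loglog]
  have h0₄ : τ₄.reg 0 = n := by simp [hr₄, hr₃, hr₂, h0₁]
  have h23₄ : τ₄.reg 23 = C := by simp [hr₄, hr₃, hr₂, h23₁]
  refine Post.seq_assign hτ₄ (by decide) (hτ₄.1 6) fun hB8 =>
    Post.seq_assign hB8 (by decide) (hB8.1 17) fun hB9 =>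
    Post.seq (P := fun τ => τ.reg 9 = min (loglog n) β + 1 ∧ (∀ r, r ≠ 9 → τ.reg r =
      Function.update (Function.update τ₄.reg 8 β) 13 (2 ^ β) r) ∧ τ.arr = τ₄.arr ∧
      τ.out = τ₄.out) (Post.cond hB9 (by decide) (fun hc => ?_) fun hc => ?_) ?_
  · simp [RamExpr.eval, BinOp.eval, h6₄, h7₄] at hc
    refine Post.assign hB9 (by decide) ?_ ⟨?_, ?_, rfl, rfl⟩
    · simp [RamExpr.eval, BinOp.eval, h7₄]; omega
    · simp [RamExpr.eval, BinOp.eval, h7₄]; omega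
    · simp +contextual [RamExpr.eval, h6₄, h17₄]
  · simp [RamExpr.eval, BinOp.eval, h6₄, h7₄] at hc
    refine Post.assign hB9 (by decide) ?_ ⟨?_, ?_, rfl, rfl⟩
    · simp [RamExpr.eval, BinOp.eval, h6₄]; omega
    · simp [RamExpr.eval, BinOp.eval, h6₄]; omega
    · simp +contextual [RamExpr.eval, h6₄, h17₄]
  rintro τ₅ hτ₅ ⟨h9₅, hr₅, ha₅, ho₅⟩
  refine Post.seq_assign hτ₅ (by decide) (by simp [RamExpr.eval]) fun hB10 =>
    Post.seq_assign hB10 (by decide) (by simpa [RamExpr.eval]) fun hB11 =>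
    Post.seq_assign hB11 (by decide) (by simp [RamExpr.eval]) fun hB12 =>
    Post.assign hB12 (by decide) (by simp [RamExpr.eval]) ?_
  refine ⟨by simp [hr₅, h0₄], by simp [hr₅, h7₄], by simp [hr₅], by simp [h9₅],
    by simp [RamExpr.eval], by simp [RamExpr.eval], by simp [hr₅], by simp [RamExpr.eval],
    by simp [RamExpr.eval], by simp [hr₅, h23₄], fun i hi => ?_, fun A h => ?_, ?_⟩
  · simp [ha₅, ha₄, ha₃, ha₂, h5₁ i hi]
  · simp only [List.mem_cons, not_or] at h
    simp [ha₅, ha₄, ha₃, ha₂, ha₁, h]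
  · simp [ho₅, ho₄, ho₃, ho₂, ho₁]

/-! ### The stages -/

/-- The parameters that determine the hash functions: the number of positions, the constant in the
number of repetitions, the rounded value of `log log n`, the logarithm of the number of buckets. -/
structure Sched where
  n : ℕ
  C : ℕ
  lam : ℕ
  β : ℕ

/-- The number of repetitions in a stage. -/
def Sched.reps (P : Sched) (m : ℕ) : ℕ := P.C * 2 ^ m * P.lam

/-- The position of the first random bit of a stage. -/
def Sched.base (P : Sched) : ℕ → ℕ
  | 0 => 0
  | m + 1 => P.base m + P.reps m * (P.n * (P.β - m))

/-- The position of the first random bit of a repetition. -/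
def Sched.pos (P : Sched) (m ρ : ℕ) : ℕ := P.base m + ρ * (P.n * (P.β - m))

/-- The number of stages. -/
def Sched.stages (P : Sched) : ℕ := min P.lam P.β + 1

/-- Runs all stages, when the arguments are the programs for a repetition and for the end of a
stage. -/
def progStages (body tail : Prog) : Prog :=
  .loop (.bin .lt (.reg 10) (.reg 9))
    (.seq (.assign 12 (.bin .sub (.reg 8) (.reg 10)))
    (.seq (.assign 14 (.bin .mul (.bin .mul (.reg 23) (.reg 11)) (.reg 7)))
    (.seq (.assign 18 (.const 0))
    (.seq (.loop (.bin .lt (.reg 18) (.reg 14))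
      (.seq body (.assign 18 (.bin .add (.reg 18) (.const 1)))))
    (.seq tail (.seq (.assign 10 (.bin .add (.reg 10) (.const 1)))
      (.seq (.assign 11 (.bin .mul (.const 2) (.reg 11)))
        (.assign 13 (.bin .div (.reg 13) (.const 2))))))))))

/-- The registers that control the stages and repetitions. -/
structure Sched.Ctl (P : Sched) (m ρ : ℕ) (τ : RamState) : Prop where
  r0 : τ.reg 0 = P.n
  r7 : τ.reg 7 = P.lam
  r8 : τ.reg 8 = P.β
  r9 : τ.reg 9 = P.stages
  r10 : τ.reg 10 = m
  r11 : τ.reg 11 = 2 ^ m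
  r12 : τ.reg 12 = P.β - m
  r13 : τ.reg 13 = 2 ^ (P.β - m)
  r14 : τ.reg 14 = P.reps m
  r18 : τ.reg 18 = ρ
  r23 : τ.reg 23 = P.C

/-- Registers used by the repetitions for their own purposes. -/
def scratch : List ℕ := [15, 16, 19, 20, 21, 22]

theorem Sched.Ctl.frame {P : Sched} {m ρ : ℕ} {τ τ' : RamState} (h : P.Ctl m ρ τ)
    (hr : ∀ r, r ∉ scratch → τ'.reg r = τ.reg r) : P.Ctl m ρ τ' := by
  constructor
  · rw [hr _ (by decide), h.r0]
  · rw [hr _ (by decide), h.r7]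
  · rw [hr _ (by decide), h.r8]
  · rw [hr _ (by decide), h.r9]
  · rw [hr _ (by decide), h.r10]
  · rw [hr _ (by decide), h.r11]
  · rw [hr _ (by decide), h.r12]
  · rw [hr _ (by decide), h.r13]
  · rw [hr _ (by decide), h.r14]
  · rw [hr _ (by decide), h.r18]
  · rw [hr _ (by decide), h.r23]

/-- The control flow is verified once, for any body and any end of stage. The condition `hJ` makes
the invariant `J` insensitive to the control registers, which the loop itself changes; it may refer
only to the two pointers, the arrays and the output. -/
theorem post_progStages (P : Sched) {body tail : Prog} (J : ℕ → ℕ → RamState → Prop)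
    {Nb Nt : ℕ → ℕ} {N : ℕ}
    (hJ : ∀ m ρ τ τ', τ'.reg 15 = τ.reg 15 → τ'.reg 16 = τ.reg 16 → τ'.arr = τ.arr →
      τ'.out = τ.out → J m ρ τ → J m ρ τ')
    (hbody : ∀ m < P.stages, ∀ ρ < P.reps m, ∀ τ, Bdd V τ → P.Ctl m ρ τ → J m ρ τ →
      Post ω V body τ (Nb m) fun τ' => J m (ρ + 1) τ' ∧ ∀ r, r ∉ scratch → τ'.reg r = τ.reg r)
    (htail : ∀ m < P.stages, ∀ τ, Bdd V τ → P.Ctl m (P.reps m) τ → J m (P.reps m) τ →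
      Post ω V tail τ (Nt m) fun τ' => J (m + 1) 0 τ' ∧ ∀ r, r ∉ scratch → τ'.reg r = τ.reg r)
    (hN : ∀ m < P.stages, P.reps m * (Nb m + 2) + Nt m + 7 ≤ N)
    (hV : ∀ m < P.stages, P.reps m ≤ V ∧ P.C * 2 ^ m ≤ V ∧ 2 ^ (m + 1) ≤ V)
    (hB : Bdd V σ) (h0 : σ.reg 0 = P.n) (h7 : σ.reg 7 = P.lam) (h8 : σ.reg 8 = P.β)
    (h9 : σ.reg 9 = P.stages) (h10 : σ.reg 10 = 0) (h11 : σ.reg 11 = 1)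
    (h13 : σ.reg 13 = 2 ^ P.β) (h23 : σ.reg 23 = P.C) (hJ0 : J 0 0 σ) :
    Post ω V (progStages body tail) σ (P.stages * (N + 1) + 1) fun τ =>
      J P.stages 0 τ ∧ τ.reg 0 = P.n := by
  refine Post.mono (Post.loop (N := N) (fun m τ => τ.reg 0 = P.n ∧ τ.reg 7 = P.lam ∧
    τ.reg 8 = P.β ∧ τ.reg 9 = P.stages ∧ τ.reg 10 = m ∧ τ.reg 11 = 2 ^ m ∧
    τ.reg 13 = 2 ^ P.β / 2 ^ m ∧ τ.reg 23 = P.C ∧ J m 0 τ) P.stages (by decide) hB ?_ ?_ ?_) le_rfl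
    fun τ _ h => ⟨h.2.2.2.2.2.2.2.2, h.1⟩
  · exact ⟨h0, h7, h8, h9, h10, by simpa using h11, by simpa using h13, h23, hJ0⟩
  · rintro m hm τ hτ ⟨h0, h7, h8, h9, h10, h11, h13, h23, hJm⟩
    obtain ⟨hV1, hV2, hV3⟩ := hV m hm
    have hmβ : m ≤ P.β := by unfold Sched.stages at hm; omega
    refine ⟨by simp [RamExpr.eval, BinOp.eval, h10, h9, hm], ?_⟩
    refine Post.mono (N := 1 + (1 + (1 + ((P.reps m * ((Nb m + 1) + 1) + 1) +
      (Nt m + (1 + (1 + 1))))))) ?_ (by have := hN m hm; ring_nf at this ⊢; omega) fun _ _ h => h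
    have hw : P.β - m ≤ V := (Nat.sub_le _ _).trans (h8 ▸ hτ.1 8)
    refine Post.seq_assign hτ (by decide) ?_ fun hB1 => Post.seq_assign hB1 (by decide) ?_
      fun hB2 => Post.seq_assign hB2 (by decide) (by simp [RamExpr.eval]) fun hB3 =>
      Post.seq (Post.loop (N := Nb m + 1) (fun ρ τ => P.Ctl m ρ τ ∧ J m ρ τ) (P.reps m) (by decide)
        hB3 ⟨?_, ?_⟩ ?_ ?_) ?_
    · simp [RamExpr.eval, BinOp.eval, h8, h10]; omega
    · simpa [RamExpr.eval, BinOp.eval, h23, h11, h7, Sched.reps] using hV1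
    · constructor <;> simp [RamExpr.eval, BinOp.eval, *, Sched.reps]
      exact Nat.pow_div hmβ (by norm_num)
    · refine hJ _ _ τ _ ?_ ?_ ?_ ?_ hJm <;> simp
    · rintro ρ hρ τ₁ hτ₁ ⟨hC₁, hJ₁⟩
      refine ⟨by simp [RamExpr.eval, BinOp.eval, hC₁.r18, hC₁.r14, hρ], Post.seq
        (hbody m hm ρ hρ τ₁ hτ₁ hC₁ hJ₁) ?_⟩
      rintro τ₂ hτ₂ ⟨hJ₂, hr₂⟩
      have hC₂ := hC₁.frame hr₂
      refine Post.assign hτ₂ (by decide) ?_ ⟨?_, ?_⟩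
      · simp [RamExpr.eval, BinOp.eval, hC₂.r18]; omega
      · obtain ⟨_, _, _, _, _, _, _, _, _, _, _⟩ := hC₂
        constructor <;> simp [RamExpr.eval, BinOp.eval, *]
      · refine hJ _ _ τ₂ _ ?_ ?_ ?_ ?_ hJ₂ <;> simp
    · rintro τ₁ hτ₁ ⟨hC₁, hJ₁⟩
      simp [RamExpr.eval, BinOp.eval, hC₁.r18, hC₁.r14]
    · rintro τ₁ hτ₁ ⟨hC₁, hJ₁⟩
      refine Post.seq (htail m hm τ₁ hτ₁ hC₁ hJ₁) ?_
      rintro τ₂ hτ₂ ⟨hJ₂, hr₂⟩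
      have hC₂ := hC₁.frame hr₂
      refine Post.seq_assign hτ₂ (by decide) ?_ fun hB4 => Post.seq_assign hB4 (by decide) ?_
        fun hB5 => Post.assign hB5 (by decide) ?_ ?_
      · simp [RamExpr.eval, BinOp.eval, hC₂.r10]
        exact (Nat.lt_two_pow_self (n := m + 1)).le.trans hV3
      · simp [RamExpr.eval, BinOp.eval, hC₂.r11]
        rw [pow_succ] at hV3; omega
      · simp only [RamExpr.eval, BinOp.eval]
        exact (Nat.div_le_self _ _).trans (hB5.1 13)
      · refine ⟨?_, ?_, ?_, ?_, ?_, ?_, ?_, ?_, hJ _ _ τ₂ _ ?_ ?_ ?_ ?_ hJ₂⟩ <;>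
          simp [RamExpr.eval, BinOp.eval, hC₂.r0, hC₂.r7, hC₂.r8, hC₂.r9, hC₂.r10, hC₂.r11,
            hC₂.r13, hC₂.r23, pow_succ, mul_comm]
        -- Register `13` is halved from stage to stage; as `m ≤ β`, the quotient `2 ^ β / 2 ^ m` is
        -- exact up to the last stage.
        rw [mul_comm 2, ← Nat.div_div_eq_div_mul, Nat.pow_div hmβ (by norm_num)]
  · rintro τ hτ ⟨-, -, -, h9, h10, -⟩
    simp [RamExpr.eval, BinOp.eval, h10, h9]

end AsymDE

/-! ### Alice's message and Bob's estimates as functions of the coins, and correctness of the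
programs. -/

namespace AsymDE

variable {ω : ℕ → Bool} {V : ℕ} {σ : RamState}

/-! ### The two programs -/

/-- The first bits of the message in stage `m`. -/
def Sched.repMsg (P : Sched) (ω : ℕ → Bool) (u : ℕ → ℕ) (m : ℕ) : ℕ → List Bool
  | 0 => []
  | ρ + 1 => P.repMsg ω u m ρ ++ segment ω P.n (P.pos m ρ) (P.β - m) u

/-- The part of the message before stage `m`. -/
def Sched.msg (P : Sched) (ω : ℕ → Bool) (u : ℕ → ℕ) : ℕ → List Bool
  | 0 => []
  | m + 1 => P.msg ω u m ++ P.repMsg ω u m (P.reps m)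

theorem Sched.length_repMsg (P : Sched) (ω : ℕ → Bool) (u : ℕ → ℕ) (m ρ : ℕ) :
    (P.repMsg ω u m ρ).length = ρ * 2 ^ (P.β - m) := by
  induction ρ with
  | zero => simp [repMsg]
  | succ ρ ih => rw [repMsg, List.length_append, ih, length_segment, add_mul, one_mul]

theorem Sched.length_msg (P : Sched) (ω : ℕ → Bool) (u : ℕ → ℕ) (m : ℕ) :
    (P.msg ω u m).length = ∑ i ∈ Finset.range m, P.reps i * 2 ^ (P.β - i) := by
  induction m with
  | zero => simp [msg]
  | succ m ih => rw [msg, List.length_append, ih, length_repMsg, Finset.sum_range_succ]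

theorem Sched.repMsg_prefix (P : Sched) (ω : ℕ → Bool) (u : ℕ → ℕ) (m : ℕ) {ρ ρ' : ℕ}
    (h : ρ ≤ ρ') : P.repMsg ω u m ρ <+: P.repMsg ω u m ρ' := by
  induction ρ', h using Nat.le_induction with
  | base => exact List.prefix_rfl
  | succ ρ' _ ih => exact ih.trans (List.prefix_append _ _)

theorem Sched.msg_prefix (P : Sched) (ω : ℕ → Bool) (u : ℕ → ℕ) {m m' : ℕ}
    (h : m ≤ m') : P.msg ω u m <+: P.msg ω u m' := by
  induction m', h using Nat.le_induction with
  | base => exact List.prefix_rfl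
  | succ ρ' _ ih => exact ih.trans (List.prefix_append _ _)

/-- The parts of the message are prefixes of one another, so the bits at Bob's reading position do
not depend on what follows. The index is always in range and the default is never used. -/
theorem Sched.getD_msg (P : Sched) (ω : ℕ → Bool) (u : ℕ → ℕ) {m M ρ v : ℕ} (hm : m < M)
    (hρ : ρ < P.reps m) (hv : v < 2 ^ (P.β - m)) :
    ((P.msg ω u M).getD ((P.msg ω u m).length + (P.repMsg ω u m ρ).length + v) false).toNat =
      parity ω P.n (P.pos m ρ) (P.β - m) u v := by
  have h1 : P.msg ω u m ++ (P.repMsg ω u m ρ ++ segment ω P.n (P.pos m ρ) (P.β - m) u) <+: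
      P.msg ω u M :=
    ((List.prefix_append_right_inj _).2 (P.repMsg_prefix ω u m hρ)).trans (P.msg_prefix ω u hm)
  obtain ⟨l, hl⟩ := h1
  have hp := parity_le ω P.n (P.pos m ρ) (P.β - m) u v
  rw [← hl, ← List.append_assoc, List.append_assoc, List.getD_append_right _ _ _ _ (by simp),
    List.length_append, Nat.add_sub_cancel_left,
    List.getD_append _ _ _ _ (by rwa [length_segment]), segment]
  rw [List.getD_eq_getElem _ _ (by simpa)]
  simp only [List.getElem_map, List.getElem_range]
  interval_cases h : parity ω P.n (P.pos m ρ) (P.β - m) u v <;> simp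

/-- The number of votes for flipping bit `j` after some repetitions of stage `m`. -/
def Sched.votes (P : Sched) (ω : ℕ → Bool) (x y : ℕ → ℕ) (m ρ j : ℕ) : ℕ :=
  ∑ i ∈ Finset.range ρ, vote ω P.n (P.pos m i) (P.β - m) x y j

theorem Sched.votes_le (P : Sched) (ω : ℕ → Bool) (x y : ℕ → ℕ) (m ρ j : ℕ) :
    P.votes ω x y m ρ j ≤ ρ := by
  refine (Finset.sum_le_sum fun i _ => vote_le _ _ _ _ _ _ _).trans ?_
  simp

/-- Bob's estimate of `x` before stage `m`, when the position `j` has label `lab j` and the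
block with label `l` has density parameter `D l`. -/
def Sched.est (P : Sched) (ω : ℕ → Bool) (D lab x y : ℕ → ℕ) : ℕ → ℕ → ℕ
  | 0 => y
  | m + 1 => fun j => if FlipCond D (2 ^ m) (P.reps m) (lab j)
      (P.votes ω x (P.est ω D lab x y m) m (P.reps m) j)
    then 1 - P.est ω D lab x y m j else P.est ω D lab x y m j

/-- The schedule that both parties compute. -/
def mkSched (C n t : ℕ) (s k : ℕ → ℕ) : Sched := ⟨n, C, loglog n, logBuckets s k t⟩

theorem Sched.base_mono (P : Sched) : Monotone P.base :=
  monotone_nat_of_le_succ fun _ => Nat.le_add_right _ _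

/-- Every repetition of stage `m` stays within the coins reserved for that stage, before those of
stage `m + 1`. -/
theorem Sched.pos_add_le (P : Sched) {m ρ : ℕ} (h : ρ < P.reps m) :
    P.pos m ρ + P.n * (P.β - m) ≤ P.base (m + 1) := by
  have := Nat.mul_le_mul_right (P.n * (P.β - m)) (Nat.succ_le_of_lt h)
  rw [Nat.succ_mul] at this
  simp only [Sched.pos, Sched.base]
  omega

/-- The message has at most so many bits, all positions on the random tape and all other numbers
in the computation are at most `V`. -/
structure Sched.Fits (P : Sched) (V : ℕ) : Prop where
  base : P.base P.stages ≤ V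
  pow_β : 2 ^ P.β ≤ V
  reps : ∀ m < P.stages, P.reps m + 1 ≤ V
  mul : ∀ m < P.stages, P.C * 2 ^ m ≤ V
  pow : ∀ m < P.stages, 2 ^ (m + 1) ≤ V
  msg : ∑ m ∈ Finset.range P.stages, P.reps m * 2 ^ (P.β - m) ≤ V

/-- A bound for the number of steps in a stage. -/
def Sched.StageBound (P : Sched) (N : ℕ) : Prop :=
  ∀ m < P.stages, P.reps m * (P.n * (4 * (P.β - m) + 10) + 7 * 2 ^ (P.β - m) + 10) +
    5 * P.n + 9 ≤ N

theorem Sched.pow_sub_le {P : Sched} (h : P.Fits V) (m : ℕ) : 2 ^ (P.β - m) ≤ V :=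
  (Nat.pow_le_pow_right (by norm_num) (Nat.sub_le _ _)).trans h.pow_β

/-- Alice's program. -/
def progAlice (C : ℕ) : Prog := .seq (progInit C) (progStages aliceBody .skip)

theorem post_progAlice (hB : Bdd V σ) {C n t N : ℕ} {s k u : ℕ → ℕ} (hn : σ.reg 0 = n)
    (ht : σ.reg 1 = t) (hs : σ.arr 0 = s) (hk : σ.arr 1 = k) (hu : σ.arr 2 = u)
    (h6 : ∀ v, σ.arr 6 v = 0) (ho : σ.out = [])
    (hC : C ≤ V) (hl : ∀ i < t, blockBits s k i ≤ n.size) (hV : 2 ^ n.size ≤ V)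
    (hF : (mkSched C n t s k).Fits V) (hN : (mkSched C n t s k).StageBound N) :
    Post ω V (progAlice C) σ (t * (4 * n.size + 8) + (4 * n.size + 4 * loglog n +
      4 * logBuckets s k t + 25) + ((mkSched C n t s k).stages * (N + 1) + 1)) fun τ =>
      τ.out = (mkSched C n t s k).msg ω u (mkSched C n t s k).stages := by
  subst hs hk hu
  refine Post.seq (post_progInit hB hn ht hC hl hV hF.pow_β) ?_
  rintro τ hτ ⟨h0, h7, h8, h9, h10, h11, h13, h15, h16, h23, -, ha, ho'⟩
  set P := mkSched C n t (σ.arr 0) (σ.arr 1)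
  refine Post.mono (post_progStages P (J := fun m ρ τ => τ.reg 15 = P.pos m ρ ∧
    (∀ v, τ.arr 6 v = 0) ∧ τ.arr 2 = σ.arr 2 ∧
    τ.out = P.msg ω (σ.arr 2) m ++ P.repMsg ω (σ.arr 2) m ρ)
    (Nb := fun m => P.n * (4 * (P.β - m) + 7) + 2 + (4 * 2 ^ (P.β - m) + 2)) (Nt := fun _ => 1)
    (N := N) ?_ ?_ ?_ ?_ ?_ hτ h0 h7 h8 h9 h10 h11 h13 h23 ?_) le_rfl ?_
  · rintro m ρ τ τ' h15 h16 ha ho h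
    rw [h15, ha, ho]; exact h
  · rintro m hm ρ hρ τ hτ hc ⟨h15, h6, h2, ho⟩
    have hpos := (P.pos_add_le hρ).trans ((P.base_mono hm).trans hF.base)
    refine Post.mono (post_aliceBody hτ hc.r0 hc.r12 hc.r13 h15 h6 hpos (Sched.pow_sub_le hF m))
      le_rfl ?_
    rintro τ' hτ' ⟨h6', ho', h15', hr', ha'⟩
    refine ⟨⟨?_, h6', ?_, ?_⟩, fun r h => hr' r fun h' => h ?_⟩
    · rw [h15']; simp only [Sched.pos]; ring
    · rw [ha' 2 (by decide), h2]
    · rw [ho', ho, h2, List.append_assoc]; rfl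
    · revert h'; simp only [scratch, List.mem_cons]; tauto
  · rintro m hm τ hτ hc ⟨h15, h6, h2, ho⟩
    refine Post.skip hτ ⟨⟨?_, h6, h2, ?_⟩, fun _ _ => rfl⟩
    · rw [h15]; simp [Sched.pos, Sched.base]
    · rw [ho]; simp [Sched.msg, Sched.repMsg]
  · intro m hm
    refine le_trans ?_ (hN m hm)
    have : P.reps m * (P.n * (4 * (P.β - m) + 7) + 2 + (4 * 2 ^ (P.β - m) + 2) + 2) ≤
        P.reps m * (P.n * (4 * (P.β - m) + 10) + 7 * 2 ^ (P.β - m) + 10) :=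
      Nat.mul_le_mul_left _ (by
        have := Nat.mul_le_mul_left P.n (show 4 * (P.β - m) + 7 ≤ 4 * (P.β - m) + 10 by omega)
        omega)
    omega
  · exact fun m hm => ⟨(Nat.le_succ _).trans (hF.reps m hm), hF.mul m hm, hF.pow m hm⟩
  · refine ⟨by rw [h15]; simp [Sched.pos, Sched.base], fun v => ?_, ha 2 (by decide), ?_⟩
    · rw [ha 6 (by decide), h6]
    · rw [ho', ho]; rfl
  · rintro τ' hτ' ⟨⟨-, -, -, ho⟩, -⟩
    simpa [Sched.repMsg] using ho

/-- Bob's program. -/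
def progBob (C : ℕ) : Prog :=
  .seq (progInit C) (.seq (progStages bobBody progFlip) progOutput)

/-- Bob's array `2` is known to agree with the mathematical estimate only at positions below `n`. -/
theorem parity_congr (ω : ℕ → Bool) {n : ℕ} (p w : ℕ) {u u' : ℕ → ℕ} (h : ∀ j < n, u j = u' j) :
    parity ω n p w u = parity ω n p w u' := by
  funext v
  unfold parity
  rw [Finset.sum_congr rfl fun j hj => by rw [h j (Finset.mem_range.1 hj)]]

/-- The estimate mentions `x`, which Bob does not know, but only through Alice's parities; `h4`
provides these in array `4`. Array `5` matches `D` only on the labels `1, …, t`, and `hlt` with the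
positivity test in `FlipCond` ensures that only these matter. -/
theorem post_progBob (hB : Bdd V σ) {C n t N : ℕ} {s k lab x y D : ℕ → ℕ} (hn : σ.reg 0 = n)
    (ht : σ.reg 1 = t) (hs : σ.arr 0 = s) (hk : σ.arr 1 = k) (hy : σ.arr 2 = y)
    (hlab : σ.arr 3 = lab)
    (h4 : σ.arr 4 = fun j => (((mkSched C n t s k).msg ω x (mkSched C n t s k).stages).getD j
      false).toNat)
    (h6 : ∀ v, σ.arr 6 v = 0) (h8 : ∀ v, σ.arr 8 v = 0) (ho : σ.out = [])
    (hD : ∀ i, D (i + 1) = blockBits s k i) (hlt : ∀ j < n, lab j ≤ t)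
    (hC : C ≤ V) (hl : ∀ i < t, blockBits s k i ≤ n.size) (hV : 2 ^ n.size ≤ V)
    (hF : (mkSched C n t s k).Fits V) (hN : (mkSched C n t s k).StageBound N) :
    Post ω V (progBob C) σ (t * (4 * n.size + 8) + (4 * n.size + 4 * loglog n +
      4 * logBuckets s k t + 25) + (((mkSched C n t s k).stages * (N + 1) + 1) + (3 * n + 2)))
      fun τ => τ.out = (List.range n).map fun j =>
        decide ((mkSched C n t s k).est ω D lab x y (mkSched C n t s k).stages j ≠ 0) := by
  subst hs hk hy hlab
  refine Post.seq (post_progInit hB hn ht hC hl hV hF.pow_β) ?_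
  rintro τ hτ ⟨h0, h7, h8', h9, h10, h11, h13, h15, h16, h23, h5, ha, ho'⟩
  set P := mkSched C n t (σ.arr 0) (σ.arr 1) with hP
  have h1V : 1 ≤ V := Nat.one_le_two_pow.trans hV
  refine Post.seq (post_progStages P (J := fun m ρ τ => τ.reg 15 = P.pos m ρ ∧
    τ.reg 16 = (P.msg ω x m).length + (P.repMsg ω x m ρ).length ∧
    (∀ v, τ.arr 6 v = 0) ∧ (∀ j < n, τ.arr 2 j = P.est ω D (σ.arr 3) x (σ.arr 2) m j) ∧
    τ.arr 3 = σ.arr 3 ∧ τ.arr 4 = σ.arr 4 ∧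
    (∀ i < t, τ.arr 5 (i + 1) = blockBits (σ.arr 0) (σ.arr 1) i) ∧
    (∀ j < n, τ.arr 8 j = P.votes ω x (P.est ω D (σ.arr 3) x (σ.arr 2) m) m ρ j) ∧
    τ.out = [])
    (Nb := fun m => P.n * (4 * (P.β - m) + 10) + 7 * 2 ^ (P.β - m) + 8)
    (Nt := fun _ => 5 * P.n + 2)
    (N := N) ?_ ?_ ?_ ?_ ?_ hτ h0 h7 h8' h9 h10 h11 h13 h23 ?_) ?_
  · rintro m ρ τ τ' h15 h16 ha ho h
    rw [h15, h16, ha, ho]; exact h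
  · rintro m hm ρ hρ τ hτ hc ⟨h15, h16, h6, h2, h3, h4', h5, h8, ho⟩
    have hpos := (P.pos_add_le hρ).trans ((P.base_mono hm).trans hF.base)
    have hmsg : (P.msg ω x m).length + (P.repMsg ω x m ρ).length + 2 ^ (P.β - m) ≤ V := by
      refine le_trans ?_ hF.msg
      rw [P.length_msg, P.length_repMsg]
      calc _ = ∑ i ∈ Finset.range m, P.reps i * 2 ^ (P.β - i) + (ρ + 1) * 2 ^ (P.β - m) := by ring
        _ ≤ ∑ i ∈ Finset.range (m + 1), P.reps i * 2 ^ (P.β - i) := by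
          rw [Finset.sum_range_succ]; gcongr; exact hρ
        _ ≤ _ := Finset.sum_le_sum_of_subset (Finset.range_subset_range.2 hm)
    refine Post.mono (post_bobBody (x := x) hτ hc.r0 hc.r12 hc.r13 h15 h16 h6 ?_ ?_ hpos hmsg)
      le_rfl ?_
    · intro j hj
      rw [h8 j hj]
      have := P.votes_le ω x (P.est ω D (σ.arr 3) x (σ.arr 2) m) m ρ j
      have := hF.reps m hm
      omega
    · intro v hv
      rw [h4', h4]
      exact P.getD_msg ω x hm hρ hv
    rintro τ' hτ' ⟨h6', h8', h15', h16', hr', ha', ho'⟩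
    have hpar : ∀ p w, parity ω P.n p w (τ.arr 2) =
        parity ω P.n p w (P.est ω D (σ.arr 3) x (σ.arr 2) m) :=
      fun p w => parity_congr ω p w h2
    refine ⟨⟨?_, ?_, h6', ?_, ?_, ?_, ?_, ?_, ?_⟩, hr'⟩
    · rw [h15']; simp only [Sched.pos]; ring
    · rw [h16', Sched.repMsg, List.length_append, length_segment, add_assoc]
    · rw [ha' 2 (by decide)]; exact h2
    · rw [ha' 3 (by decide), h3]
    · rw [ha' 4 (by decide), h4']
    · rw [ha' 5 (by decide)]; exact h5
    · intro j hj
      rw [h8' j hj, h8 j hj, Sched.votes, Sched.votes, Finset.sum_range_succ, vote, vote, hpar]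
    · rw [ho', ho]
  · rintro m hm τ hτ hc ⟨h15, h16, h6, h2, h3, h4', h5, h8, ho⟩
    refine Post.mono (post_progFlip hτ hc.r0 hc.r11 hc.r14 h1V) le_rfl ?_
    rintro τ' hτ' ⟨h2', h8', hr', ha', ho'⟩
    refine ⟨⟨?_, ?_, ?_, ?_, ?_, ?_, ?_, ?_, ?_⟩, fun r h => hr' r fun h' => h ?_⟩
    · rw [hr' 15 (by decide), h15]; simp [Sched.pos, Sched.base]
    · rw [hr' 16 (by decide), h16]; simp [Sched.msg, Sched.repMsg]
    · rw [ha' 6 (by decide)]; exact h6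
    · intro j hj
      have hiff : FlipCond (τ.arr 5) (2 ^ m) (P.reps m) (τ.arr 3 j) (τ.arr 8 j) ↔
          FlipCond D (2 ^ m) (P.reps m) (σ.arr 3 j)
            (P.votes ω x (P.est ω D (σ.arr 3) x (σ.arr 2) m) m (P.reps m) j) := by
        rw [h3, h8 j hj]
        refine and_congr_right fun hpos => ?_
        have hlt' := hlt j hj
        obtain ⟨i, hi⟩ := Nat.exists_eq_add_of_lt hpos
        rw [Nat.zero_add] at hi
        rw [hi, h5 i (by omega), hD i]
      rw [h2' j hj, Sched.est, h2 j hj]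
      simp only [hiff]
    · rw [ha' 3 (by decide), h3]
    · rw [ha' 4 (by decide), h4']
    · rw [ha' 5 (by decide)]; exact h5
    · intro j hj
      rw [h8' j hj]; simp [Sched.votes]
    · rw [ho', ho]
    · revert h'; simp only [scratch, List.mem_cons]; tauto
  · intro m hm
    exact le_trans (le_of_eq (by ring)) (hN m hm)
  · exact fun m hm => ⟨(Nat.le_succ _).trans (hF.reps m hm), hF.mul m hm, hF.pow m hm⟩
  · refine ⟨by rw [h15]; simp [Sched.pos, Sched.base], by rw [h16]; simp [Sched.msg, Sched.repMsg],
      fun v => ?_, fun j _ => ?_, ha 3 (by decide), ha 4 (by decide), h5, fun j hj => ?_, ?_⟩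
    · rw [ha 6 (by decide), h6]
    · rw [ha 2 (by decide)]; rfl
    · rw [ha 8 (by decide), h8]; simp [Sched.votes]
    · rw [ho', ho]
  · rintro τ' hτ' ⟨⟨-, -, -, h2, -, -, -, -, ho⟩, h0⟩
    refine Post.mono (post_progOutput hτ' h0) le_rfl ?_
    rintro τ'' hτ'' ho''
    rw [ho'', ho, List.nil_append]
    refine List.map_congr_left fun j hj => ?_
    rw [h2 j (List.mem_range.1 hj)]

end AsymDE

/-! ### Probability: independent coins, collisions and wrong majorities. -/

namespace AsymDE

/-! ### Events that depend on finitely many coins -/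

instance : IsProbabilityMeasure coinTape := by unfold coinTape; infer_instance

/-- The event `A` depends only on the coins in `I`. -/
def DependsOnCoins (A : Set (ℕ → Bool)) (I : Finset ℕ) : Prop :=
  ∀ ω ω' : ℕ → Bool, (∀ i ∈ I, ω i = ω' i) → ω ∈ A → ω' ∈ A

theorem DependsOnCoins.exists_preimage {A : Set (ℕ → Bool)} {I : Finset ℕ}
    (h : DependsOnCoins A I) :
    ∃ B : Set (I → Bool), A = (fun ω (i : I) => ω i) ⁻¹' B := by
  refine ⟨(fun ω (i : I) => ω i) '' A, Set.Subset.antisymm (Set.subset_preimage_image _ _) ?_⟩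
  rintro ω ⟨ω', hω', he⟩
  exact h ω' ω (fun i hi => congrFun he ⟨i, hi⟩) hω'

theorem DependsOnCoins.measurableSet {A : Set (ℕ → Bool)} {I : Finset ℕ}
    (h : DependsOnCoins A I) : MeasurableSet A := by
  obtain ⟨B, rfl⟩ := h.exists_preimage
  exact (by fun_prop : Measurable fun (ω : ℕ → Bool) (i : I) => ω i) B.toFinite.measurableSet

theorem coinTape_inter {A A' : Set (ℕ → Bool)} {I I' : Finset ℕ} (hI : Disjoint I I')
    (h : DependsOnCoins A I) (h' : DependsOnCoins A' I') :
    coinTape (A ∩ A') = coinTape A * coinTape A' := by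
  obtain ⟨B, rfl⟩ := h.exists_preimage
  obtain ⟨B', rfl⟩ := h'.exists_preimage
  have hind : ProbabilityTheory.iIndepFun (fun (i : ℕ) (ω : ℕ → Bool) => ω i) coinTape :=
    ProbabilityTheory.iIndepFun_infinitePi (X := fun _ b => b) fun _ => measurable_id
  exact (hind.indepFun_finset I I' hI fun i => measurable_pi_apply i).measure_inter_preimage_eq_mul
    _ _ B.toFinite.measurableSet B'.toFinite.measurableSet

theorem coinTape_cylinder (I : Finset ℕ) (v : ℕ → Bool) :
    coinTape {ω | ∀ i ∈ I, ω i = v i} = 2⁻¹ ^ I.card := by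
  have h : {ω : ℕ → Bool | ∀ i ∈ I, ω i = v i} = Set.pi I fun i => {v i} := by
    ext ω; simp [Set.mem_pi]
  rw [h, coinTape, Measure.infinitePi_pi _ fun i _ => MeasurableSet.singleton _,
    Finset.prod_eq_pow_card]
  intro i _
  rw [PMF.toMeasure_apply_singleton _ _ (MeasurableSet.singleton _)]
  simp

/-- If a random set of positions depends on the coins before `N` only, then it can be regarded as
fixed when later coins are tossed. -/
theorem coinTape_conditional {n N N' : ℕ} (X : (ℕ → Bool) → Finset ℕ)
    (hX : ∀ ω ω' : ℕ → Bool, (∀ i < N, ω i = ω' i) → X ω = X ω')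
    (hXn : ∀ ω, X ω ⊆ Finset.range n) (good : Finset ℕ → Prop)
    (A : Finset ℕ → Set (ℕ → Bool)) {δ : ENNReal}
    (hA : ∀ E ⊆ Finset.range n, DependsOnCoins (A E) (Finset.Ico N N'))
    (hδ : ∀ E ⊆ Finset.range n, good E → coinTape (A E) ≤ δ) :
    coinTape {ω | good (X ω) ∧ ω ∈ A (X ω)} ≤ δ := by
  classical
  have hdep : ∀ E, DependsOnCoins {ω | X ω = E} (Finset.range N) := by
    intro E ω ω' h hω
    simp only [Set.mem_ofPred_eq] at hω ⊢
    rw [← hω, hX ω ω' fun i hi => h i (Finset.mem_range.2 hi)]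
  have hdisj : Disjoint (Finset.range N) (Finset.Ico N N') := by
    rw [Finset.disjoint_left]
    intro i hi hi'
    have := Finset.mem_range.1 hi
    have := (Finset.mem_Ico.1 hi').1
    omega
  have hsub : {ω | good (X ω) ∧ ω ∈ A (X ω)} ⊆
      ⋃ E ∈ (Finset.range n).powerset.filter good, {ω | X ω = E} ∩ A E := by
    rintro ω ⟨hg, hω⟩
    simp only [Set.mem_iUnion]
    exact ⟨X ω, Finset.mem_filter.2 ⟨Finset.mem_powerset.2 (hXn ω), hg⟩, rfl, hω⟩
  calc coinTape {ω | good (X ω) ∧ ω ∈ A (X ω)}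
      ≤ ∑ E ∈ (Finset.range n).powerset.filter good, coinTape ({ω | X ω = E} ∩ A E) :=
        (measure_mono hsub).trans (measure_biUnion_finset_le _ _)
    _ ≤ ∑ E ∈ (Finset.range n).powerset.filter good, coinTape {ω | X ω = E} * δ := by
        refine Finset.sum_le_sum fun E hE => ?_
        rw [Finset.mem_filter, Finset.mem_powerset] at hE
        rw [coinTape_inter hdisj (hdep E) (hA E hE.1)]
        gcongr
        exact hδ E hE.1 hE.2
    _ = coinTape (⋃ E ∈ (Finset.range n).powerset.filter good, {ω | X ω = E}) * δ := by
        rw [← Finset.sum_mul, measure_biUnion_finset _ fun E _ => (hdep E).measurableSet]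
        intro E _ E' _ hne
        rw [Function.onFun, Set.disjoint_left]
        intro ω hω hω'
        exact hne (hω.symm.trans hω')
    _ ≤ 1 * δ := by gcongr; exact prob_le_one
    _ = δ := one_mul δ

/-! ### Collisions -/

/-- Once the coins in the image of `g` are fixed, every coin `f a` is forced, and these are `T.card`
further distinct coins. The event is covered by the cylinders for all patterns on the image of `g`.
Injectivity of `g` is not needed, which allows several positions to collide with the same error. -/
theorem coinTape_coins_eq_le {ι : Type*} (T : Finset ι) (f g : ι → ℕ) (hf : Set.InjOn f T)
    (hfg : ∀ a ∈ T, ∀ b ∈ T, g a ≠ f b) :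
    coinTape {ω | ∀ a ∈ T, ω (f a) = ω (g a)} ≤ 2⁻¹ ^ T.card := by
  classical
  set I := T.image f with hI
  set J := T.image g with hJ
  have hIJ : Disjoint I J := by
    rw [Finset.disjoint_left]
    intro i hi hj
    obtain ⟨b, hb, rfl⟩ := Finset.mem_image.1 hi
    obtain ⟨a, ha, hab⟩ := Finset.mem_image.1 hj
    exact hfg a ha b hb hab
  have hcard : I.card = T.card := Finset.card_image_of_injOn hf
  rcases T.eq_empty_or_nonempty with rfl | ⟨a₀, ha₀⟩
  · simp
  have : Nonempty ι := ⟨a₀⟩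
  set r := Function.invFunOn f T with hr
  have hrf : ∀ a ∈ T, r (f a) = a := fun a ha => hf.leftInvOn_invFunOn ha
  have hsub : {ω : ℕ → Bool | ∀ a ∈ T, ω (f a) = ω (g a)} ⊆ ⋃ c ∈ J.powerset,
      {ω | ∀ i ∈ I ∪ J, ω i = decide ((if i ∈ I then g (r i) else i) ∈ c)} := by
    intro ω hω
    simp only [Set.mem_iUnion]
    refine ⟨J.filter fun i => ω i = true, by simp, fun i hi => ?_⟩
    rcases Finset.mem_union.1 hi with hi | hi
    · rw [if_pos hi]
      obtain ⟨a, ha, rfl⟩ := Finset.mem_image.1 hi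
      rw [hrf a ha, hω a ha]
      simp [Finset.mem_filter, hJ, Finset.mem_image_of_mem g ha]
    · rw [if_neg fun h => Finset.disjoint_left.1 hIJ h hi]
      simp [Finset.mem_filter, hi]
  calc _ ≤ ∑ c ∈ J.powerset, (2⁻¹ : ENNReal) ^ (I ∪ J).card := by
        refine (measure_mono hsub).trans ((measure_biUnion_finset_le _ _).trans ?_)
        exact Finset.sum_le_sum fun c _ => (coinTape_cylinder _ _).le
    _ = 2⁻¹ ^ T.card := by
        rw [Finset.sum_const, Finset.card_powerset, Finset.card_union_of_disjoint hIJ, hcard,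
          pow_add, nsmul_eq_mul, Nat.cast_pow, Nat.cast_ofNat, mul_left_comm, ← mul_pow,
          ENNReal.mul_inv_cancel (by norm_num) (by norm_num), one_pow, mul_one]

/-- Uniqueness of quotient and remainder; applied twice it shows that different triples of
repetition, position and bit use different coins. -/
theorem mul_add_inj {a a' l l' w : ℕ} (hl : l < w) (hl' : l' < w)
    (h : a * w + l = a' * w + l') : a = a' ∧ l = l' := by
  have hw : 0 < w := by omega
  have h1 := congrArg (· / w) h
  have h2 := congrArg (· % w) h
  simp only [Nat.mul_comm _ w, Nat.mul_add_div hw, Nat.div_eq_of_lt hl, Nat.div_eq_of_lt hl',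
    Nat.mul_add_mod, Nat.mod_eq_of_lt hl, Nat.mod_eq_of_lt hl'] at h1 h2
  omega

/-- The bucket of `u.2` in the repetition `u.1`, when the random bits from `p` on are used. -/
def cell (ω : ℕ → Bool) (n p w : ℕ) (u : ℕ × ℕ) : ℕ := bkt ω (p + u.1 * (n * w) + u.2 * w) w

/-- The probability that given positions collide with positions of a set that are not among them. -/
theorem coinTape_collisions_le {n p w : ℕ} (U : Finset (ℕ × ℕ)) (hU : ∀ u ∈ U, u.2 < n)
    (E : Finset ℕ) (hE : E ⊆ Finset.range n) :
    coinTape {ω | ∀ u ∈ U, ∃ e ∈ E, (u.1, e) ∉ U ∧ cell ω n p w (u.1, e) = cell ω n p w u} ≤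
      ((E.card : ENNReal) * 2⁻¹ ^ w) ^ U.card := by
  classical
  -- Union bound over the choices `q` of a colliding error for each `u`, of which there are `E.card
  -- ^ U.card`.
  have hsub : {ω | ∀ u ∈ U, ∃ e ∈ E, (u.1, e) ∉ U ∧ cell ω n p w (u.1, e) = cell ω n p w u} ⊆
      ⋃ q ∈ Fintype.piFinset (fun _ : U => E), {ω | ∀ u : U, (u.1.1, q u) ∉ U ∧
        cell ω n p w (u.1.1, q u) = cell ω n p w u} := by
    intro ω hω
    choose! q hq using hω
    simp only [Set.mem_iUnion]
    exact ⟨fun u => q u, Fintype.mem_piFinset.2 fun u => (hq u u.2).1, fun u => (hq u u.2).2⟩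
  refine (measure_mono hsub).trans ((measure_biUnion_finset_le _ _).trans ?_)
  have hbound : ∀ q ∈ Fintype.piFinset (fun _ : U => E), coinTape {ω | ∀ u : U,
      (u.1.1, q u) ∉ U ∧ cell ω n p w (u.1.1, q u) = cell ω n p w u} ≤
      2⁻¹ ^ (U.card * w) := by
    intro q hq
    have hqn : ∀ u, q u < n := fun u => Finset.mem_range.1 (hE (Fintype.mem_piFinset.1 hq u))
    -- If some chosen partner lies in `U`, the event is empty. Otherwise the coins of the partners
    -- are disjoint from those of `U`, as `coinTape_coins_eq_le` requires.
    by_cases hqU : ∀ u : U, (u.1.1, q u) ∉ U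
    swap
    · rw [show {ω | ∀ u : U, (u.1.1, q u) ∉ U ∧ cell ω n p w (u.1.1, q u) = cell ω n p w u} = ∅
        from Set.eq_empty_of_forall_notMem fun ω hω => hqU fun u => (hω u).1]
      simp
    have haddr : ∀ {ρ j l ρ' j' l' : ℕ}, j < n → j' < n → l < w → l' < w →
        p + ρ * (n * w) + j * w + l = p + ρ' * (n * w) + j' * w + l' →
        ρ = ρ' ∧ j = j' ∧ l = l' := by
      intro ρ j l ρ' j' l' hj hj' hl hl' h
      obtain ⟨h1, h2⟩ := mul_add_inj (a := ρ * n + j) (a' := ρ' * n + j') hl hl' (by linarith)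
      obtain ⟨h3, h4⟩ := mul_add_inj hj hj' h1
      exact ⟨h3, h4, h2⟩
    have key := coinTape_coins_eq_le (Finset.univ ×ˢ Finset.range w : Finset (U × ℕ))
      (fun a => p + a.1.1.1 * (n * w) + a.1.1.2 * w + a.2)
      (fun a => p + a.1.1.1 * (n * w) + q a.1 * w + a.2) ?_ ?_
    · rw [Finset.card_product, Finset.card_range, Finset.card_univ, Fintype.card_coe] at key
      refine (measure_mono ?_).trans key
      intro ω hω a ha
      have h1 := (hω a.1).2
      rw [cell, cell, bkt_eq_iff] at h1
      exact (h1 a.2 (Finset.mem_range.1 (Finset.mem_product.1 ha).2)).symm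
    · intro a ha b hb hab
      simp only [Finset.coe_product, Set.mem_prod, Finset.mem_coe, Finset.mem_range] at ha hb
      obtain ⟨h1, h2, h3⟩ := haddr (hU _ a.1.2) (hU _ b.1.2) ha.2 hb.2 hab
      exact Prod.ext (Subtype.ext (Prod.ext h1 h2)) h3
    · intro a ha b hb hab
      simp only [Finset.mem_product, Finset.mem_range] at ha hb
      obtain ⟨h1, h2, h3⟩ := haddr (hqn _) (hU _ b.1.2) ha.2 hb.2 hab
      refine hqU a.1 ?_
      rw [show (a.1.1.1, q a.1) = b.1.1 from Prod.ext h1 h2]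
      exact b.1.2
  refine (Finset.sum_le_sum hbound).trans (le_of_eq ?_)
  rw [Finset.sum_const, Fintype.card_piFinset, Finset.prod_const, Finset.card_univ, Fintype.card_coe, nsmul_eq_mul, mul_pow,
    Nat.cast_pow, mul_comm U.card w, pow_mul]

/-- The set of positions `E` meets the bucket of `u` in another position. -/
def Hit (b : ℕ × ℕ → ℕ) (E : Finset ℕ) (u : ℕ × ℕ) : Prop :=
  ∃ e ∈ E, e ≠ u.2 ∧ b (u.1, e) = b u

/-- Split `W` according to whether some error in the same bucket precedes or follows the position,
and keep the larger part. In the first case the smallest error of the bucket serves as partner: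
nothing precedes it, so it is not in the part. In the second case the largest one does. -/
theorem exists_half_hit (b : ℕ × ℕ → ℕ) (E : Finset ℕ) (W : Finset (ℕ × ℕ))
    (hW : ∀ u ∈ W, Hit b E u) :
    ∃ U ⊆ W, W.card ≤ 2 * U.card ∧ ∀ u ∈ U, ∃ e ∈ E, (u.1, e) ∉ U ∧ b (u.1, e) = b u := by
  classical
  set U₁ := W.filter fun u => ∃ e ∈ E, e < u.2 ∧ b (u.1, e) = b u with hU₁
  set U₂ := W.filter fun u => ∃ e ∈ E, u.2 < e ∧ b (u.1, e) = b u with hU₂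
  have hcover : W ⊆ U₁ ∪ U₂ := by
    intro u hu
    obtain ⟨e, he, hne, hb⟩ := hW u hu
    rcases lt_or_gt_of_ne hne with h | h
    · exact Finset.mem_union_left _ (Finset.mem_filter.2 ⟨hu, e, he, h, hb⟩)
    · exact Finset.mem_union_right _ (Finset.mem_filter.2 ⟨hu, e, he, h, hb⟩)
  have hcard : W.card ≤ U₁.card + U₂.card :=
    (Finset.card_le_card hcover).trans (Finset.card_union_le _ _)
  have hne : ∀ u ∈ W, (E.filter fun e => b (u.1, e) = b u).Nonempty := by
    intro u hu
    obtain ⟨e, he, -, hb⟩ := hW u hu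
    exact ⟨e, Finset.mem_filter.2 ⟨he, hb⟩⟩
  rcases le_total U₂.card U₁.card with h | h
  · refine ⟨U₁, Finset.filter_subset _ _, by omega, fun u hu => ?_⟩
    have huW := (Finset.mem_filter.1 hu).1
    have hmin := Finset.min'_mem _ (hne u huW)
    rw [Finset.mem_filter] at hmin
    refine ⟨_, hmin.1, fun hmem => ?_, hmin.2⟩
    obtain ⟨e', he', hlt, hb'⟩ := (Finset.mem_filter.1 hmem).2
    have := Finset.min'_le (E.filter fun e => b (u.1, e) = b u) e'
      (Finset.mem_filter.2 ⟨he', hb'.trans hmin.2⟩)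
    exact absurd hlt (not_lt.2 this)
  · refine ⟨U₂, Finset.filter_subset _ _, by omega, fun u hu => ?_⟩
    have huW := (Finset.mem_filter.1 hu).1
    have hmax := Finset.max'_mem _ (hne u huW)
    rw [Finset.mem_filter] at hmax
    refine ⟨_, hmax.1, fun hmem => ?_, hmax.2⟩
    obtain ⟨e', he', hlt, hb'⟩ := (Finset.mem_filter.1 hmem).2
    have := Finset.le_max' (E.filter fun e => b (u.1, e) = b u) e'
      (Finset.mem_filter.2 ⟨he', hb'.trans hmax.2⟩)
    exact absurd hlt (not_lt.2 this)

/-! ### Misjudged positions -/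

/-- The parity of the number of elements of `E` in the bucket of `u`. -/
def errVote (b : ℕ × ℕ → ℕ) (E : Finset ℕ) (u : ℕ × ℕ) : ℕ :=
  (E.filter fun e => b (u.1, e) = b u).card % 2

/-- The majority vote of `R` repetitions on the question whether `j` is in `E` is wrong. -/
def Misjudged (b : ℕ × ℕ → ℕ) (R : ℕ) (E : Finset ℕ) (j : ℕ) : Prop :=
  ¬ (j ∈ E ↔ R < 2 * ∑ ρ ∈ Finset.range R, errVote b E (ρ, j))

/-- Without a collision the only possible error in the bucket is the position itself, so the vote is
correct. -/
theorem errVote_of_not_hit {b : ℕ × ℕ → ℕ} {E : Finset ℕ} {u : ℕ × ℕ} (h : ¬ Hit b E u) :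
    errVote b E u = if u.2 ∈ E then 1 else 0 := by
  classical
  have h' : E.filter (fun e => b (u.1, e) = b u) = if u.2 ∈ E then {u.2} else ∅ := by
    ext e
    split_ifs with hu
    · rw [Finset.mem_filter, Finset.mem_singleton]
      refine ⟨fun he => ?_, ?_⟩
      · by_contra hne
        exact h ⟨e, he.1, hne, he.2⟩
      · rintro rfl
        exact ⟨hu, rfl⟩
    · rw [Finset.mem_filter]
      refine ⟨fun he => absurd ⟨e, he.1, ?_, he.2⟩ h, fun he => absurd he (Finset.notMem_empty _)⟩
      rintro rfl
      exact hu he.1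
  rw [errVote, h']
  split_ifs <;> simp

-- Every repetition without a collision votes correctly, so a wrong majority, ties included, needs
-- at least half of the repetitions to have one.
open Classical in
theorem Misjudged.le_card_hit {b : ℕ × ℕ → ℕ} {R : ℕ} {E : Finset ℕ} {j : ℕ}
    (h : Misjudged b R E j) : R ≤ 2 * ((Finset.range R).filter fun ρ => Hit b E (ρ, j)).card := by
  have hsplit := Finset.sum_filter_add_sum_filter_not (Finset.range R)
    (fun ρ => Hit b E (ρ, j)) (fun ρ => errVote b E (ρ, j))
  have hcard := Finset.card_filter_add_card_filter_not (s := Finset.range R)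
    (fun ρ => Hit b E (ρ, j))
  rw [Finset.card_range] at hcard
  have h1 : ∑ ρ ∈ (Finset.range R).filter (fun ρ => ¬ Hit b E (ρ, j)), errVote b E (ρ, j) =
      ((Finset.range R).filter fun ρ => ¬ Hit b E (ρ, j)).card * if j ∈ E then 1 else 0 := by
    rw [Finset.sum_congr rfl fun ρ hρ => errVote_of_not_hit (Finset.mem_filter.1 hρ).2]
    by_cases hj : j ∈ E <;> simp [hj]
  have h2 : ∑ ρ ∈ (Finset.range R).filter (fun ρ => Hit b E (ρ, j)), errVote b E (ρ, j) ≤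
      ((Finset.range R).filter fun ρ => Hit b E (ρ, j)).card := by
    rw [Finset.card_eq_sum_ones]
    exact Finset.sum_le_sum fun ρ _ => by unfold errVote; omega
  rw [Misjudged] at h
  by_cases hj : j ∈ E
  · rw [if_pos hj] at h1
    simp only [hj, true_iff] at h
    omega
  · rw [if_neg hj] at h1
    simp only [hj, false_iff, not_not] at h
    omega

/-- The probability that all positions in `F` are misjudged. -/
theorem coinTape_misjudged_le {n p w R : ℕ} (F E : Finset ℕ) (hF : F ⊆ Finset.range n)
    (hE : E ⊆ Finset.range n) (hcard : E.card * 2 ^ 12 ≤ 2 ^ w) :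
    coinTape {ω | ∀ j ∈ F, Misjudged (cell ω n p w) R E j} ≤ 2⁻¹ ^ (2 * (F.card * R)) := by
  classical
  -- At least `F.card * R / 2` pairs have a collision, and `exists_half_hit` keeps half of them:
  -- hence the `4`.
  have hsub : {ω | ∀ j ∈ F, Misjudged (cell ω n p w) R E j} ⊆
      ⋃ U ∈ (Finset.range R ×ˢ F).powerset.filter (fun U => F.card * R ≤ 4 * U.card),
        {ω | ∀ u ∈ U, ∃ e ∈ E, (u.1, e) ∉ U ∧ cell ω n p w (u.1, e) = cell ω n p w u} := by
    intro ω hω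
    set W := (Finset.range R ×ˢ F).filter (Hit (cell ω n p w) E) with hW
    obtain ⟨U, hU, hc, hh⟩ := exists_half_hit (cell ω n p w) E W
      fun u hu => (Finset.mem_filter.1 hu).2
    have hWc : F.card * R ≤ 2 * W.card := by
      have h1 : W.card = ∑ j ∈ F,
          ((Finset.range R).filter fun ρ => Hit (cell ω n p w) E (ρ, j)).card := by
        rw [hW, Finset.card_filter, Finset.sum_product_right]
        exact Finset.sum_congr rfl fun j _ => (Finset.card_filter _ _).symm
      rw [h1, Finset.mul_sum, ← smul_eq_mul, ← Finset.sum_const]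
      exact Finset.sum_le_sum fun j hj => (hω j hj).le_card_hit
    simp only [Set.mem_iUnion]
    exact ⟨U, Finset.mem_filter.2 ⟨Finset.mem_powerset.2 (hU.trans (Finset.filter_subset _ _)),
      by omega⟩, hh⟩
  have h12 : (E.card : ENNReal) * 2⁻¹ ^ w ≤ 2⁻¹ ^ 12 := by
    have h1 : (E.card : ENNReal) * 2 ^ 12 ≤ 2 ^ w := by exact_mod_cast hcard
    have h2 : (2 : ENNReal) ^ w * 2⁻¹ ^ w = 1 := by
      rw [← mul_pow, ENNReal.mul_inv_cancel (by norm_num) (by norm_num), one_pow]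
    have h3 : (2 : ENNReal) ^ 12 * 2⁻¹ ^ 12 = 1 := by
      rw [← mul_pow, ENNReal.mul_inv_cancel (by norm_num) (by norm_num), one_pow]
    calc (E.card : ENNReal) * 2⁻¹ ^ w = (E.card * 2 ^ 12) * (2⁻¹ ^ 12 * 2⁻¹ ^ w) := by
          rw [mul_assoc, ← mul_assoc (2 ^ 12), h3, one_mul]
      _ ≤ 2 ^ w * (2⁻¹ ^ 12 * 2⁻¹ ^ w) := by gcongr
      _ = 2⁻¹ ^ 12 := by rw [mul_left_comm, h2, mul_one]
  have hhalf : (2⁻¹ : ENNReal) ≤ 1 := by simp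
  -- Each `U` contributes `2^(-12 * U.card)`, at most `2^(-3 * F.card * R)`. There are at most
  -- `2^(F.card * R)` sets `U`, which leaves the exponent `2 * F.card * R`.
  calc _ ≤ ∑ U ∈ (Finset.range R ×ˢ F).powerset.filter (fun U => F.card * R ≤ 4 * U.card),
        (2⁻¹ : ENNReal) ^ (3 * (F.card * R)) := by
        refine (measure_mono hsub).trans ((measure_biUnion_finset_le _ _).trans ?_)
        refine Finset.sum_le_sum fun U hU => ?_
        rw [Finset.mem_filter, Finset.mem_powerset] at hU
        refine (coinTape_collisions_le U (fun u hu => ?_) E hE).trans ?_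
        · exact Finset.mem_range.1 (hF (Finset.mem_product.1 (hU.1 hu)).2)
        · calc _ ≤ ((2⁻¹ : ENNReal) ^ 12) ^ U.card := by gcongr
            _ = 2⁻¹ ^ (12 * U.card) := (pow_mul _ _ _).symm
            _ ≤ _ := pow_le_pow_right_of_le_one' hhalf (by omega)
    _ ≤ 2 ^ (F.card * R) * 2⁻¹ ^ (3 * (F.card * R)) := by
        rw [Finset.sum_const, nsmul_eq_mul]
        gcongr
        refine (Nat.cast_le.2 (Finset.card_filter_le _ _)).trans ?_
        rw [Finset.card_powerset, Finset.card_product, Finset.card_range, mul_comm R]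
        simp
    _ = 2⁻¹ ^ (2 * (F.card * R)) := by
        rw [show 3 * (F.card * R) = F.card * R + 2 * (F.card * R) by ring, pow_add, ← mul_assoc,
          ← mul_pow, ENNReal.mul_inv_cancel (by norm_num) (by norm_num), one_pow, one_mul]

open Classical in
/-- The probability that at least `f` positions of `cand` are misjudged. -/
theorem coinTape_many_misjudged_le {n p w R f : ℕ} (cand E : Finset ℕ)
    (hcand : cand ⊆ Finset.range n) (hE : E ⊆ Finset.range n)
    (hcard : E.card * 2 ^ 12 ≤ 2 ^ w) :
    coinTape {ω | f ≤ (cand.filter (Misjudged (cell ω n p w) R E)).card} ≤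
      cand.card.choose f * 2⁻¹ ^ (2 * (f * R)) := by
  have hsub : {ω | f ≤ (cand.filter (Misjudged (cell ω n p w) R E)).card} ⊆
      ⋃ F ∈ cand.powersetCard f, {ω | ∀ j ∈ F, Misjudged (cell ω n p w) R E j} := by
    intro ω hω
    obtain ⟨F, hF, hFc⟩ := Finset.exists_subset_card_eq hω
    simp only [Set.mem_iUnion]
    exact ⟨F, Finset.mem_powersetCard.2 ⟨hF.trans (Finset.filter_subset _ _), hFc⟩,
      fun j hj => (Finset.mem_filter.1 (hF hj)).2⟩
  refine (measure_mono hsub).trans ((measure_biUnion_finset_le _ _).trans ?_)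
  refine (Finset.sum_le_sum (g := fun _ => 2⁻¹ ^ (2 * (f * R))) fun F hF => ?_).trans ?_
  · rw [Finset.mem_powersetCard] at hF
    have := coinTape_misjudged_le (p := p) (R := R) F E (hF.1.trans hcand) hE hcard
    rwa [hF.2] at this
  · rw [Finset.sum_const, Finset.card_powersetCard, nsmul_eq_mul]

end AsymDE

/-! ### Evolution of the errors over the stages, and the failure probability. -/

namespace AsymDE

/-! ### The positions where Bob's estimate is wrong -/

/-- The positions where Bob's estimate before stage `m` is wrong. -/
def Sched.errSet (P : Sched) (ω : ℕ → Bool) (D lab x y : ℕ → ℕ) (m : ℕ) : Finset ℕ :=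
  (Finset.range P.n).filter fun j => x j ≠ P.est ω D lab x y m j

/-- The positions in blocks with density parameter at most `g`. -/
def Sched.cand (P : Sched) (D lab : ℕ → ℕ) (g : ℕ) : Finset ℕ :=
  (Finset.range P.n).filter fun j => 0 < lab j ∧ D (lab j) ≤ g

/-- The buckets of stage `m`. -/
def Sched.stageCell (P : Sched) (ω : ℕ → Bool) (m : ℕ) : ℕ × ℕ → ℕ :=
  cell ω P.n (P.base m) (P.β - m)

open Classical in
/-- The positions that Bob judges wrongly in stage `m` when his estimate is wrong on `E`. -/
noncomputable def Sched.misSet (P : Sched) (ω : ℕ → Bool) (D lab : ℕ → ℕ) (m : ℕ)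
    (E : Finset ℕ) : Finset ℕ :=
  (P.cand D lab (2 ^ m)).filter (Misjudged (P.stageCell ω m) (P.reps m) E)

variable {P : Sched} {ω : ℕ → Bool} {D lab x y : ℕ → ℕ}

theorem Sched.errSet_subset (m : ℕ) : P.errSet ω D lab x y m ⊆ Finset.range P.n :=
  Finset.filter_subset _ _

theorem Sched.est_succ (m j : ℕ) : P.est ω D lab x y (m + 1) j =
    if FlipCond D (2 ^ m) (P.reps m) (lab j)
      (P.votes ω x (P.est ω D lab x y m) m (P.reps m) j)
    then 1 - P.est ω D lab x y m j else P.est ω D lab x y m j := rfl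

theorem Sched.est_le (hy : ∀ j, y j ≤ 1) (m j : ℕ) : P.est ω D lab x y m j ≤ 1 := by
  induction m with
  | zero => exact hy j
  | succ m ih =>
    rw [est_succ]
    split_ifs
    · omega
    · exact ih

/-- For bits, `x + y` is odd exactly when they differ, so the sum of the two parities counts the
errors in the bucket modulo 2. -/
theorem vote_eq_errVote {n p w : ℕ} (hx : ∀ j, x j ≤ 1) (hy : ∀ j, y j ≤ 1) (ρ j : ℕ) :
    vote ω n (p + ρ * (n * w)) w x y j =
      errVote (cell ω n p w) ((Finset.range n).filter fun j => x j ≠ y j) (ρ, j) := by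
  rw [vote, parity, parity, errVote, ← Nat.add_mod, ← Finset.sum_add_distrib, Finset.filter_filter,
    Finset.card_filter, Finset.sum_nat_mod, Finset.sum_nat_mod (Finset.range n) 2 (fun i =>
      if x i ≠ y i ∧ _ then 1 else 0)]
  congr 1
  refine Finset.sum_congr rfl fun i _ => ?_
  have hxi := hx i
  have hyi := hy i
  simp only [cell]
  by_cases hb : bkt ω (p + ρ * (n * w) + i * w) w = bkt ω (p + ρ * (n * w) + j * w) w
  · by_cases h : x i = y i
    · simp only [hb, h, if_true, ne_eq, not_true_eq_false, false_and, if_false]; omega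
    · simp only [hb, h, if_true, ne_eq, not_false_eq_true, and_true]; omega
  · simp [hb]

theorem Sched.votes_eq (hx : ∀ j, x j ≤ 1) (hy : ∀ j, y j ≤ 1) (m ρ j : ℕ) :
    P.votes ω x (P.est ω D lab x y m) m ρ j =
      ∑ i ∈ Finset.range ρ, errVote (P.stageCell ω m) (P.errSet ω D lab x y m) (i, j) :=
  Finset.sum_congr rfl fun i _ => vote_eq_errVote hx (Sched.est_le hy m) i j

/-- A candidate is flipped exactly when the majority declares it an error; since entries are bits,
it is wrong afterwards if and only if that verdict was wrong. -/
theorem Sched.mem_errSet_succ_of_mem (hx : ∀ j, x j ≤ 1) (hy : ∀ j, y j ≤ 1) {m j : ℕ}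
    (hj : j ∈ P.cand D lab (2 ^ m)) : j ∈ P.errSet ω D lab x y (m + 1) ↔
      j ∈ P.misSet ω D lab m (P.errSet ω D lab x y m) := by
  classical
  have hj' := hj
  rw [cand, Finset.mem_filter] at hj'
  rw [misSet, Finset.mem_filter, and_iff_right hj, Misjudged, ← Sched.votes_eq hx hy, errSet,
    errSet, Finset.mem_filter, Finset.mem_filter, and_iff_right hj'.1, and_iff_right hj'.1, est_succ]
  have hxj := hx j
  have hej : P.est ω D lab x y m j ≤ 1 := Sched.est_le hy m j
  by_cases hv : P.reps m < 2 * P.votes ω x (P.est ω D lab x y m) m (P.reps m) j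
  · rw [if_pos ⟨hj'.2.1, hj'.2.2, hv⟩]
    simp only [hv, iff_true, ne_eq, not_not]
    omega
  · rw [if_neg fun h => hv h.2.2]
    simp only [hv, iff_false, ne_eq, not_not]

theorem Sched.mem_errSet_succ_of_notMem {m j : ℕ} (hj : j ∉ P.cand D lab (2 ^ m)) :
    j ∈ P.errSet ω D lab x y (m + 1) ↔ j ∈ P.errSet ω D lab x y m := by
  rw [errSet, errSet, Finset.mem_filter, Finset.mem_filter]
  refine and_congr_right fun hn => ?_
  rw [est_succ, if_neg]
  exact fun h => hj (Finset.mem_filter.2 ⟨hn, h.1, h.2.1⟩)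

/-! ### Which coins the stages use -/

theorem bkt_congr {ω ω' : ℕ → Bool} {p w : ℕ} (h : ∀ l < w, ω (p + l) = ω' (p + l)) :
    bkt ω p w = bkt ω' p w := by
  induction w with
  | zero => rfl
  | succ w ih => rw [bkt, bkt, ih fun l hl => h l (by omega), h w (by omega)]

theorem Sched.stageCell_congr {ω ω' : ℕ → Bool} {m : ℕ}
    (h : ∀ i ∈ Finset.Ico (P.base m) (P.base (m + 1)), ω i = ω' i) {ρ j : ℕ} (hρ : ρ < P.reps m)
    (hj : j < P.n) : P.stageCell ω m (ρ, j) = P.stageCell ω' m (ρ, j) := by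
  refine bkt_congr fun l hl => h _ (Finset.mem_Ico.2 ⟨by omega, ?_⟩)
  have h1 := P.pos_add_le hρ
  have h2 := Nat.mul_le_mul_right (P.β - m) (Nat.succ_le_of_lt hj)
  rw [Nat.succ_mul] at h2
  rw [Sched.pos] at h1
  simp only
  omega

theorem Sched.misSet_congr {ω ω' : ℕ → Bool} {m : ℕ}
    (h : ∀ i ∈ Finset.Ico (P.base m) (P.base (m + 1)), ω i = ω' i) {E : Finset ℕ}
    (hE : E ⊆ Finset.range P.n) : P.misSet ω D lab m E = P.misSet ω' D lab m E := by
  classical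
  refine Finset.filter_congr fun j hj => ?_
  have hj' : j < P.n := Finset.mem_range.1 (Finset.filter_subset _ _ hj)
  have : ∀ ρ ∈ Finset.range (P.reps m), errVote (P.stageCell ω m) E (ρ, j) =
      errVote (P.stageCell ω' m) E (ρ, j) := by
    intro ρ hρ
    rw [Finset.mem_range] at hρ
    rw [errVote, errVote]
    congr 2
    refine Finset.filter_congr fun e he => ?_
    rw [P.stageCell_congr h hρ hj', P.stageCell_congr h hρ (Finset.mem_range.1 (hE he))]
  rw [Misjudged, Misjudged, Finset.sum_congr rfl this]

/-- The errors before stage `m` are determined by coins that stage `m` does not use. This is what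
`coinTape_conditional` needs. -/
theorem Sched.errSet_congr (hx : ∀ j, x j ≤ 1) (hy : ∀ j, y j ≤ 1) {ω ω' : ℕ → Bool} {m : ℕ}
    (h : ∀ i < P.base m, ω i = ω' i) : P.errSet ω D lab x y m = P.errSet ω' D lab x y m := by
  induction m with
  | zero => rfl
  | succ m ih =>
    have ih' := ih fun i hi => h i (hi.trans_le (P.base_mono (Nat.le_succ m)))
    have hm := P.misSet_congr (D := D) (lab := lab)
      (fun i hi => h i (Finset.mem_Ico.1 hi).2) (Sched.errSet_subset (ω := ω) (D := D)
        (lab := lab) (x := x) (y := y) m)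
    ext j
    by_cases hj : j ∈ P.cand D lab (2 ^ m)
    · rw [Sched.mem_errSet_succ_of_mem hx hy hj, Sched.mem_errSet_succ_of_mem hx hy hj, hm, ih']
    · rw [Sched.mem_errSet_succ_of_notMem hj, Sched.mem_errSet_succ_of_notMem hj, ih']

/-- The probability that many positions are misjudged in a stage, if the estimate was good. -/
theorem Sched.coinTape_stage_le (hx : ∀ j, x j ≤ 1) (hy : ∀ j, y j ≤ 1) (m f : ℕ) :
    coinTape {ω | (P.errSet ω D lab x y m).card * 2 ^ 12 ≤ 2 ^ (P.β - m) ∧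
      f ≤ (P.misSet ω D lab m (P.errSet ω D lab x y m)).card} ≤
      (P.cand D lab (2 ^ m)).card.choose f * 2⁻¹ ^ (2 * (f * P.reps m)) :=
  coinTape_conditional (n := P.n) (N := P.base m) (N' := P.base (m + 1))
    (fun ω => P.errSet ω D lab x y m)
    (fun _ _ h => Sched.errSet_congr hx hy h) (fun _ => Sched.errSet_subset m)
    (fun E => E.card * 2 ^ 12 ≤ 2 ^ (P.β - m)) (fun E => {ω | f ≤ (P.misSet ω D lab m E).card})
    (fun E hE ω ω' h hω => by
      rw [Set.mem_ofPred_eq] at hω ⊢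
      rwa [← P.misSet_congr h hE])
    fun E hE hg => coinTape_many_misjudged_le _ E (Finset.filter_subset _ _) hE hg

/-! ### Progress -/

/-- Before stage `m`, the estimate is unchanged in the sparse blocks and has few errors in the
other blocks. -/
structure Sched.Inv (P : Sched) (ω : ℕ → Bool) (D lab x y : ℕ → ℕ) (m : ℕ) : Prop where
  lab_pos : ∀ j ∈ P.errSet ω D lab x y m, 0 < lab j
  sparse : ∀ j ∈ P.errSet ω D lab x y m, 2 ^ m < 2 * D (lab j) → x j ≠ y j
  dense : ((P.errSet ω D lab x y m).filter fun j => ¬ 2 ^ m < 2 * D (lab j)).card * 2 ^ 13 ≤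
    2 ^ (P.β - m)

/-- There are few errors in sparse blocks, where `H` is the rounded entropy. -/
def Sched.FewSparse (P : Sched) (D lab x y : ℕ → ℕ) (H : ℕ) : Prop :=
  ∀ m, ((Finset.range P.n).filter fun j => x j ≠ y j ∧ 2 ^ m < 2 * D (lab j)).card * 2 ^ m ≤ 2 * H

/-- Sparse and dense blocks contribute at most `2 ^ (β - m) / 2 ^ 13` errors each. For the sparse
ones, combine `2 * H / 2 ^ m` with `2 ^ 14 * H < 2 ^ β`. -/
theorem Sched.Inv.card_le {m H : ℕ} (h : P.Inv ω D lab x y m) (hf : P.FewSparse D lab x y H)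
    (hβ : 2 ^ 14 * H < 2 ^ P.β) (hm : m ≤ P.β) :
    (P.errSet ω D lab x y m).card * 2 ^ 12 ≤ 2 ^ (P.β - m) := by
  have h1 := Finset.card_filter_add_card_filter_not (s := P.errSet ω D lab x y m)
    fun j => 2 ^ m < 2 * D (lab j)
  have h2 : ((P.errSet ω D lab x y m).filter fun j => 2 ^ m < 2 * D (lab j)).card ≤
      ((Finset.range P.n).filter fun j => x j ≠ y j ∧ 2 ^ m < 2 * D (lab j)).card := by
    refine Finset.card_le_card fun j hj => ?_
    rw [Finset.mem_filter] at hj ⊢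
    exact ⟨Sched.errSet_subset m hj.1, h.sparse j hj.1 hj.2, hj.2⟩
  have h3 : ((P.errSet ω D lab x y m).filter fun j => 2 ^ m < 2 * D (lab j)).card * 2 ^ 13 ≤
      2 ^ (P.β - m) := by
    have h4 := hf m
    have h5 : 2 ^ P.β = 2 ^ (P.β - m) * 2 ^ m := by rw [← pow_add]; congr 1; omega
    have h6 := (Nat.mul_le_mul_right (2 ^ m) h2).trans h4
    refine Nat.le_of_mul_le_mul_right ?_ (show 0 < 2 ^ m by positivity)
    rw [← h5]
    nlinarith
  have h7 := h.dense
  linarith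

/-- At `m = 0` every labelled block is sparse, since `D ≥ 1`. -/
theorem Sched.inv_zero (hy : ∀ j < P.n, x j ≠ y j → 0 < lab j) (hD : ∀ j, 0 < lab j →
    1 ≤ D (lab j)) : P.Inv ω D lab x y 0 := by
  have h0 : ∀ j ∈ P.errSet ω D lab x y 0, x j ≠ y j ∧ 0 < lab j := by
    intro j hj
    rw [errSet, Finset.mem_filter, Finset.mem_range] at hj
    exact ⟨hj.2, hy j hj.1 hj.2⟩
  refine ⟨fun j hj => (h0 j hj).2, fun j hj _ => (h0 j hj).1, ?_⟩
  rw [Finset.filter_false_of_mem fun j hj => ?_]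
  · simp
  · have := hD j (h0 j hj).2
    simp only [not_not, pow_zero]
    omega

theorem Sched.Inv.lab_pos_succ {m : ℕ}
    (h : P.Inv ω D lab x y m) : ∀ j ∈ P.errSet ω D lab x y (m + 1), 0 < lab j := by
  intro j hj
  by_cases hc : j ∈ P.cand D lab (2 ^ m)
  · exact (Finset.mem_filter.1 hc).2.1
  · exact h.lab_pos j ((Sched.mem_errSet_succ_of_notMem hc).1 hj)

theorem Sched.mem_misSet_of_mem_errSet_succ (hx : ∀ j, x j ≤ 1) (hy : ∀ j, y j ≤ 1) {m j : ℕ}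
    (hj : j ∈ P.errSet ω D lab x y (m + 1)) (hl : 0 < lab j) (hD : D (lab j) ≤ 2 ^ m) :
    j ∈ P.misSet ω D lab m (P.errSet ω D lab x y m) :=
  (Sched.mem_errSet_succ_of_mem hx hy
    (Finset.mem_filter.2 ⟨Sched.errSet_subset _ hj, hl, hD⟩)).1 hj

/-- The blocks that count as dense for `m + 1` are those with `D ≤ 2 ^ m`, the candidates of stage
`m`, so their remaining errors are exactly misjudged positions. The bound has `2 ^ 14` rather than
`2 ^ 13` because the number of buckets halves. -/
theorem Sched.Inv.succ (hx : ∀ j, x j ≤ 1) (hy : ∀ j, y j ≤ 1) {m : ℕ}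
    (h : P.Inv ω D lab x y m) (hm : m < P.β)
    (hok : (P.misSet ω D lab m (P.errSet ω D lab x y m)).card * 2 ^ 14 ≤ 2 ^ (P.β - m)) :
    P.Inv ω D lab x y (m + 1) := by
  refine ⟨h.lab_pos_succ, fun j hj hD => ?_, ?_⟩
  · have hc : j ∉ P.cand D lab (2 ^ m) := by
      intro hc
      have := (Finset.mem_filter.1 hc).2.2
      rw [pow_succ] at hD
      omega
    refine h.sparse j ((Sched.mem_errSet_succ_of_notMem hc).1 hj) (lt_trans ?_ hD)
    exact Nat.pow_lt_pow_right (by norm_num) (Nat.lt_succ_self m)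
  · have h1 : ((P.errSet ω D lab x y (m + 1)).filter fun j => ¬ 2 ^ (m + 1) < 2 * D (lab j)).card ≤
        (P.misSet ω D lab m (P.errSet ω D lab x y m)).card := by
      refine Finset.card_le_card fun j hj => ?_
      rw [Finset.mem_filter] at hj
      refine Sched.mem_misSet_of_mem_errSet_succ hx hy hj.1 (h.lab_pos_succ j hj.1) ?_
      have := hj.2
      rw [pow_succ] at this
      omega
    have h2 : 2 ^ (P.β - m) = 2 ^ (P.β - (m + 1)) * 2 := by
      rw [← pow_succ]; congr 1; omega
    linarith

theorem Sched.Inv.errSet_eq_empty (hx : ∀ j, x j ≤ 1) (hy : ∀ j, y j ≤ 1) {m : ℕ}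
    (h : P.Inv ω D lab x y m) (hD : ∀ j, 0 < lab j → D (lab j) ≤ 2 ^ m)
    (hok : (P.misSet ω D lab m (P.errSet ω D lab x y m)).card = 0) :
    P.errSet ω D lab x y (m + 1) = ∅ := by
  refine Finset.eq_empty_of_forall_notMem fun j hj => ?_
  have hl := h.lab_pos_succ j hj
  have := Sched.mem_misSet_of_mem_errSet_succ hx hy hj hl (hD j hl)
  rw [Finset.card_eq_zero.1 hok] at this
  exact Finset.notMem_empty _ this

/-- If the estimate is still wrong in the end, then too many positions have been misjudged in a
stage. -/
theorem Sched.exists_bad_stage (hx : ∀ j, x j ≤ 1) (hy : ∀ j, y j ≤ 1) {H : ℕ}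
    (hf : P.FewSparse D lab x y H) (hβ : 2 ^ 14 * H < 2 ^ P.β)
    (hlab : ∀ j < P.n, x j ≠ y j → 0 < lab j) (hD : ∀ j, 0 < lab j → 1 ≤ D (lab j))
    (hDβ : ∀ j, 0 < lab j → D (lab j) ≤ 2 ^ P.β) (hDlam : ∀ j, 0 < lab j → D (lab j) ≤ 2 ^ P.lam)
    (hne : P.errSet ω D lab x y P.stages ≠ ∅) :
    (∃ m < P.stages, (P.errSet ω D lab x y m).card * 2 ^ 12 ≤ 2 ^ (P.β - m) ∧
      2 ^ (P.β - m) / 2 ^ 14 + 1 ≤ (P.misSet ω D lab m (P.errSet ω D lab x y m)).card) ∨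
    ((P.errSet ω D lab x y P.lam).card * 2 ^ 12 ≤ 2 ^ (P.β - P.lam) ∧
      1 ≤ (P.misSet ω D lab P.lam (P.errSet ω D lab x y P.lam)).card) := by
  by_contra hcon
  rw [not_or] at hcon
  obtain ⟨h1, h2⟩ := hcon
  push Not at h1 h2
  have hok : ∀ m < P.stages, P.Inv ω D lab x y m →
      (P.misSet ω D lab m (P.errSet ω D lab x y m)).card * 2 ^ 14 ≤ 2 ^ (P.β - m) := by
    intro m hm hI
    have := h1 m hm (hI.card_le hf hβ (by unfold stages at hm; omega))
    exact (Nat.mul_le_mul_right _ (Nat.lt_succ_iff.1 this)).trans (Nat.div_mul_le_self _ _)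
  have hinv : ∀ m ≤ min P.lam P.β, P.Inv ω D lab x y m := by
    intro m
    induction m with
    | zero => exact fun _ => Sched.inv_zero hlab hD
    | succ m ih =>
      intro hm
      exact (ih (by omega)).succ hx hy (by omega) (hok m (by unfold stages; omega) (ih (by omega)))
  apply hne
  -- If `β ≤ λ`, the last stage has a single bucket and the ordinary bound already forces no
  -- misjudged position. Otherwise the last stage is `λ`, and the extra event excludes them.
  rcases le_total P.β P.lam with h | h
  · have hM : P.stages = P.β + 1 := by unfold stages; omega
    have hI := hinv P.β (by omega)
    rw [hM]
    refine hI.errSet_eq_empty hx hy hDβ ?_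
    have := hok P.β (by omega) hI
    rw [Nat.sub_self, pow_zero] at this
    omega
  · have hM : P.stages = P.lam + 1 := by unfold stages; omega
    have hI := hinv P.lam (by omega)
    rw [hM]
    refine hI.errSet_eq_empty hx hy hDlam ?_
    have := h2 (hI.card_le hf hβ h)
    omega

/-! ### The error probability -/

/-- The binomial is at most `N ^ f / f!`, and `f ^ f ≤ 4 ^ f * f!` because `(f+1)⋯(2f)` equals `f!`
times a central binomial coefficient, which is at most `4 ^ f`. -/
theorem choose_le_pow_of_le {N f Y : ℕ} (h : N ≤ f * Y) : N.choose f ≤ (4 * Y) ^ f := by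
  have h1 : N.choose f * f.factorial ≤ N ^ f := by
    rw [mul_comm, ← Nat.descFactorial_eq_factorial_mul_choose]
    exact Nat.descFactorial_le_pow _ _
  have h2 : f ^ f ≤ 4 ^ f * f.factorial := by
    calc f ^ f ≤ (f + 1) ^ f := Nat.pow_le_pow_left (Nat.le_succ f) f
      _ ≤ (f + 1).ascFactorial f := Nat.pow_succ_le_ascFactorial (f + 1) f
      _ = f.factorial * (f + f).choose f := Nat.ascFactorial_eq_factorial_mul_choose f f
      _ ≤ f.factorial * 2 ^ (f + f) := Nat.mul_le_mul_left _ (Nat.choose_le_two_pow _ _)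
      _ = 4 ^ f * f.factorial := by rw [← two_mul, pow_mul]; norm_num [mul_comm]
  refine Nat.le_of_mul_le_mul_right ?_ (Nat.factorial_pos f)
  calc N.choose f * f.factorial ≤ (f * Y) ^ f := h1.trans (Nat.pow_le_pow_left h f)
    _ = f ^ f * Y ^ f := mul_pow _ _ _
    _ ≤ 4 ^ f * f.factorial * Y ^ f := Nat.mul_le_mul_right _ h2
    _ = (4 * Y) ^ f * f.factorial := by rw [mul_pow]; ring

/-- The number of sets of `f` candidates is at most `2 ^ (f * (2 + m + 2 ^ m))`, and `2 + m + 2 ^ m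
≤ 3 * 2 ^ m ≤ R`. Half of the exponent `2 * f * R` pays for these sets; the other half is at least
`c * H`. -/
theorem choose_mul_half_pow_le {N f R H m c : ℕ} (hN : N ≤ H * 2 ^ 2 ^ m) (hH : H ≤ f * 2 ^ m)
    (hR : R = c * 2 ^ m) (hc : 3 ≤ c) :
    (N.choose f : ENNReal) * 2⁻¹ ^ (2 * (f * R)) ≤ 2⁻¹ ^ (c * H) := by
  have h1 : N.choose f ≤ 2 ^ (f * R) := by
    have h2 : N ≤ f * (2 ^ m * 2 ^ 2 ^ m) := by
      refine hN.trans ?_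
      rw [← mul_assoc]
      exact Nat.mul_le_mul_right _ hH
    refine (choose_le_pow_of_le h2).trans ?_
    rw [mul_comm f R, pow_mul]
    refine Nat.pow_le_pow_left ?_ f
    rw [show (4 : ℕ) = 2 ^ 2 by norm_num, ← pow_add, ← pow_add]
    refine Nat.pow_le_pow_right (by norm_num) ?_
    have h3 : m + 1 ≤ 2 ^ m := Nat.lt_two_pow_self
    have h4 : 3 * 2 ^ m ≤ R := hR ▸ Nat.mul_le_mul_right _ hc
    have h5 : 1 ≤ 2 ^ m := Nat.one_le_two_pow
    omega
  have h2 : c * H ≤ f * R := by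
    rw [hR]
    calc c * H ≤ c * (f * 2 ^ m) := Nat.mul_le_mul_left _ hH
      _ = _ := by ring
  have hhalf : (2⁻¹ : ENNReal) ≤ 1 := by simp
  calc (N.choose f : ENNReal) * 2⁻¹ ^ (2 * (f * R)) ≤ 2 ^ (f * R) * 2⁻¹ ^ (2 * (f * R)) := by
        gcongr; exact_mod_cast h1
    _ = 2⁻¹ ^ (f * R) := by
        rw [two_mul, pow_add, ← mul_assoc, ← mul_pow,
          ENNReal.mul_inv_cancel (by norm_num) (by norm_num), one_pow, one_mul]
    _ ≤ _ := pow_le_pow_right_of_le_one' hhalf h2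

theorem Sched.coinTape_errSet_le (hx : ∀ j, x j ≤ 1) (hy : ∀ j, y j ≤ 1) {H : ℕ}
    (hC : 3 ≤ P.C) (hlam : 1 ≤ P.lam) (hH : 1 ≤ H)
    (hf : P.FewSparse D lab x y H) (hβ : 2 ^ 14 * H < 2 ^ P.β)
    (hcand : ∀ m, (P.cand D lab (2 ^ m)).card ≤ H * 2 ^ 2 ^ m)
    (hlab : ∀ j < P.n, x j ≠ y j → 0 < lab j) (hD : ∀ j, 0 < lab j → 1 ≤ D (lab j))
    (hDβ : ∀ j, 0 < lab j → D (lab j) ≤ 2 ^ P.β)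
    (hDlam : ∀ j, 0 < lab j → D (lab j) ≤ 2 ^ P.lam) :
    coinTape {ω | P.errSet ω D lab x y P.stages ≠ ∅} ≤
      2⁻¹ ^ H + (P.cand D lab (2 ^ P.lam)).card * 2⁻¹ ^ (2 * P.reps P.lam) := by
  have hsub : {ω | P.errSet ω D lab x y P.stages ≠ ∅} ⊆
      (⋃ m ∈ Finset.range P.stages, {ω | (P.errSet ω D lab x y m).card * 2 ^ 12 ≤ 2 ^ (P.β - m) ∧
        2 ^ (P.β - m) / 2 ^ 14 + 1 ≤ (P.misSet ω D lab m (P.errSet ω D lab x y m)).card}) ∪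
      {ω | (P.errSet ω D lab x y P.lam).card * 2 ^ 12 ≤ 2 ^ (P.β - P.lam) ∧
        1 ≤ (P.misSet ω D lab P.lam (P.errSet ω D lab x y P.lam)).card} := by
    intro ω hω
    rcases Sched.exists_bad_stage hx hy hf hβ hlab hD hDβ hDlam hω with ⟨m, hm, h⟩ | h
    · refine Or.inl ?_
      simp only [Set.mem_iUnion]
      exact ⟨m, Finset.mem_range.2 hm, h⟩
    · exact Or.inr h
  refine (measure_mono hsub).trans ((measure_union_le _ _).trans (add_le_add ?_ ?_))
  · have hhalf : (2⁻¹ : ENNReal) ≤ 1 := by simp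
    calc _ ≤ ∑ m ∈ Finset.range P.stages, (2⁻¹ : ENNReal) ^ (P.C * P.lam * H) := by
          refine (measure_biUnion_finset_le _ _).trans (Finset.sum_le_sum fun m hm => ?_)
          have hm' : m ≤ P.β := by
            have := Finset.mem_range.1 hm; unfold stages at this; omega
          refine (Sched.coinTape_stage_le hx hy m _).trans
            (choose_mul_half_pow_le (hcand m) ?_ (by unfold reps; ring) (by nlinarith))
          have h5 : 2 ^ P.β = 2 ^ (P.β - m) * 2 ^ m := by rw [← pow_add]; congr 1; omega
          have h6 : 2 ^ (P.β - m) ≤ (2 ^ (P.β - m) / 2 ^ 14 + 1) * 2 ^ 14 := by omega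
          have h7 := Nat.mul_le_mul_right (2 ^ m) h6
          rw [← h5] at h7
          refine Nat.le_of_mul_le_mul_left (hβ.le.trans h7 |>.trans ?_) (show 0 < 2 ^ 14 by norm_num)
          exact le_of_eq (by ring)
      -- There are at most `λ + 1 ≤ 2 ^ λ` stages, and `3 * λ * H ≥ λ + H` absorbs their number.
      _ ≤ 2 ^ P.lam * 2⁻¹ ^ (P.lam + H) := by
          rw [Finset.sum_const, Finset.card_range, nsmul_eq_mul]
          refine mul_le_mul' ?_ (pow_le_pow_right_of_le_one' hhalf ?_)
          · have : P.stages ≤ 2 ^ P.lam :=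
              le_trans (by unfold stages; omega) (Nat.lt_two_pow_self (n := P.lam))
            exact_mod_cast this
          · have h1 : 3 * (P.lam * H) ≤ P.C * P.lam * H := by
              rw [mul_assoc]; exact Nat.mul_le_mul_right _ hC
            nlinarith
      _ = 2⁻¹ ^ H := by
          rw [pow_add, ← mul_assoc, ← mul_pow,
            ENNReal.mul_inv_cancel (by norm_num) (by norm_num), one_pow, one_mul]
  · refine (Sched.coinTape_stage_le hx hy P.lam 1).trans (le_of_eq ?_)
    rw [Nat.choose_one_right, one_mul]

end AsymDE

/-! ### The parameters of an actual input, and bounds for numbers and steps. -/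

namespace AsymDE

/-! ### The inputs as arrays -/

theorem toArr_val {m : ℕ} (v : Fin m → ℕ) (i : Fin m) : toArr v i = v i := by simp [toArr]

theorem toArr_le {m : ℕ} {v : Fin m → ℕ} {b : ℕ} (h : ∀ i, v i ≤ b) (j : ℕ) : toArr v j ≤ b := by
  unfold toArr
  split_ifs
  · exact h _
  · exact Nat.zero_le _

section Params

variable {n t : ℕ} {s k : Fin t → ℕ} {x y : Fin n → Bool} {S : Fin t → Finset (Fin n)}

theorem roundedH_toArr (s k : Fin t → ℕ) :
    roundedH (toArr s) (toArr k) t = ∑ i, k i * (s i / k i).size := by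
  rw [roundedH, Finset.sum_range]
  simp only [blockBits, toArr_val]

theorem one_le_size_div (hk : ∀ i, 1 ≤ k i) (hsk : ∀ i, 2 * k i ≤ s i) (i : Fin t) :
    1 ≤ (s i / k i).size := by
  rw [Nat.succ_le_iff, Nat.size_pos]
  exact Nat.div_pos (by have := hsk i; omega) (hk i)

theorem labels_of_mem (hc : Consistent s k x y S) {i : Fin t} {j : Fin n} (h : j ∈ S i) :
    labels S j = i + 1 := by
  rw [labels, Finset.sum_eq_single i, if_pos h]
  · intro i' _ hne
    exact if_neg fun h' => Finset.disjoint_left.1 (hc.disjoint i' i hne) h' h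
  · simp

theorem exists_mem_of_labels_pos {j : Fin n} (h : 0 < labels S j) : ∃ i, j ∈ S i := by
  by_contra hcon
  push Not at hcon
  rw [labels, Finset.sum_eq_zero fun i _ => if_neg (hcon i)] at h
  exact lt_irrefl _ h

theorem exists_block (hc : Consistent s k x y S) {j : ℕ} (h : 0 < toArr (labels S) j) :
    ∃ (hj : j < n) (i : Fin t), ⟨j, hj⟩ ∈ S i ∧ toArr (labels S) j = i + 1 := by
  have hj : j < n := by
    by_contra hj
    rw [toArr, dif_neg hj] at h
    exact lt_irrefl _ h
  rw [toArr, dif_pos hj] at h ⊢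
  obtain ⟨i, hi⟩ := exists_mem_of_labels_pos h
  exact ⟨hj, i, hi, labels_of_mem hc hi⟩

theorem labels_le (hc : Consistent s k x y S) (j : Fin n) : labels S j ≤ t := by
  rcases Nat.eq_zero_or_pos (labels S j) with h | h
  · omega
  · obtain ⟨i, hi⟩ := exists_mem_of_labels_pos h
    rw [labels_of_mem hc hi]
    exact i.2

theorem sum_s_le (hc : Consistent s k x y S) : ∑ i, s i ≤ n := by
  calc ∑ i, s i = ∑ i, (S i).card := Finset.sum_congr rfl fun i _ => (hc.card_eq i).symm
    _ = (Finset.univ.biUnion S).card :=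
        (Finset.card_biUnion fun i _ j _ h => hc.disjoint i j h).symm
    _ ≤ n := (Finset.card_le_univ _).trans (by simp)

theorem s_le (hc : Consistent s k x y S) (i : Fin t) : s i ≤ n :=
  (Finset.single_le_sum (f := s) (fun _ _ => Nat.zero_le _) (Finset.mem_univ i)).trans (sum_s_le hc)

theorem t_le (hk : ∀ i, 1 ≤ k i) (hsk : ∀ i, 2 * k i ≤ s i) (hc : Consistent s k x y S) :
    t ≤ n := by
  refine le_trans ?_ (sum_s_le hc)
  calc t = ∑ _i : Fin t, 1 := by simp
    _ ≤ ∑ i, s i := Finset.sum_le_sum fun i _ => by have := hk i; have := hsk i; omega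

theorem size_div_le (hc : Consistent s k x y S) (i : Fin t) : (s i / k i).size ≤ n.size :=
  Nat.size_le_size ((Nat.div_le_self _ _).trans (s_le hc i))

theorem roundedH_le (hsk : ∀ i, 2 * k i ≤ s i) (hc : Consistent s k x y S) :
    roundedH (toArr s) (toArr k) t ≤ n * n.size := by
  rw [roundedH_toArr]
  calc ∑ i, k i * (s i / k i).size ≤ ∑ i, s i * n.size :=
        Finset.sum_le_sum fun i _ => Nat.mul_le_mul (by have := hsk i; omega) (size_div_le hc i)
    _ = (∑ i, s i) * n.size := (Finset.sum_mul _ _ _).symm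
    _ ≤ _ := Nat.mul_le_mul_right _ (sum_s_le hc)

theorem mul_size_le_roundedH (s k : Fin t → ℕ) (i : Fin t) :
    k i * (s i / k i).size ≤ roundedH (toArr s) (toArr k) t := by
  rw [roundedH_toArr]
  exact Finset.single_le_sum (f := fun i => k i * (s i / k i).size) (fun _ _ => Nat.zero_le _)
    (Finset.mem_univ i)

theorem k_le_roundedH (hk : ∀ i, 1 ≤ k i) (hsk : ∀ i, 2 * k i ≤ s i) (i : Fin t) :
    k i ≤ roundedH (toArr s) (toArr k) t :=
  (Nat.le_mul_of_pos_right _ (one_le_size_div hk hsk i)).trans (mul_size_le_roundedH s k i)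

theorem lt_two_pow_logBuckets (s k : ℕ → ℕ) (t : ℕ) :
    2 ^ 14 * roundedH s k t < 2 ^ logBuckets s k t := Nat.lt_size_self _

theorem two_pow_size_le {m : ℕ} (h : 0 < m) : 2 ^ m.size ≤ 2 * m := by
  obtain ⟨d, hd⟩ := Nat.exists_eq_add_of_lt (Nat.size_pos.2 h)
  rw [Nat.zero_add] at hd
  have := Nat.lt_size.1 (show d < m.size by omega)
  rw [hd, pow_succ]
  omega

theorem two_pow_logBuckets_le {s k : ℕ → ℕ} {t : ℕ} (h : 1 ≤ roundedH s k t) :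
    2 ^ logBuckets s k t ≤ 2 ^ 15 * roundedH s k t := by
  refine (two_pow_size_le (by omega)).trans (le_of_eq ?_)
  ring

/-- The density parameter of the block with label `l`. -/
def density (s k : Fin t → ℕ) (l : ℕ) : ℕ := blockBits (toArr s) (toArr k) (l - 1)

theorem density_succ (s k : Fin t → ℕ) (i : Fin t) : density s k (i + 1) = (s i / k i).size := by
  simp [density, blockBits, toArr_val]

theorem card_le_sum_of_blocks (A : Finset ℕ) (I : Finset (Fin t)) (G : Fin t → Finset (Fin n))
    (h : ∀ j ∈ A, ∃ (hj : j < n), ∃ i ∈ I, (⟨j, hj⟩ : Fin n) ∈ G i) :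
    A.card ≤ ∑ i ∈ I, (G i).card := by
  classical
  have : A ⊆ (I.biUnion G).image Fin.val := by
    intro j hj
    obtain ⟨hj', i, hi, hG⟩ := h j hj
    exact Finset.mem_image.2 ⟨_, Finset.mem_biUnion.2 ⟨i, hi, hG⟩, rfl⟩
  exact (Finset.card_le_card this).trans (Finset.card_image_le.trans Finset.card_biUnion_le)

theorem bits_le (x : Fin n → Bool) (j : ℕ) : toArr (fun j => (x j).toNat) j ≤ 1 :=
  toArr_le (fun _ => Bool.toNat_le _) j

theorem bits_ne_iff {j : ℕ} (hj : j < n) : toArr (fun j => (x j).toNat) j ≠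
    toArr (fun j => (y j).toNat) j ↔ x ⟨j, hj⟩ ≠ y ⟨j, hj⟩ := by
  rw [toArr, toArr, dif_pos hj, dif_pos hj]
  cases x ⟨j, hj⟩ <;> cases y ⟨j, hj⟩ <;> simp

/-- Only blocks with `2 ^ m < 2 * D i` count, and each of their at most `k i` errors is charged `2 ^
m ≤ 2 * D i`; the sum of `k i * D i` is the rounded entropy. -/
theorem fewSparse (hc : Consistent s k x y S) {P : Sched} (hP : P.n = n) :
    P.FewSparse (density s k) (toArr (labels S)) (toArr fun j => (x j).toNat)
      (toArr fun j => (y j).toNat) (roundedH (toArr s) (toArr k) t) := by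
  intro m
  have h1 : ((Finset.range P.n).filter fun j => toArr (fun j => (x j).toNat) j ≠
      toArr (fun j => (y j).toNat) j ∧ 2 ^ m < 2 * density s k (toArr (labels S) j)).card ≤
      ∑ i ∈ Finset.univ.filter (fun i => 2 ^ m < 2 * (s i / k i).size), k i := by
    refine (card_le_sum_of_blocks _ _ (fun i => (S i).filter fun j => x j ≠ y j) ?_).trans
      (Finset.sum_le_sum fun i _ => hc.dist_le i)
    intro j hj
    rw [Finset.mem_filter, Finset.mem_range, hP] at hj
    obtain ⟨hj, hne, hD⟩ := hj
    rw [bits_ne_iff hj] at hne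
    have hex : ∃ i, (⟨j, hj⟩ : Fin n) ∈ S i := by
      by_contra hcon
      push Not at hcon
      exact hne (hc.eq_outside _ hcon)
    obtain ⟨i, hi⟩ := hex
    rw [toArr, dif_pos hj, labels_of_mem hc hi, density_succ] at hD
    exact ⟨hj, i, Finset.mem_filter.2 ⟨Finset.mem_univ _, hD⟩, Finset.mem_filter.2 ⟨hi, hne⟩⟩
  refine (Nat.mul_le_mul_right _ h1).trans ?_
  rw [roundedH_toArr, Finset.sum_mul, Finset.mul_sum]
  refine le_trans (Finset.sum_le_sum fun i hi => ?_)
    (Finset.sum_le_sum_of_subset (Finset.filter_subset _ _))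
  have := (Finset.mem_filter.1 hi).2
  nlinarith [Nat.zero_le (k i)]

theorem card_cand_le_sum (hc : Consistent s k x y S) {P : Sched} (g : ℕ) :
    (P.cand (density s k) (toArr (labels S)) g).card ≤
      ∑ i ∈ Finset.univ.filter (fun i => (s i / k i).size ≤ g), s i := by
  refine (card_le_sum_of_blocks _ _ S ?_).trans (Finset.sum_le_sum fun i _ => (hc.card_eq i).le)
  intro j hj
  obtain ⟨-, hpos, hD⟩ := Finset.mem_filter.1 hj
  obtain ⟨hj, i, hi, hl⟩ := exists_block hc hpos
  rw [hl, density_succ] at hD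
  exact ⟨hj, i, Finset.mem_filter.2 ⟨Finset.mem_univ _, hD⟩, hi⟩

/-- A block with `D i ≤ 2 ^ m` has size `s i < k i * 2 ^ D i`, and `k i ≤ k i * D i`. -/
theorem card_cand_le (hk : ∀ i, 1 ≤ k i) (hsk : ∀ i, 2 * k i ≤ s i) (hc : Consistent s k x y S)
    {P : Sched} (m : ℕ) : (P.cand (density s k) (toArr (labels S)) (2 ^ m)).card ≤
      roundedH (toArr s) (toArr k) t * 2 ^ 2 ^ m := by
  refine (card_cand_le_sum hc _).trans ?_
  rw [roundedH_toArr, Finset.sum_mul]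
  refine le_trans (Finset.sum_le_sum fun i hi => ?_)
    (Finset.sum_le_sum_of_subset (Finset.filter_subset _ _))
  have h1 := (Finset.mem_filter.1 hi).2
  have h2 : s i ≤ k i * 2 ^ (s i / k i).size := by
    have := (Nat.div_lt_iff_lt_mul (hk i)).1 (Nat.lt_size_self (s i / k i))
    rw [mul_comm]
    exact this.le
  refine h2.trans (Nat.mul_le_mul ?_ (Nat.pow_le_pow_right (by norm_num) h1))
  exact Nat.le_mul_of_pos_right _ (one_le_size_div hk hsk i)

/-! ### Bounds for the parameters -/

/-- A bound for all numbers in the computation. -/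
def valueBound (C n : ℕ) : ℕ := 2 ^ 16 * C * n ^ 5

/-- A bound for the number of steps in a stage. -/
def stageBound (C n : ℕ) : ℕ := 2 ^ 18 * (C * n * n.size ^ 3)

theorem two_le_size {n : ℕ} (hn : 3 ≤ n) : 2 ≤ n.size :=
  Nat.lt_size.2 (by norm_num; omega)

theorem size_le_self (n : ℕ) : n.size ≤ n := Nat.size_le.2 Nat.lt_two_pow_self

theorem one_le_loglog {n : ℕ} (hn : 3 ≤ n) : 1 ≤ loglog n :=
  Nat.size_pos.2 (by have := two_le_size hn; omega)

theorem two_pow_loglog_le {n : ℕ} (hn : 3 ≤ n) : 2 ^ loglog n ≤ 2 * n.size :=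
  two_pow_size_le (by have := two_le_size hn; omega)

theorem reps_mkSched_le {C m : ℕ} {s k : ℕ → ℕ} (hn : 3 ≤ n)
    (hm : m < (mkSched C n t s k).stages) :
    2 ^ m ≤ 2 * n.size ∧ (mkSched C n t s k).reps m ≤ C * (2 * n.size) * n.size := by
  have h1 : m ≤ loglog n := by
    have : m < min (loglog n) (logBuckets s k t) + 1 := hm
    omega
  have h2 : 2 ^ m ≤ 2 * n.size :=
    (Nat.pow_le_pow_right (by norm_num) h1).trans (two_pow_loglog_le hn)
  exact ⟨h2, Nat.mul_le_mul (Nat.mul_le_mul_left _ h2) (size_le_self _)⟩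

/-- The factor `2 ^ m` in the repetitions cancels the loss of buckets, so all stages send equally
many bits. -/
theorem reps_mul_pow {C m : ℕ} {s k : ℕ → ℕ} (hm : m < (mkSched C n t s k).stages) :
    (mkSched C n t s k).reps m * 2 ^ ((mkSched C n t s k).β - m) =
      C * loglog n * 2 ^ logBuckets s k t := by
  have h1 : m ≤ logBuckets s k t := by
    have : m < min (loglog n) (logBuckets s k t) + 1 := hm
    omega
  have h2 : 2 ^ logBuckets s k t = 2 ^ m * 2 ^ (logBuckets s k t - m) := by
    rw [← pow_add]; congr 1; omega
  rw [h2]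
  simp only [mkSched, Sched.reps]
  ring

theorem logBuckets_le {s k : ℕ → ℕ} (hn : 3 ≤ n) (hH : 1 ≤ roundedH s k t)
    (hH' : roundedH s k t ≤ n * n.size) : logBuckets s k t ≤ 10 * n.size := by
  have h1 : logBuckets s k t ≤ 15 + (n.size + n.size) := by
    refine Nat.size_le.2 ?_
    calc 16384 * roundedH s k t < 2 ^ 15 * (2 ^ n.size * 2 ^ n.size) := by
          have h2 : n * n.size ≤ 2 ^ n.size * 2 ^ n.size :=
            Nat.mul_le_mul (Nat.lt_size_self n).le Nat.lt_two_pow_self.le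
          norm_num
          omega
      _ = _ := by rw [← pow_add, ← pow_add]
  have := two_le_size hn
  omega

theorem stages_le {C : ℕ} {s k : ℕ → ℕ} (hn : 3 ≤ n) :
    (mkSched C n t s k).stages ≤ loglog n + 1 ∧ (mkSched C n t s k).stages ≤ 2 * n.size := by
  have h1 : (mkSched C n t s k).stages = min (loglog n) (logBuckets s k t) + 1 := rfl
  have h2 : loglog n ≤ n.size := size_le_self _
  have := two_le_size hn
  omega

/-- A repetition costs `O(n * log n)` steps for hashing plus its buckets. As `2 ^ m = O(log n)`,
there are `O(log² n)` repetitions, while the total number of buckets in a stage is `C * λ * 2 ^ β =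
O(n * log² n)`. -/
theorem stageBound_mkSched {C : ℕ} {s k : ℕ → ℕ} (hn : 3 ≤ n) (hC : 1 ≤ C)
    (hH : 1 ≤ roundedH s k t) (hH' : roundedH s k t ≤ n * n.size) :
    (mkSched C n t s k).StageBound (stageBound C n) := by
  intro m hm
  have hl := two_le_size hn
  obtain ⟨-, hR⟩ := reps_mkSched_le hn hm
  have hRp := reps_mul_pow hm
  have hβ := logBuckets_le hn hH hH'
  have hp := two_pow_logBuckets_le hH
  have hll : loglog n ≤ n.size := size_le_self _
  set R := (mkSched C n t s k).reps m
  set l := n.size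
  have hβ' : (mkSched C n t s k).β - m ≤ 10 * l := (Nat.sub_le _ _).trans hβ
  have e1 : R * (n * (4 * ((mkSched C n t s k).β - m) + 10) + 10) ≤
      (C * (2 * l) * l) * (n * (50 * l)) := by
    refine Nat.mul_le_mul hR ?_
    have : n * (4 * ((mkSched C n t s k).β - m) + 10) ≤ n * (45 * l) :=
      Nat.mul_le_mul_left _ (by omega)
    nlinarith
  have e2 : R * (7 * 2 ^ ((mkSched C n t s k).β - m)) ≤ 7 * (C * l * (2 ^ 15 * (n * l))) := by
    rw [mul_left_comm, hRp]
    gcongr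
    exact hp.trans (Nat.mul_le_mul_left _ hH')
  have e3 : C * n * l ^ 2 ≤ C * n * l ^ 3 :=
    Nat.mul_le_mul_left _ (Nat.pow_le_pow_right (by omega) (by norm_num))
  have e4 : n ≤ C * n * l ^ 3 := by
    have : 1 ≤ l ^ 3 := Nat.one_le_pow _ _ (by omega)
    calc n = 1 * n * 1 := by ring
      _ ≤ _ := by gcongr
  have hn' : (mkSched C n t s k).n = n := rfl
  rw [hn', stageBound]
  calc _ = R * (n * (4 * ((mkSched C n t s k).β - m) + 10) + 10) +
        R * (7 * 2 ^ ((mkSched C n t s k).β - m)) + 5 * n + 9 := by ring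
    _ ≤ (C * (2 * l) * l) * (n * (50 * l)) + 7 * (C * l * (2 ^ 15 * (n * l))) + 14 * n := by omega
    _ = 100 * (C * n * l ^ 3) + 229376 * (C * n * l ^ 2) + 14 * n := by ring
    _ ≤ 2 ^ 18 * (C * n * l ^ 3) := by omega

theorem base_le {C m : ℕ} {s k : ℕ → ℕ} (hn : 3 ≤ n) (hH : 1 ≤ roundedH s k t)
    (hH' : roundedH s k t ≤ n * n.size) (hm : m ≤ (mkSched C n t s k).stages) :
    (mkSched C n t s k).base m ≤ m * (C * (2 * n.size) * n.size * (n * (10 * n.size))) := by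
  induction m with
  | zero => simp [Sched.base]
  | succ m ih =>
    have h1 := ih (by omega)
    have h2 := (reps_mkSched_le hn (show m < (mkSched C n t s k).stages by omega)).2
    have h3 : (mkSched C n t s k).β - m ≤ 10 * n.size :=
      (Nat.sub_le _ _).trans (logBuckets_le hn hH hH')
    rw [Sched.base, add_mul, one_mul]
    refine Nat.add_le_add h1 (Nat.mul_le_mul h2 (Nat.mul_le_mul le_rfl h3))

theorem sum_msg {C : ℕ} {s k : ℕ → ℕ} :
    ∑ m ∈ Finset.range (mkSched C n t s k).stages, (mkSched C n t s k).reps m *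
      2 ^ ((mkSched C n t s k).β - m) =
      (mkSched C n t s k).stages * (C * loglog n * 2 ^ logBuckets s k t) := by
  rw [Finset.sum_congr rfl fun m hm => reps_mul_pow (Finset.mem_range.1 hm), Finset.sum_const,
    Finset.card_range, smul_eq_mul]

theorem fits_mkSched {C : ℕ} {s k : ℕ → ℕ} (hn : 3 ≤ n) (hC : 1 ≤ C)
    (hH : 1 ≤ roundedH s k t) (hH' : roundedH s k t ≤ n * n.size) :
    (mkSched C n t s k).Fits (valueBound C n) := by
  have hl := two_le_size hn
  have hln := size_le_self n
  have hp := (two_pow_logBuckets_le hH).trans (Nat.mul_le_mul_left _ hH')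
  have hll : loglog n ≤ n.size := size_le_self _
  have hst := (stages_le (t := t) (C := C) (s := s) (k := k) hn).2
  have h5 : ∀ i ≤ 5, C * n ^ i ≤ C * n ^ 5 := fun i hi =>
    Nat.mul_le_mul_left _ (Nat.pow_le_pow_right (by omega) hi)
  have hb : C * (2 * n.size) * n.size ≤ 2 * (C * n ^ 2) := by
    calc C * (2 * n.size) * n.size ≤ C * (2 * n) * n := by gcongr
      _ = _ := by ring
  have hval : valueBound C n = 2 ^ 16 * (C * n ^ 5) := by unfold valueBound; ring
  have hCn : C * 1 ≤ C * n := Nat.mul_le_mul_left _ (by omega)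
  have h1 := h5 1 (by norm_num)
  have h2 := h5 2 (by norm_num)
  rw [pow_one] at h1
  have hnC : 1 * n ≤ C * n := Nat.mul_le_mul_right _ hC
  have hn2 : 1 * n ^ 2 ≤ C * n ^ 2 := Nat.mul_le_mul_right _ hC
  have hpow : 2 ^ logBuckets s k t ≤ 2 ^ 15 * n ^ 2 := by
    refine hp.trans (Nat.mul_le_mul_left _ ?_)
    rw [sq]
    exact Nat.mul_le_mul_left _ hln
  refine ⟨?_, ?_, ?_, ?_, ?_, ?_⟩
  · refine (base_le hn hH hH' le_rfl).trans ?_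
    rw [hval]
    calc _ ≤ (2 * n) * (2 * (C * n ^ 2) * (n * (10 * n))) := by
          gcongr
          omega
      _ = 40 * (C * n ^ 5) := by ring
      _ ≤ _ := Nat.mul_le_mul_right _ (by norm_num)
  · rw [hval]
    refine hpow.trans ?_
    norm_num at hn2 ⊢
    omega
  · intro m hm
    have := (reps_mkSched_le hn hm).2
    rw [hval]
    omega
  · intro m hm
    have h3 := (reps_mkSched_le hn hm).1
    have h4 : C * 2 ^ m ≤ C * (2 * n) := Nat.mul_le_mul_left _ (by omega)
    have h6 : C * (2 * n) = 2 * (C * n) := by ring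
    rw [hval]
    exact h4.trans (by omega)
  · intro m hm
    have h3 := (reps_mkSched_le hn hm).1
    rw [hval, pow_succ]
    omega
  · rw [sum_msg, hval]
    calc _ ≤ (2 * n) * (C * n * (2 ^ 15 * n ^ 2)) := by
          gcongr
          · omega
          · omega
      _ = 2 ^ 16 * (C * n ^ 4) := by ring
      _ ≤ _ := Nat.mul_le_mul_left _ (h5 4 (by norm_num))

theorem n_le_valueBound {C : ℕ} (hn : 3 ≤ n) (hC : 1 ≤ C) :
    2 * n ≤ valueBound C n ∧ C ≤ valueBound C n := by
  have h1 : n ^ 1 ≤ n ^ 5 := Nat.pow_le_pow_right (by omega) (by norm_num)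
  rw [pow_one] at h1
  have h2 : 1 * n ^ 5 ≤ C * n ^ 5 := Nat.mul_le_mul_right _ hC
  have h3 : C * 1 ≤ C * n ^ 5 := Nat.mul_le_mul_left _ (by omega)
  rw [valueBound, mul_assoc]
  omega

/-- A bound for the number of steps of each party. -/
theorem steps_le {C : ℕ} {s k : ℕ → ℕ} (hn : 3 ≤ n) (hC : 1 ≤ C) (ht : t ≤ n)
    (hH : 1 ≤ roundedH s k t) (hH' : roundedH s k t ≤ n * n.size) :
    t * (4 * n.size + 8) + (4 * n.size + 4 * loglog n + 4 * logBuckets s k t + 25) +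
      (((mkSched C n t s k).stages * (stageBound C n + 1) + 1) + (3 * n + 2)) ≤
      2 ^ 21 * (C * n * n.size ^ 4) := by
  have hl := two_le_size hn
  have hβ := logBuckets_le hn hH hH'
  have hll : loglog n ≤ n.size := size_le_self _
  have hst := (stages_le (t := t) (C := C) (s := s) (k := k) hn).2
  set l := n.size
  have e1 : t * (4 * l + 8) ≤ n * (8 * l) := Nat.mul_le_mul ht (by omega)
  have e0 : 1 ≤ C * n * l ^ 3 := Nat.mul_pos (Nat.mul_pos hC (by omega)) (pow_pos (by omega) 3)
  have e2 : (mkSched C n t s k).stages * (stageBound C n + 1) ≤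
      (2 * l) * (2 ^ 19 * (C * n * l ^ 3)) := by
    refine Nat.mul_le_mul hst ?_
    have : stageBound C n = 2 ^ 18 * (C * n * l ^ 3) := rfl
    omega
  have e3 : n * l ≤ C * n * l ^ 4 := by
    have : l ^ 1 ≤ l ^ 4 := Nat.pow_le_pow_right (by omega) (by norm_num)
    rw [pow_one] at this
    calc n * l = 1 * n * l := by ring
      _ ≤ _ := by gcongr
  have e4 : 3 * l ≤ n * l := Nat.mul_le_mul_right _ hn
  have e5 : n * 2 ≤ n * l := Nat.mul_le_mul_left _ hl
  have e6 : (2 * l) * (2 ^ 19 * (C * n * l ^ 3)) = 2 ^ 20 * (C * n * l ^ 4) := by ring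
  have e7 : n * (8 * l) = 8 * (n * l) := by ring
  omega

theorem stepCost_le {C : ℕ} (hn : 3 ≤ n) :
    stepCost (valueBound C n) ≤ 256 * ((C + 22) * n.size) := by
  have hl := two_le_size hn
  have h1 : (valueBound C n).size ≤ 16 + C + n.size * 5 := by
    refine Nat.size_le.2 ?_
    rw [valueBound, pow_add, pow_add, pow_mul]
    have h2 : C < 2 ^ C := Nat.lt_two_pow_self
    have h3 : n ^ 5 < (2 ^ n.size) ^ 5 := Nat.pow_lt_pow_left (Nat.lt_size_self n) (by norm_num)
    exact Nat.mul_lt_mul'' (Nat.mul_lt_mul_of_pos_left h2 (by norm_num)) h3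
  unfold stepCost
  refine Nat.mul_le_mul_left _ ?_
  have h4 : C ≤ C * n.size := Nat.le_mul_of_pos_right _ (by omega)
  rw [add_mul]
  omega

end Params

end AsymDE

/-! ### Comparison with entropy and real logarithms, and the guarantees of the protocol. -/

namespace AsymDE

/-! ### Comparison with the real parameters -/

/-- Induction on `k`: passing from `(s, k)` to `(s + 1, k + 1)` multiplies the binomial by `(s + 1)
/ (k + 1)`, which is at least `q`. -/
theorem pow_le_choose {q k : ℕ} : ∀ {s : ℕ}, q * k ≤ s → q ^ k ≤ s.choose k := by
  rcases Nat.eq_zero_or_pos q with rfl | hq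
  · intro s _
    rcases Nat.eq_zero_or_pos k with rfl | hk
    · simp
    · simp [zero_pow hk.ne']
  induction k with
  | zero => simp
  | succ k ih =>
    intro s hs
    obtain ⟨s, rfl⟩ : ∃ s', s = s' + 1 := ⟨s - 1, by rw [mul_add] at hs; omega⟩
    have h1 : q ^ k ≤ s.choose k := ih (by rw [mul_add] at hs; omega)
    refine Nat.le_of_mul_le_mul_right ?_ (Nat.succ_pos k)
    calc q ^ (k + 1) * (k + 1) = (q * (k + 1)) * q ^ k := by ring
      _ ≤ (s + 1) * s.choose k := Nat.mul_le_mul hs h1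
      _ = (s + 1).choose (k + 1) * (k + 1) := Nat.add_one_mul_choose_eq s k

theorem size_le_logb {m : ℕ} (hm : 0 < m) : (m.size : ℝ) ≤ 1 + Real.logb 2 m := by
  have h1 : (2 : ℝ) ^ (m.size : ℝ) ≤ 2 * m := by
    rw [Real.rpow_natCast]
    exact_mod_cast two_pow_size_le hm
  have hm' : (0 : ℝ) < m := by exact_mod_cast hm
  have h2 := (Real.le_logb_iff_rpow_le (by norm_num) (by positivity)).2 h1
  rwa [Real.logb_mul (by norm_num) hm'.ne', Real.logb_self_eq_one (by norm_num)] at h2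

/-- With `q = s i / k i`, the binomial sum is at least `q ^ k i`. The bit length of `q` is at most
`1 + logb 2 q`, and `q ≥ 2` turns this into `2 * logb 2 q`. This is where `2 * k i ≤ s i` is
essential. -/
theorem roundedH_le_entropyH {t : ℕ} {s k : Fin t → ℕ} (hk : ∀ i, 1 ≤ k i)
    (hsk : ∀ i, 2 * k i ≤ s i) :
    (roundedH (toArr s) (toArr k) t : ℝ) ≤ 2 * entropyH s k := by
  rw [roundedH_toArr, entropyH, Nat.cast_sum, Finset.mul_sum]
  refine Finset.sum_le_sum fun i _ => ?_
  have hq : 2 ≤ s i / k i := (Nat.le_div_iff_mul_le (hk i)).2 (hsk i)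
  have h1 : (((s i / k i) ^ k i : ℕ) : ℝ) ≤
      ∑ j ∈ Finset.range (k i + 1), ((s i).choose j : ℝ) := by
    refine le_trans (Nat.cast_le.2 (pow_le_choose (Nat.div_mul_le_self (s i) (k i)))) ?_
    exact Finset.single_le_sum (f := fun j => ((s i).choose j : ℝ))
      (fun _ _ => Nat.cast_nonneg _) (Finset.self_mem_range_succ (k i))
  have hq' : (2 : ℝ) ≤ ((s i / k i : ℕ) : ℝ) := by exact_mod_cast hq
  have h2 : (k i : ℝ) * Real.logb 2 ((s i / k i : ℕ) : ℝ) ≤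
      Real.logb 2 (∑ j ∈ Finset.range (k i + 1), ((s i).choose j : ℝ)) := by
    rw [← Real.logb_pow]
    rw [Nat.cast_pow] at h1
    exact Real.logb_le_logb_of_le (by norm_num) (by positivity) h1
  have h3 : ((s i / k i).size : ℝ) ≤ 2 * Real.logb 2 ((s i / k i : ℕ) : ℝ) := by
    have h4 := size_le_logb (show 0 < s i / k i by omega)
    have h5 : (1 : ℝ) ≤ Real.logb 2 ((s i / k i : ℕ) : ℝ) := by
      rw [Real.le_logb_iff_rpow_le (by norm_num) (by linarith), Real.rpow_one]
      exact hq'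
    linarith
  push_cast
  calc (k i : ℝ) * ((s i / k i).size : ℝ) ≤ k i * (2 * Real.logb 2 ((s i / k i : ℕ) : ℝ)) := by
        gcongr
    _ = 2 * (k i * Real.logb 2 ((s i / k i : ℕ) : ℝ)) := by ring
    _ ≤ _ := by linarith

/-- From `3 ^ 2 ≥ 2 ^ 3` and `(3 / 2) ^ 2 ≥ 2`. Both logarithms are bounded away from zero, so
additive constants can be absorbed into factors. -/
theorem logb_bounds {n : ℕ} (hn : 3 ≤ n) : 3 / 2 ≤ Real.logb 2 n ∧
    1 / 2 ≤ Real.logb 2 (Real.logb 2 n) := by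
  have hn' : (3 : ℝ) ≤ n := by exact_mod_cast hn
  have h1 : 3 / 2 ≤ Real.logb 2 n := by
    have h : Real.logb 2 (2 ^ 3) ≤ Real.logb 2 ((n : ℝ) ^ 2) :=
      Real.logb_le_logb_of_le (by norm_num) (by norm_num) (by nlinarith)
    rw [Real.logb_pow, Real.logb_pow, Real.logb_self_eq_one (by norm_num)] at h
    push_cast at h
    linarith
  refine ⟨h1, ?_⟩
  have h : Real.logb 2 (2 ^ 1) ≤ Real.logb 2 (Real.logb 2 n ^ 2) :=
    Real.logb_le_logb_of_le (by norm_num) (by norm_num) (by nlinarith)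
  rw [Real.logb_pow, Real.logb_pow, Real.logb_self_eq_one (by norm_num)] at h
  push_cast at h
  linarith

theorem size_le_two_mul_logb {n : ℕ} (hn : 3 ≤ n) : (n.size : ℝ) ≤ 2 * Real.logb 2 n := by
  have := size_le_logb (show 0 < n by omega)
  have := (logb_bounds hn).1
  linarith

theorem loglog_le_logb {n : ℕ} (hn : 3 ≤ n) :
    (loglog n : ℝ) ≤ 5 * Real.logb 2 (Real.logb 2 n) := by
  have hl := two_le_size hn
  have h1 := size_le_logb (show 0 < n.size by omega)
  obtain ⟨h2, h3⟩ := logb_bounds hn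
  have h4 : Real.logb 2 (n.size : ℝ) ≤ Real.logb 2 (2 * Real.logb 2 n) := by
    refine Real.logb_le_logb_of_le (by norm_num) ?_ (size_le_two_mul_logb hn)
    have : (0 : ℝ) < n.size := by exact_mod_cast (show 0 < n.size by omega)
    exact this
  rw [Real.logb_mul (by norm_num) (by positivity), Real.logb_self_eq_one (by norm_num)] at h4
  unfold loglog
  linarith

/-! ### The protocol -/

/-- The protocol in which a stage has `C * 2 ^ m * loglog n` repetitions. -/
def protocol (C : ℕ) : OneRoundProtocol := ⟨progAlice C, progBob C⟩

section

variable {n t : ℕ} {s k : Fin t → ℕ} {x y : Fin n → Bool} {S : Fin t → Finset (Fin n)}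

/-- Alice's message. -/
def message (C : ℕ) (s k : Fin t → ℕ) (x : Fin n → Bool) (ω : ℕ → Bool) : List Bool :=
  (mkSched C n t (toArr s) (toArr k)).msg ω (toArr fun j => (x j).toNat)
    (mkSched C n t (toArr s) (toArr k)).stages

/-- Bob's output. -/
def result (C : ℕ) (s k : Fin t → ℕ) (x y : Fin n → Bool) (S : Fin t → Finset (Fin n))
    (ω : ℕ → Bool) : List Bool :=
  (List.range n).map fun j => decide ((mkSched C n t (toArr s) (toArr k)).est ω (density s k)
    (toArr (labels S)) (toArr fun j => (x j).toNat) (toArr fun j => (y j).toNat)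
    (mkSched C n t (toArr s) (toArr k)).stages j ≠ 0)

theorem one_le_roundedH (hk : ∀ i, 1 ≤ k i) (hsk : ∀ i, 2 * k i ≤ s i) (ht : 0 < t) :
    1 ≤ roundedH (toArr s) (toArr k) t :=
  (hk ⟨0, ht⟩).trans (k_le_roundedH hk hsk _)

theorem length_message {C : ℕ} (x : Fin n → Bool) (ω : ℕ → Bool) :
    (message C s k x ω).length = (mkSched C n t (toArr s) (toArr k)).stages *
      (C * loglog n * 2 ^ logBuckets (toArr s) (toArr k) t) := by
  rw [message, Sched.length_msg, sum_msg]

theorem exists_runs {C : ℕ} (hC : 1 ≤ C) (hn : 3 ≤ n) (ht : 0 < t) (hk : ∀ i, 1 ≤ k i)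
    (hsk : ∀ i, 2 * k i ≤ s i) (hc : Consistent s k x y S) (ω : ℕ → Bool) :
    ∃ T, (protocol C).Runs s k x y S ω (message C s k x ω) (result C s k x y S ω) T ∧
      T ≤ 2 ^ 30 * (C * (C + 22)) * n * n.size ^ 5 := by
  have hH := one_le_roundedH hk hsk ht
  have hH' := roundedH_le hsk hc
  have htn := t_le hk hsk hc
  obtain ⟨hnV, hCV⟩ := n_le_valueBound hn hC
  have hF := fits_mkSched (t := t) (s := toArr s) (k := toArr k) hn hC hH hH'
  have hN := stageBound_mkSched (t := t) (s := toArr s) (k := toArr k) hn hC hH hH'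
  have hst := steps_le (s := toArr s) (k := toArr k) hn hC htn hH hH'
  have hcost := stepCost_le (n := n) (C := C) hn
  have h2n : 2 ^ n.size ≤ valueBound C n := (two_pow_size_le (by omega)).trans hnV
  have hs : ∀ j, toArr s j ≤ valueBound C n := toArr_le fun i => by have := s_le hc i; omega
  have hk' : ∀ j, toArr k j ≤ valueBound C n := toArr_le fun i => by
    have := s_le hc i; have := hsk i; omega
  have hbits : ∀ (z : Fin n → Bool) j, toArr (fun j => (z j).toNat) j ≤ valueBound C n :=
    fun z j => (bits_le z j).trans (by omega)
  have hblk : ∀ i < t, blockBits (toArr s) (toArr k) i ≤ n.size := by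
    intro i hi
    have := size_div_le hc ⟨i, hi⟩
    rwa [← toArr_val s, ← toArr_val k] at this
  have hmsg : (message C s k x ω).length ≤ valueBound C n := by
    rw [length_message, ← sum_msg]
    exact hF.msg
  have hBA : Bdd (valueBound C n) (aliceInput s k x) := by
    constructor
    · intro r
      match r with
      | 0 => exact (show n ≤ _ by omega)
      | 1 => exact (show t ≤ _ by omega)
      | _ + 2 => exact Nat.zero_le _
    · intro A j
      match A with
      | 0 => exact hs j
      | 1 => exact hk' j
      | 2 => exact hbits x j
      | _ + 3 => exact Nat.zero_le _
  have hBB : Bdd (valueBound C n) (bobInput s k y S (message C s k x ω)) := by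
    constructor
    · intro r
      match r with
      | 0 => exact (show n ≤ _ by omega)
      | 1 => exact (show t ≤ _ by omega)
      | 2 => exact hmsg
      | _ + 3 => exact Nat.zero_le _
    · intro A j
      match A with
      | 0 => exact hs j
      | 1 => exact hk' j
      | 2 => exact hbits y j
      | 3 => exact toArr_le (fun j => (labels_le hc j).trans (by omega)) j
      | 4 => exact (Bool.toNat_le _).trans (by omega)
      | _ + 5 => exact Nat.zero_le _
  obtain ⟨τ₁, T₁, hA1, hA2, -, hA3⟩ := post_progAlice (ω := ω) hBA (C := C) (n := n) (t := t) rfl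
    rfl rfl rfl rfl (fun _ => rfl) rfl hCV hblk h2n hF hN
  obtain ⟨τ₂, T₂, hB1, hB2, -, hB3⟩ := post_progBob (ω := ω) hBB (C := C) (n := n) (t := t)
    (x := toArr fun j => (x j).toNat) (D := density s k) rfl rfl rfl rfl rfl rfl rfl (fun _ => rfl)
    (fun _ => rfl) rfl (fun i => rfl) (fun j _ => toArr_le (labels_le hc) j) hCV hblk h2n hF hN
  refine ⟨T₁ + T₂, ⟨T₁, T₂, ⟨τ₁, hA1, hA3⟩, ⟨τ₂, hB1, hB3⟩, rfl⟩, ?_⟩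
  -- The factor `2 ^ 21` from the steps and `256` from the step cost give `2 ^ 29` for each party.
  have key : ∀ {T N : ℕ}, T ≤ N * stepCost (valueBound C n) →
      N ≤ 2 ^ 21 * (C * n * n.size ^ 4) →
      T ≤ 2 ^ 29 * (C * (C + 22)) * n * n.size ^ 5 := by
    intro T N h1 h2
    refine h1.trans ((Nat.mul_le_mul h2 hcost).trans (le_of_eq ?_))
    ring
  have hA2' : T₁ ≤ (t * (4 * n.size + 8) + (4 * n.size + 4 * loglog n +
      4 * logBuckets (toArr s) (toArr k) t + 25) +
      ((mkSched C n t (toArr s) (toArr k)).stages * (stageBound C n + 1) + 1)) *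
      stepCost (valueBound C n) := hA2
  have h1 := key hA2' (le_trans (by omega) hst)
  have h2 := key hB2 hst
  calc T₁ + T₂ ≤ _ := Nat.add_le_add h1 h2
    _ = _ := by ring

theorem length_message_le {C : ℕ} (hn : 3 ≤ n) (ht : 0 < t) (hk : ∀ i, 1 ≤ k i)
    (hsk : ∀ i, 2 * k i ≤ s i) (x : Fin n → Bool) (ω : ℕ → Bool) :
    ((message C s k x ω).length : ℝ) ≤
      2 ^ 22 * C * Real.logb 2 (Real.logb 2 n) ^ 2 * entropyH s k := by
  have hH := one_le_roundedH hk hsk ht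
  have h1 : (message C s k x ω).length ≤ (2 * loglog n) * (C * loglog n *
      (2 ^ 15 * roundedH (toArr s) (toArr k) t)) := by
    rw [length_message]
    refine Nat.mul_le_mul ?_ (Nat.mul_le_mul_left _ (two_pow_logBuckets_le hH))
    have := (stages_le (t := t) (C := C) (s := toArr s) (k := toArr k) hn).1
    have := one_le_loglog hn
    omega
  have h2 := loglog_le_logb hn
  have h3 := roundedH_le_entropyH hk hsk
  have h4 := (logb_bounds hn).2
  have h5 : (0 : ℝ) ≤ entropyH s k := by
    have : (0 : ℝ) ≤ roundedH (toArr s) (toArr k) t := Nat.cast_nonneg _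
    linarith
  calc ((message C s k x ω).length : ℝ) ≤ ((2 * loglog n) * (C * loglog n *
      (2 ^ 15 * roundedH (toArr s) (toArr k) t)) : ℕ) := by exact_mod_cast h1
    _ = 2 ^ 16 * C * (loglog n : ℝ) ^ 2 * roundedH (toArr s) (toArr k) t := by push_cast; ring
    _ ≤ 2 ^ 16 * C * (5 * Real.logb 2 (Real.logb 2 n)) ^ 2 * (2 * entropyH s k) := by gcongr
    _ = (2 ^ 17 * 25) * (C * Real.logb 2 (Real.logb 2 n) ^ 2 * entropyH s k) := by ring
    _ ≤ 2 ^ 22 * (C * Real.logb 2 (Real.logb 2 n) ^ 2 * entropyH s k) := by gcongr; norm_num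
    _ = _ := by ring

theorem succeeds_of_errSet_eq_empty {C : ℕ} (hC : 1 ≤ C) (hn : 3 ≤ n) (ht : 0 < t)
    (hk : ∀ i, 1 ≤ k i) (hsk : ∀ i, 2 * k i ≤ s i) (hc : Consistent s k x y S) {ω : ℕ → Bool}
    (h : (mkSched C n t (toArr s) (toArr k)).errSet ω (density s k) (toArr (labels S))
      (toArr fun j => (x j).toNat) (toArr fun j => (y j).toNat)
      (mkSched C n t (toArr s) (toArr k)).stages = ∅) : (protocol C).Succeeds s k x y S ω := by
  obtain ⟨T, hT, -⟩ := exists_runs hC hn ht hk hsk hc ω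
  suffices hx : List.ofFn x = result C s k x y S ω from
    ⟨message C s k x ω, T, by rw [hx]; exact hT⟩
  refine List.ext_getElem (by simp [result]) fun j hj hj' => ?_
  have hjn : j < n := by simpa using hj
  have h1 : j ∉ (mkSched C n t (toArr s) (toArr k)).errSet ω (density s k) (toArr (labels S))
      (toArr fun j => (x j).toNat) (toArr fun j => (y j).toNat)
      (mkSched C n t (toArr s) (toArr k)).stages := by rw [h]; exact Finset.notMem_empty _
  rw [Sched.errSet, Finset.mem_filter, not_and, not_not] at h1
  have h2 := h1 (Finset.mem_range.2 hjn)
  simp only [result, List.getElem_ofFn, List.getElem_map, List.getElem_range]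
  rw [← h2, toArr, dif_pos hjn]
  cases x ⟨j, hjn⟩ <;> simp

theorem half_pow_eq_ofReal (m : ℕ) : (2⁻¹ : ENNReal) ^ m = ENNReal.ofReal ((2 : ℝ)⁻¹ ^ m) := by
  rw [ENNReal.ofReal_pow (by norm_num), ENNReal.ofReal_inv_of_pos (by norm_num),
    ENNReal.ofReal_ofNat]

/-- The index `i₀` is arbitrary because the rounded entropy dominates every `k i`. The constant `a +
3` is at least `3`, as the union bound requires, and exceeds `a + 1`, which yields the power of `s`.
-/
theorem coinTape_not_succeeds_le (a : ℕ) (hn : 3 ≤ n) (ht : 0 < t) (hk : ∀ i, 1 ≤ k i)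
    (hsk : ∀ i, 2 * k i ≤ s i) (hc : Consistent s k x y S) (i₀ : Fin t) :
    coinTape {ω | ¬ (protocol (a + 3)).Succeeds s k x y S ω} ≤
      ENNReal.ofReal ((2 : ℝ) ^ (-(1 * (k i₀ : ℝ))) + 1 / (∑ i, (s i : ℝ)) ^ a) := by
  set P := mkSched (a + 3) n t (toArr s) (toArr k) with hP
  have hH := one_le_roundedH hk hsk ht
  have hlam : 1 ≤ P.lam := one_le_loglog hn
  have hβ : 2 ^ 14 * roundedH (toArr s) (toArr k) t < 2 ^ P.β := lt_two_pow_logBuckets _ _ _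
  have hblock : ∀ j, 0 < toArr (labels S) j →
      ∃ i, density s k (toArr (labels S) j) = (s i / k i).size := by
    intro j hj
    obtain ⟨-, i, -, hl⟩ := exists_block hc hj
    exact ⟨i, by rw [hl, density_succ]⟩
  have h2lam : n.size < 2 ^ P.lam := Nat.lt_size_self _
  have main := Sched.coinTape_errSet_le (P := P) (D := density s k) (lab := toArr (labels S))
    (x := toArr fun j => (x j).toNat) (y := toArr fun j => (y j).toNat) (bits_le x) (bits_le y)
    (show 3 ≤ a + 3 by omega) hlam hH (fewSparse hc rfl) hβ (card_cand_le hk hsk hc) ?_ ?_ ?_ ?_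
  · have hcard : (P.cand (density s k) (toArr (labels S)) (2 ^ P.lam)).card ≤ ∑ i, s i :=
      (card_cand_le_sum hc _).trans (Finset.sum_le_sum_of_subset (Finset.filter_subset _ _))
    have hspos : 0 < ∑ i, s i :=
      lt_of_lt_of_le (by have := hk i₀; have := hsk i₀; omega : 0 < s i₀)
        (Finset.single_le_sum (f := s) (fun _ _ => Nat.zero_le _) (Finset.mem_univ i₀))
    -- One of the `a + 1` factors pays for the union over the at most `∑ i, s i` candidates of stage
    -- `λ`; it uses `∑ i, s i ≤ n < 2 ^ n.size` and `n.size < 2 ^ λ`.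
    have hspow : (∑ i, s i) ^ (a + 1) ≤ 2 ^ (2 * P.reps P.lam) := by
      calc (∑ i, s i) ^ (a + 1) ≤ (2 ^ n.size) ^ (a + 1) :=
            Nat.pow_le_pow_left ((sum_s_le hc).trans (Nat.lt_size_self n).le) _
        _ = 2 ^ (n.size * (a + 1)) := (pow_mul _ _ _).symm
        _ ≤ _ := by
          refine Nat.pow_le_pow_right (by norm_num) ?_
          have h1 : P.reps P.lam = (a + 3) * 2 ^ P.lam * P.lam := rfl
          have h2 : (a + 1) * n.size ≤ (a + 3) * 2 ^ P.lam := Nat.mul_le_mul (by omega) h2lam.le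
          have h3 : (a + 3) * 2 ^ P.lam * 1 ≤ (a + 3) * 2 ^ P.lam * P.lam :=
            Nat.mul_le_mul_left _ hlam
          rw [h1, mul_comm]
          omega
    have hsub : {ω | ¬ (protocol (a + 3)).Succeeds s k x y S ω} ⊆
        {ω | P.errSet ω (density s k) (toArr (labels S)) (toArr fun j => (x j).toNat)
          (toArr fun j => (y j).toNat) P.stages ≠ ∅} := fun ω hω he =>
      hω (succeeds_of_errSet_eq_empty (by omega) hn ht hk hsk hc he)
    refine (measure_mono hsub).trans (main.trans ?_)
    rw [ENNReal.ofReal_add (by positivity) (by positivity)]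
    refine add_le_add ?_ ?_
    · rw [half_pow_eq_ofReal]
      refine ENNReal.ofReal_le_ofReal ?_
      rw [one_mul, Real.rpow_neg (by norm_num), Real.rpow_natCast, inv_pow]
      gcongr
      · norm_num
      · exact k_le_roundedH hk hsk i₀
    · rw [half_pow_eq_ofReal, ← ENNReal.ofReal_natCast, ← ENNReal.ofReal_mul (Nat.cast_nonneg _)]
      refine ENNReal.ofReal_le_ofReal ?_
      have hs' : (0 : ℝ) < ∑ i, (s i : ℝ) := by exact_mod_cast hspos
      have hc' : ((P.cand (density s k) (toArr (labels S)) (2 ^ P.lam)).card : ℝ) ≤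
          ∑ i, (s i : ℝ) := by exact_mod_cast hcard
      have hp' : (∑ i, (s i : ℝ)) ^ (a + 1) ≤ 2 ^ (2 * P.reps P.lam) := by exact_mod_cast hspow
      rw [inv_pow, ← div_eq_mul_inv, div_le_div_iff₀ (by positivity) (by positivity), one_mul]
      calc _ ≤ (∑ i, (s i : ℝ)) * (∑ i, (s i : ℝ)) ^ a := by gcongr
        _ = (∑ i, (s i : ℝ)) ^ (a + 1) := by ring
        _ ≤ _ := hp'
  · intro j hjP hne
    have hj : j < n := hjP
    rw [bits_ne_iff hj] at hne
    have hex : ∃ i, (⟨j, hj⟩ : Fin n) ∈ S i := by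
      by_contra hcon
      push Not at hcon
      exact hne (hc.eq_outside _ hcon)
    obtain ⟨i, hi⟩ := hex
    rw [toArr, dif_pos hj, labels_of_mem hc hi]
    exact Nat.succ_pos _
  · intro j hj
    obtain ⟨i, hi⟩ := hblock j hj
    rw [hi]
    exact one_le_size_div hk hsk i
  · intro j hj
    obtain ⟨i, hi⟩ := hblock j hj
    rw [hi]
    have h1 := mul_size_le_roundedH s k i
    have h2 : (s i / k i).size ≤ k i * (s i / k i).size := Nat.le_mul_of_pos_left _ (hk i)
    omega
  · intro j hj
    obtain ⟨i, hi⟩ := hblock j hj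
    rw [hi]
    exact (size_div_le hc i).trans h2lam.le

end

end AsymDE

/-! ### The theorem, with explicit constants. -/

theorem mainTheorem8 (a : ℕ) :
    ∃ (P : AsymDE.OneRoundProtocol) (C c : ℝ) (d : ℕ), 0 < C ∧ 0 < c ∧
      ∀ (n t : ℕ) (s k : Fin t → ℕ) (ht : 0 < t), 3 ≤ n →
        (∀ i, 1 ≤ k i) → (∀ i j, i ≤ j → k j ≤ k i) → (∀ i, 2 * k i ≤ s i) →
        ∀ (x y : Fin n → Bool) (S : Fin t → Finset (Fin n)), AsymDE.Consistent s k x y S →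
          (∀ ω : ℕ → Bool, ∃ (w z : List Bool) (T : ℕ), P.Runs s k x y S ω w z T ∧
            (w.length : ℝ) ≤ C * Real.logb 2 (Real.logb 2 n) ^ 2 * AsymDE.entropyH s k ∧
            (T : ℝ) ≤ C * n * Real.logb 2 n ^ d) ∧
          AsymDE.coinTape {ω | ¬ P.Succeeds s k x y S ω} ≤
            ENNReal.ofReal ((2 : ℝ) ^ (-(c * (k ⟨t - 1, Nat.sub_lt ht Nat.one_pos⟩ : ℝ))) +
              1 / (∑ i, (s i : ℝ)) ^ a) := by
  -- The `2 ^ 35` is `2 ^ 30` from the running time times `2 ^ 5` from `n.size ≤ 2 * logb 2 n`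
  -- raised to the fifth power, and `a + 25` is `(a + 3) + 22`; the constant for the message length
  -- is smaller.
  refine ⟨AsymDE.protocol (a + 3), 2 ^ 35 * ((a + 3) * (a + 25)), 1, 5, by positivity, one_pos, ?_⟩
  intro n t s k ht hn hk _ hsk x y S hc
  refine ⟨fun ω => ?_, AsymDE.coinTape_not_succeeds_le a hn ht hk hsk hc _⟩
  obtain ⟨T, hT, hTle⟩ := AsymDE.exists_runs (C := a + 3) (by omega) hn ht hk hsk hc ω
  refine ⟨_, _, T, hT, ?_, ?_⟩
  · refine (AsymDE.length_message_le hn ht hk hsk x ω).trans ?_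
    have h1 := AsymDE.roundedH_le_entropyH hk hsk
    have h2 : (0 : ℝ) ≤ AsymDE.entropyH s k := by
      have : (0 : ℝ) ≤ AsymDE.roundedH (AsymDE.toArr s) (AsymDE.toArr k) t := Nat.cast_nonneg _
      linarith
    have ha : (0 : ℝ) ≤ a := Nat.cast_nonneg a
    gcongr
    · norm_num
    · norm_num
    · push_cast
      nlinarith
  · have hl := AsymDE.size_le_two_mul_logb hn
    have hlog := (AsymDE.logb_bounds hn).1
    calc (T : ℝ) ≤ ((2 ^ 30 * ((a + 3) * (a + 3 + 22)) * n * n.size ^ 5 : ℕ) : ℝ) := by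
          exact_mod_cast hTle
      _ = 2 ^ 30 * ((a + 3) * (a + 25)) * n * (n.size : ℝ) ^ 5 := by push_cast; ring
      _ ≤ 2 ^ 30 * ((a + 3) * (a + 25)) * n * (2 * Real.logb 2 n) ^ 5 := by gcongr
      _ = _ := by ring
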